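/- Let $\mathcal G$ be the infinite regular tree of degree $\delta\ge 3$ and $v_1$ a node of $\mathcal G$ (the rumor source). The rumor starts at $v_1$; a node $i$ that has got the rumor passes it on to each neighbour $j$ after a time $\tau_{ij}$, where the spreading times $\tau_{ij}$ are independent exponential random variables of mean $1$, and a node keeps the rumor forever. Let $G_n$ be the network formed by the infected nodes when exactly $n$ nodes are infected, and let $\hat V_n$ be the maximum likelihood estimate of the source given $G_n$, i.e. a node $v$ of $G_n$ that maximizes the probability of observing $G_n$ when $v$ is the source, ties being broken uniformly at random. Let $d_{\mathcal G}$ be the graph distance. Put \[ I_x(a,b)=\frac{\Gamma(a+b)}{\Gamma(a)\Gamma(b)}\int_0^x t^{a-1}(1-t)^{b-1}\,dt,\qquad C(\delta)=\delta\, I_{1/2}\Big(\tfrac{1}{\delta-2},\tfrac{\delta-1}{\delta-2}\Big)-(\delta-1), \] let $x^{\overline k}=x(x+1)\cdots(x+k-1)$ and $\zeta_k^d(x)=\sum_{1\le j_1<\cdots<j_d\le k}\prod_{i=1}^d\frac1{j_i+x}$ (with $\zeta_k^0(x)=1$). Let $f(0)=C(3)$ and, for $d\ge 1$, \[ f(d)=3\cdot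 2^{d-1}(-1)^d\left(\frac14+\sum_{l=1}^d(-1)^l\left(\frac{(\ln 2)^l}{l!}-2+\sum_{m=0}^l\frac{(\ln 2)^m}{m!}\right)\right). \] Let $g(\delta,0,m)=C(\delta)$ and, for $d\ge1$ and $m\ge d+1$, \[ g(\delta,d,m)=\delta(\delta-1)^{d-1}\sum_{k=d+1}^m p_1(\delta,d,k)\,p_2(\delta,k), \] \[ p_1(\delta,d,k)=\frac{2}{(\delta-2)^d}\,\frac{\big(\frac1{\delta-2}\big)^{\overline{k-1}}}{\big(\frac2{\delta-2}\big)^{\overline{k}}}\,\zeta_{k-2}^{d-1}\Big(\frac1{\delta-2}\Big), \] \[ p_2(\delta,k)=I_{1/2}\Big(k-1+\tfrac1{\delta-2},\tfrac{\delta-1}{\delta-2}\Big)-(\delta-1)\,I_{1/2}\Big(k-1+\tfrac{\delta-1}{\delta-2},\tfrac1{\delta-2}\Big), \] and let $\epsilon_m=e^2(8+5m+m^2)2^{-m+3}$. If $\delta=3$, then for every $d\ge 0$ \[ \lim_{n\to\infty}\Pr\{d_{\mathcal G}(\hat V_n,v_1)\le d\}=\sum_{l=0}^d f(l). \] For every $\delta\ge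 3$ and $d\ge 0$ the limit $\lim_{n\to\infty}\Pr\{d_{\mathcal G}(\hat V_n,v_1)\le d\}$ exists, and for every $m\ge d+1$ \[ 0\le \lim_{n\to\infty}\Pr\{d_{\mathcal G}(\hat V_n,v_1)\le d\}-\sum_{l=0}^d g(\delta,l,m)\le d\cdot\epsilon_m. \] -/

import Mathlib

open MeasureTheory ProbabilityTheory Filter Topology

noncomputable section

namespace RumorSource

/-! ### The spreading model -/

section Model

variable {V Ω : Type*} {G : SimpleGraph V}

/-- The time at which `v` gets the rumor when `s` is the source and `τ (i, j) ω` is the time the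
rumor needs to pass from `i` to its neighbour `j` after `i` has got it: the least total spreading
time of a path from `s` to `v` (in a tree there is exactly one such path). -/
def infectionTime (τ : G.Dart → Ω → ℝ) (s v : V) (ω : Ω) : ℝ :=
  ⨅ p : G.Path s v, ((p : G.Walk s v).darts.map fun e => τ e ω).sum

/-- The set of nodes that possess the rumor at time `t` when `s` is the source. -/
def infectedAt (τ : G.Dart → Ω → ℝ) (s : V) (ω : Ω) (t : ℝ) : Set V :=
  {v | infectionTime τ s v ω ≤ t}

open Classical in
/-- The network `G_n` of `n` infected nodes when `s` is the source, given by its set of nodes: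
the set of infected nodes at a time at which exactly `n` nodes are infected. (The infected sets
increase with time, so there is at most one such set; `∅` is a dummy value if there is none.) -/
def infectedNetwork (τ : G.Dart → Ω → ℝ) (s : V) (n : ℕ) (ω : Ω) : Finset V :=
  if h : ∃ S : Finset V, S.card = n ∧ ∃ t : ℝ, infectedAt τ s ω t = (S : Set V) then h.choose
  else ∅

variable [MeasurableSpace Ω]

/-- The likelihood `Pr{S | v}`: the probability to observe the network with set of nodes `S`
if `v` is the source. -/
def likelihood (P : Measure Ω) (τ : G.Dart → Ω → ℝ) (S : Finset V) (v : V) : ℝ :=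
  P.real {ω | infectedNetwork τ v S.card ω = S}

open Classical in
/-- The nodes of `S` at which the likelihood is maximal among the nodes of `S`. -/
def mlNodes (P : Measure Ω) (τ : G.Dart → Ω → ℝ) (S : Finset V) : Finset V :=
  S.filter fun v => ∀ w ∈ S, likelihood P τ S w ≤ likelihood P τ S v

open Classical in
/-- `Vhat` is the maximum likelihood estimate of the source from the network of `n` infected nodes
(spread from the source `s`), ties being broken uniformly at random: given that the network is `S`,
`Vhat` is uniformly distributed on the nodes of `S` of maximal likelihood. -/
structure IsMLEstimate (P : Measure Ω) (τ : G.Dart → Ω → ℝ) (s : V) (n : ℕ) (Vhat : Ω → V) :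
    Prop where
  measurableSet_eq : ∀ v, MeasurableSet {ω | Vhat ω = v}
  law : ∀ (S : Finset V) (v : V),
    P.real {ω | infectedNetwork τ s n ω = S ∧ Vhat ω = v} =
      P.real {ω | infectedNetwork τ s n ω = S} *
        (if v ∈ mlNodes P τ S then 1 / ((mlNodes P τ S).card : ℝ) else 0)

end Model

/-! ### The explicit quantities -/

/-- The regularized incomplete beta function `I_x(a, b)`. -/
def regIncBeta (x a b : ℝ) : ℝ :=
  Real.Gamma (a + b) / (Real.Gamma a * Real.Gamma b) *
    ∫ t in (0 : ℝ)..x, t ^ (a - 1) * (1 - t) ^ (b - 1)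

/-- The limit of the correct detection probability in the regular tree of degree `δ`. -/
def correctLimit (δ : ℕ) : ℝ :=
  δ * regIncBeta (1 / 2) (1 / ((δ : ℝ) - 2)) (((δ : ℝ) - 1) / ((δ : ℝ) - 2)) - ((δ : ℝ) - 1)

def f (d : ℕ) : ℝ :=
  if d = 0 then correctLimit 3
  else
    3 * 2 ^ (d - 1) * (-1) ^ d *
      (1 / 4 + ∑ l ∈ Finset.Icc 1 d, (-1) ^ l *
        (Real.log 2 ^ l / (l.factorial : ℝ) - 2 +
          ∑ m ∈ Finset.range (l + 1), Real.log 2 ^ m / (m.factorial : ℝ)))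

/-- The rising factorial `x (x + 1) ⋯ (x + k - 1)`. -/
def risingFactorial (x : ℝ) (k : ℕ) : ℝ :=
  ∏ i ∈ Finset.range k, (x + i)

/-- `ζ_k^d(x)`: the sum over `1 ≤ j₁ < ⋯ < j_d ≤ k` of `∏ 1 / (j_i + x)`. -/
def zetaSum (k d : ℕ) (x : ℝ) : ℝ :=
  ∑ J ∈ (Finset.Icc 1 k).powersetCard d, ∏ j ∈ J, 1 / ((j : ℝ) + x)

def p₁ (δ d k : ℕ) : ℝ :=
  2 / ((δ : ℝ) - 2) ^ d *
    (risingFactorial (1 / ((δ : ℝ) - 2)) (k - 1) / risingFactorial (2 / ((δ : ℝ) - 2)) k) *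
    zetaSum (k - 2) (d - 1) (1 / ((δ : ℝ) - 2))

def p₂ (δ k : ℕ) : ℝ :=
  regIncBeta (1 / 2) ((k : ℝ) - 1 + 1 / ((δ : ℝ) - 2)) (((δ : ℝ) - 1) / ((δ : ℝ) - 2)) -
    ((δ : ℝ) - 1) *
      regIncBeta (1 / 2) ((k : ℝ) - 1 + ((δ : ℝ) - 1) / ((δ : ℝ) - 2)) (1 / ((δ : ℝ) - 2))

def g (δ d m : ℕ) : ℝ :=
  if d = 0 then correctLimit δ
  else δ * ((δ : ℝ) - 1) ^ (d - 1) * ∑ k ∈ Finset.Icc (d + 1) m, p₁ δ d k * p₂ δ k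

def ε (m : ℕ) : ℝ :=
  Real.exp 1 ^ 2 * (8 + 5 * (m : ℝ) + (m : ℝ) ^ 2) * (2 : ℝ) ^ (-(m : ℤ) + 3)

end RumorSource

end

noncomputable section

namespace RumorSource

open scoped Classical

/-! ### Rooted trees -/

section Tree

variable {V : Type*} {G : SimpleGraph V}

/-! Exponential clocks are memoryless, so the infected set grows by a uniformly chosen boundary node
at each step. In a regular tree the size of the boundary depends only on the number of infected
nodes (`card_bdry`), so all growth histories of a given length are equally likely, and the
likelihood of `v` given `S` is the number `hist` of histories that build `S` from `v`, divided by a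
constant (`IsPassage.measureReal_stageEvent`, `ExpSpread.likelihood_eq`). For adjacent `v` and `w`,
interleaving histories on the two sides of the edge shows that the ratio of these numbers is the
ratio of the sizes of the two sides (`hist_mul_card_side`). Hence every maximum likelihood node lies
on the side of a strict majority, for every edge (`mem_side_of_hist_max`). Up to ties, the estimate
is below `w` exactly if more than half of the infected nodes are.

Write `α = 1 / (δ - 2)`. Once `w` or its parent has been infected, the number of infected nodes
below `w` evolves as a Pólya urn (`mean_desc`). The urn is a beta mixture of binomials
(`urnMean_eq_integral`), so the probability of a majority tends to an incomplete beta function at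
`1/2`; ties do not matter because the beta law has no atom there. Summing over the arrival time,
whose law is `p₁` (`arrival_eq`), gives the limit of the probability that the estimate is below `w`
(`ExpSpread.tendsto_estimate_desc`).

The distance is at most `d` unless the estimate is below one of the `δ (δ - 1) ^ d` nodes `w` at
distance `d + 1`. The urn below `w` may be started at the arrival of `w` or of its parent. Using the
first description for distance `d + 1` and the second for `d + 2`, both series have the same weights
`p₁ δ (d + 1)`, and the increment of the distribution function is a series with terms `p₁ * p₂`
(`ExpSpread.tendsto_dist_le`).

For the error bound, `δ (δ - 1) ^ l * p₁` is at most one, being the probability that the next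
infected node has distance `l + 1`, and integration by parts shows that `p₂` is nonnegative and
exponentially small (`p₂_mem_Icc`). For `δ = 3`, `α = 1` makes both factors elementary, and the
generating function of the sums `ζ` turns the series into an integral that satisfies a two-term
recursion (`hasSum_zetaSum`, `zetaIntegral_succ`). -/

lemma dist_comm_tree (u v : V) : G.dist u v = G.dist v u := SimpleGraph.dist_comm

lemma exists_unique_toward (hG : G.IsTree) {r v : V} (hv : v ≠ r) :
    ∃! p, G.Adj p v ∧ G.dist r p + 1 = G.dist r v := by
  obtain ⟨w, hw, hl⟩ := hG.connected.exists_path_of_dist r v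
  have hnn : ¬ w.Nil := fun h => hv h.eq.symm
  refine ⟨w.penultimate, ⟨w.adj_penultimate hnn, ?_⟩, ?_⟩
  · have h1 := SimpleGraph.dist_le w.dropLast
    have h2 : w.dropLast.length + 1 = w.length := by
      have := w.length_dropLast_add_one hnn
      exact this
    rcases hG.dist_eq_dist_add_one_of_adj r (w.adj_penultimate hnn) with h | h <;> omega
  · rintro p ⟨hp, hd⟩
    obtain ⟨w', hw', hl'⟩ := hG.connected.exists_path_of_dist r p
    have hv' : v ∉ w'.support := by
      intro hmem
      have := SimpleGraph.dist_le (w'.takeUntil v hmem)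
      have := w'.length_takeUntil_le_length hmem
      omega
    have h3 : w'.concat hp = w := by
      have := (hG.existsUnique_path r v).unique (hw'.concat hv' hp) hw
      exact this
    rw [← h3, SimpleGraph.Walk.penultimate_concat]

/-- The neighbour of `v` on the path to `r`. -/
def par (G : SimpleGraph V) (r v : V) : V :=
  if h : ∃ p, G.Adj p v ∧ G.dist r p + 1 = G.dist r v then h.choose else v

lemma par_spec (hG : G.IsTree) {r v : V} (hv : v ≠ r) :
    G.Adj (par G r v) v ∧ G.dist r (par G r v) + 1 = G.dist r v := by
  have h := (exists_unique_toward hG hv).exists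
  unfold par
  rw [dif_pos h]
  exact h.choose_spec

lemma par_eq (hG : G.IsTree) {r v p : V} (hp : G.Adj p v) (hd : G.dist r p + 1 = G.dist r v) :
    par G r v = p := by
  have hv : v ≠ r := by rintro rfl; simp at hd
  exact (exists_unique_toward hG hv).unique (par_spec hG hv) ⟨hp, hd⟩

lemma dist_eq_zero' (hG : G.IsTree) {u v : V} (h : G.dist u v = 0) : u = v :=
  hG.connected.dist_eq_zero_iff.1 h

/-- The component of `v` after removal of the edge `u v`. -/
def side (G : SimpleGraph V) (u v : V) : Set V := {y | G.dist y u = G.dist y v + 1}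

lemma mem_side {u v y : V} : y ∈ side G u v ↔ G.dist y u = G.dist y v + 1 := Iff.rfl

lemma notMem_side (hG : G.IsTree) {u v y : V} (h : G.Adj u v) :
    y ∉ side G u v ↔ y ∈ side G v u := by
  rw [mem_side, mem_side]
  rcases hG.dist_eq_dist_add_one_of_adj y h with h | h <;> omega

/-- A path from outside of `side u v` into it uses the edge `u v`. -/
lemma dist_cross (hG : G.IsTree) {u v x y : V} (h : G.Adj u v) (hx : x ∉ side G u v)
    (hy : y ∈ side G u v) : G.dist x y = G.dist x u + 1 + G.dist v y := by
  have hxv : G.dist x v = G.dist x u + 1 := (notMem_side hG h).1 hx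
  obtain ⟨n, hn⟩ : ∃ n, G.dist v y = n := ⟨_, rfl⟩
  induction n using Nat.strong_induction_on generalizing y with
  | _ n ih =>
    by_cases hyv : y = v
    · subst hyv; simp [hxv]
    obtain ⟨ha, hd⟩ := par_spec hG hyv
    set y1 := par G v y with hy1
    have hside : y1 ∈ side G u v := by
      rw [mem_side] at hy ⊢
      rw [dist_comm_tree y1 v]
      rw [dist_comm_tree y v] at hy
      rcases hG.dist_eq_dist_add_one_of_adj u ha with h1 | h1 <;>
      rcases hG.dist_eq_dist_add_one_of_adj y1 h with h2 | h2 <;>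
      rw [dist_comm_tree y1 u, dist_comm_tree y1 v] at h2 <;>
      rw [dist_comm_tree y u] at hy <;> rw [dist_comm_tree y1 u] <;> omega
    have ih1 := ih _ (by omega) hside rfl
    rcases hG.dist_eq_dist_add_one_of_adj x ha with h1 | h1
    -- If `x` were closer to `y` than to `y1`, then `y` would be the neighbour of `y1` towards `x`.
    -- But that neighbour is `u` if `y1 = v`, and otherwise, by the induction hypothesis, the next
    -- node `y2` on the way to `v`; neither can be `y`.
    · exfalso
      have hpar := par_eq hG ha.symm h1.symm
      by_cases hv1 : y1 = v
      · have : par G x v = u := par_eq hG h hxv.symm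
        rw [hv1] at hpar
        rw [hpar] at this
        subst this
        rw [mem_side] at hy; simp at hy
      · obtain ⟨ha2, hd2⟩ := par_spec hG hv1
        set y2 := par G v y1 with hy2
        have hside2 : y2 ∈ side G u v := by
          rw [mem_side] at hside ⊢
          rw [dist_comm_tree y2 v]
          rw [dist_comm_tree y1 v] at hside
          rcases hG.dist_eq_dist_add_one_of_adj u ha2 with h1 | h1 <;>
          rcases hG.dist_eq_dist_add_one_of_adj y2 h with h2 | h2 <;>
          rw [dist_comm_tree y2 u, dist_comm_tree y2 v] at h2 <;>
          rw [dist_comm_tree y1 u] at hside <;> rw [dist_comm_tree y2 u] <;> omega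
        have ih2 := ih _ (by omega) hside2 rfl
        have := par_eq hG (r := x) ha2 (by omega)
        rw [hpar] at this
        rw [← this] at hd2
        omega
    · omega

lemma edge_cross (hG : G.IsTree) {u v x y : V} (h : G.Adj u v) (hx : x ∉ side G u v)
    (hy : y ∈ side G u v) (hxy : G.Adj x y) : x = u ∧ y = v := by
  have h1 := dist_cross hG h hx hy
  rw [SimpleGraph.dist_eq_one_iff_adj.2 hxy] at h1
  exact ⟨dist_eq_zero' hG (by omega), (dist_eq_zero' hG (by omega)).symm⟩

lemma mem_side_self {u v : V} (h : G.Adj u v) : v ∈ side G u v := by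
  rw [mem_side, SimpleGraph.dist_self, SimpleGraph.dist_eq_one_iff_adj.2 h.symm]

lemma notMem_side_self {u v : V} : u ∉ side G u v := by
  rw [mem_side, SimpleGraph.dist_self]; omega

/-- The descendants of `w` in the tree with root `r`. -/
def desc (G : SimpleGraph V) (r w : V) : Set V := side G (par G r w) w

lemma mem_desc_self (hG : G.IsTree) {r w : V} (hw : w ≠ r) : w ∈ desc G r w :=
  mem_side_self (par_spec hG hw).1

lemma par_notMem_desc {r w : V} : par G r w ∉ desc G r w := notMem_side_self

lemma root_notMem_desc (hG : G.IsTree) {r w : V} (hw : w ≠ r) : r ∉ desc G r w := by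
  have := (par_spec hG hw).2
  rw [desc, mem_side]; omega

/-- The edge from the parent of `w` to `w` is the only one that enters the set of descendants. This
is the form in which descendants are handled by induction on the distance from the root. -/
lemma mem_desc_iff (hG : G.IsTree) {r w c : V} (hw : w ≠ r) (hc : c ≠ r) :
    c ∈ desc G r w ↔ c = w ∨ par G r c ∈ desc G r w := by
  obtain ⟨ha, hd⟩ := par_spec hG hw
  obtain ⟨hac, hdc⟩ := par_spec hG hc
  constructor
  · intro h
    by_contra! hcon
    exact hcon.1 (edge_cross hG ha hcon.2 h hac).2
  · rintro (rfl | h)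
    · exact mem_desc_self hG hw
    · by_contra hcon
      obtain ⟨h1, h2⟩ := edge_cross hG ha hcon h hac.symm
      rw [h2, h1] at hdc
      omega

/-- `S` is a subtree that contains the root `r`. -/
def Good (G : SimpleGraph V) (r : V) (S : Finset V) : Prop :=
  r ∈ S ∧ ∀ v ∈ S, v ≠ r → par G r v ∈ S

/-- A subtree contains the first step of the path from its root to any of its nodes. -/
lemma Good.exists_first_step (hG : G.IsTree) {r z : V} {S : Finset V} (hS : Good G r S)
    (hz : z ∈ S) (hzr : z ≠ r) : ∃ x ∈ S, G.Adj x r ∧ G.dist z x + 1 = G.dist z r := by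
  obtain ⟨n, hn⟩ : ∃ n, G.dist r z = n := ⟨_, rfl⟩
  induction n generalizing z with
  | zero => exact absurd (dist_eq_zero' hG hn).symm hzr
  | succ n ih =>
    obtain ⟨ha, hd⟩ := par_spec hG hzr
    by_cases hp : par G r z = r
    · rw [hp] at ha
      refine ⟨z, hz, ha.symm, ?_⟩
      rw [SimpleGraph.dist_self, SimpleGraph.dist_eq_one_iff_adj.2 ha.symm]
    · obtain ⟨x, hx, hxr, hxd⟩ := ih (hS.2 z hz hzr) hp (by omega)
      refine ⟨x, hx, hxr, ?_⟩
      have h1 := hG.connected.dist_triangle (u := z) (v := par G r z) (w := x)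
      rw [SimpleGraph.dist_eq_one_iff_adj.2 ha.symm] at h1
      rw [dist_comm_tree _ r] at hxd
      rcases hG.dist_eq_dist_add_one_of_adj z hxr with h2 | h2 <;>
        rw [dist_comm_tree z r] at * <;> omega

variable [G.LocallyFinite]

/-- The neighbours of `v` that are farther away from `r`. -/
def children (G : SimpleGraph V) [G.LocallyFinite] (r v : V) : Finset V :=
  (G.neighborFinset v).filter fun c => G.dist r c = G.dist r v + 1

lemma mem_children (hG : G.IsTree) {r v c : V} : c ∈ children G r v ↔ c ≠ r ∧ par G r c = v := by
  rw [children, Finset.mem_filter, SimpleGraph.mem_neighborFinset]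
  constructor
  · rintro ⟨h, hd⟩
    exact ⟨by rintro rfl; simp at hd, par_eq hG h hd.symm⟩
  · rintro ⟨h, rfl⟩
    exact ⟨(par_spec hG h).1, (par_spec hG h).2.symm⟩

lemma card_children_root {δ : ℕ} (hreg : G.IsRegularOfDegree δ) (r : V) :
    (children G r r).card = δ := by
  rw [children, Finset.filter_true_of_mem]
  · exact hreg r
  · intro c hc
    rw [SimpleGraph.mem_neighborFinset] at hc
    simp [SimpleGraph.dist_eq_one_iff_adj.2 hc]

lemma card_children (hG : G.IsTree) {δ : ℕ} (hreg : G.IsRegularOfDegree δ) {r v : V}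
    (hv : v ≠ r) : (children G r v).card = δ - 1 := by
  have h : children G r v = (G.neighborFinset v).erase (par G r v) := by
    ext c
    rw [children, Finset.mem_filter, Finset.mem_erase, SimpleGraph.mem_neighborFinset]
    constructor
    · rintro ⟨h, hd⟩
      refine ⟨?_, h⟩
      rintro rfl
      have := (par_spec hG hv).2
      omega
    · rintro ⟨hne, h⟩
      refine ⟨h, ?_⟩
      rcases hG.dist_eq_dist_add_one_of_adj r h with h1 | h1
      · exact absurd (par_eq hG h.symm h1.symm).symm hne
      · exact h1
  rw [h, Finset.card_erase_of_mem]
  · rw [SimpleGraph.card_neighborFinset_eq_degree, hreg v]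
  · rw [SimpleGraph.mem_neighborFinset]; exact (par_spec hG hv).1.symm

/-- The nodes outside of `S` whose parent is in `S`. -/
def bdry (G : SimpleGraph V) [G.LocallyFinite] (r : V) (S : Finset V) : Finset V :=
  S.biUnion (children G r) \ S

lemma mem_bdry (hG : G.IsTree) {r : V} {S : Finset V} {u : V} :
    u ∈ bdry G r S ↔ u ∉ S ∧ u ≠ r ∧ par G r u ∈ S := by
  simp only [bdry, Finset.mem_sdiff, Finset.mem_biUnion, mem_children hG]
  constructor
  · rintro ⟨⟨a, ha, h, rfl⟩, h'⟩; exact ⟨h', h, ha⟩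
  · rintro ⟨h', h, ha⟩; exact ⟨⟨_, ha, h, rfl⟩, h'⟩

lemma children_disjoint (hG : G.IsTree) (r : V) {x y : V} (h : x ≠ y) :
    Disjoint (children G r x) (children G r y) := by
  rw [Finset.disjoint_left]
  intro a ha hb
  rw [mem_children hG] at ha hb
  exact h (ha.2.symm.trans hb.2)

lemma card_biUnion_children (hG : G.IsTree) (r : V) (S : Finset V) :
    (S.biUnion (children G r)).card = ∑ x ∈ S, (children G r x).card :=
  Finset.card_biUnion fun _ _ _ _ h => children_disjoint hG r h

/-- The children of nodes of `S` are the boundary together with `S` without the root. The root has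
`δ` children and every other node `δ - 1`, which gives `δ + (|S| - 1)(δ - 1) - (|S| - 1)`. -/
lemma card_bdry (hG : G.IsTree) {δ : ℕ} (hδ : 3 ≤ δ) (hreg : G.IsRegularOfDegree δ) {r : V}
    {S : Finset V} (hS : Good G r S) : (bdry G r S).card = (δ - 2) * S.card + 2 := by
  have h1 : S.biUnion (children G r) = bdry G r S ∪ S.erase r := by
    ext u
    simp only [Finset.mem_union, mem_bdry hG, Finset.mem_biUnion, mem_children hG,
      Finset.mem_erase]
    constructor
    · rintro ⟨a, ha, h, rfl⟩
      by_cases hu : u ∈ S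
      · exact Or.inr ⟨h, hu⟩
      · exact Or.inl ⟨hu, h, ha⟩
    · rintro (⟨h, h', ha⟩ | ⟨h, h'⟩)
      · exact ⟨_, ha, h', rfl⟩
      · exact ⟨_, hS.2 u h' h, h, rfl⟩
  have h2 : Disjoint (bdry G r S) (S.erase r) := by
    rw [Finset.disjoint_left]
    intro a ha hb
    exact ((mem_bdry hG).1 ha).1 (Finset.mem_of_mem_erase hb)
  have h3 := card_biUnion_children hG r S
  rw [h1, Finset.card_union_of_disjoint h2, Finset.card_erase_of_mem hS.1,
    ← Finset.add_sum_erase _ _ hS.1, card_children_root hreg,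
    Finset.sum_congr rfl (fun x hx => card_children hG hreg (Finset.ne_of_mem_erase hx)),
    Finset.sum_const, Finset.card_erase_of_mem hS.1, smul_eq_mul] at h3
  have h4 : 1 ≤ S.card := Finset.card_pos.2 ⟨r, hS.1⟩
  obtain ⟨k, hk⟩ : ∃ k, S.card = k + 1 := ⟨S.card - 1, by omega⟩
  obtain ⟨e, rfl⟩ : ∃ e, δ = e + 2 := ⟨δ - 2, by omega⟩
  rw [hk] at h3 ⊢
  simp only [Nat.add_sub_cancel] at h3 ⊢
  have : e + 2 - 1 = e + 1 := by omega
  rw [this] at h3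
  nlinarith

/-- The number of infected descendants of `w`. -/
def descCount (G : SimpleGraph V) (r w : V) (S : Finset V) : ℕ :=
  (S.filter (· ∈ desc G r w)).card

/-- The same count of children below `w`, where `w` has to be added by hand since its parent is not
below `w`. That the answer depends only on `descCount` is what makes the growth below `w` an urn. -/
lemma card_bdry_desc (hG : G.IsTree) {δ : ℕ} (hδ : 3 ≤ δ) (hreg : G.IsRegularOfDegree δ)
    {r w : V} (hw : w ≠ r) {S : Finset V} (hS : Good G r S) (hp : par G r w ∈ S) :
    ((bdry G r S).filter (· ∈ desc G r w)).card = (δ - 2) * descCount G r w S + 1 := by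
  set D := S.filter (· ∈ desc G r w) with hD
  have hrD : r ∉ desc G r w := root_notMem_desc hG hw
  have h1 : insert w (D.biUnion (children G r)) =
      (bdry G r S).filter (· ∈ desc G r w) ∪ D := by
    ext u
    simp only [Finset.mem_insert, Finset.mem_union, mem_bdry hG, Finset.mem_biUnion,
      mem_children hG, Finset.mem_filter, hD]
    constructor
    · rintro (rfl | ⟨a, ⟨ha, ha'⟩, h, rfl⟩)
      · by_cases hu : u ∈ S
        · exact Or.inr ⟨hu, mem_desc_self hG hw⟩
        · exact Or.inl ⟨⟨hu, hw, hp⟩, mem_desc_self hG hw⟩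
      · have := (mem_desc_iff hG hw h).2 (Or.inr ha')
        by_cases hu : u ∈ S
        · exact Or.inr ⟨hu, this⟩
        · exact Or.inl ⟨⟨hu, h, ha⟩, this⟩
    · rintro (⟨⟨h, h', ha⟩, hu⟩ | ⟨h, hu⟩)
      · rcases (mem_desc_iff hG hw h').1 hu with rfl | h2
        · exact Or.inl rfl
        · exact Or.inr ⟨_, ⟨ha, h2⟩, h', rfl⟩
      · have h' : u ≠ r := by rintro rfl; exact hrD hu
        rcases (mem_desc_iff hG hw h').1 hu with rfl | h2
        · exact Or.inl rfl
        · exact Or.inr ⟨_, ⟨hS.2 u h h', h2⟩, h', rfl⟩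
  have h2 : Disjoint ((bdry G r S).filter (· ∈ desc G r w)) D := by
    rw [Finset.disjoint_left]
    intro a ha hb
    exact ((mem_bdry hG).1 (Finset.mem_filter.1 ha).1).1 (Finset.mem_filter.1 hb).1
  have h0 : w ∉ D.biUnion (children G r) := by
    simp only [Finset.mem_biUnion, mem_children hG, hD, Finset.mem_filter]
    rintro ⟨a, ⟨_, ha⟩, _, rfl⟩
    exact par_notMem_desc ha
  have h3 := card_biUnion_children hG r D
  have h4 : ∀ x ∈ D, (children G r x).card = δ - 1 := by
    intro x hx
    refine card_children hG hreg ?_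
    rintro rfl
    exact hrD (Finset.mem_filter.1 hx).2
  have h5 := congrArg Finset.card h1
  rw [Finset.card_insert_of_notMem h0, Finset.card_union_of_disjoint h2, h3,
    Finset.sum_congr rfl h4, Finset.sum_const, smul_eq_mul] at h5
  have h6 : descCount G r w S = D.card := rfl
  rw [h6]
  obtain ⟨e, rfl⟩ : ∃ e, δ = e + 2 := ⟨δ - 2, by omega⟩
  have : e + 2 - 1 = e + 1 := by omega
  rw [this] at h5
  simp only [Nat.add_sub_cancel]
  nlinarith

lemma Good.insert (hG : G.IsTree) {r u : V} {S : Finset V} (hS : Good G r S)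
    (hu : u ∈ bdry G r S) : Good G r (insert u S) := by
  obtain ⟨h1, h2, h3⟩ := (mem_bdry hG).1 hu
  refine ⟨Finset.mem_insert_of_mem hS.1, fun v hv hvr => ?_⟩
  rcases Finset.mem_insert.1 hv with rfl | hv
  · exact Finset.mem_insert_of_mem h3
  · exact Finset.mem_insert_of_mem (hS.2 v hv hvr)

/-- A node outside of a subtree with a neighbour in it is a boundary node. -/
lemma Good.mem_bdry_of_adj (hG : G.IsTree) {r u p : V} {S : Finset V} (hS : Good G r S)
    (hu : u ∉ S) (hp : p ∈ S) (h : G.Adj p u) : u ∈ bdry G r S := by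
  rw [mem_bdry hG]
  have hur : u ≠ r := by rintro rfl; exact hu hS.1
  refine ⟨hu, hur, ?_⟩
  rcases hG.dist_eq_dist_add_one_of_adj r h with h1 | h1
  · exfalso
    have hpr : p ≠ r := by rintro rfl; simp at h1
    have := par_eq hG h.symm h1.symm
    exact hu (this ▸ hS.2 p hp hpr)
  · rw [par_eq hG h h1.symm]; exact hp

end Tree

/-! ### Counting spreading histories -/

section History

variable {V : Type*} {G : SimpleGraph V}

/-- The number of ways to build `S` from `r` by adding `n` times a node that is adjacent to one of
the nodes that are already there. -/
def hist (G : SimpleGraph V) (r : V) : ℕ → Finset V → ℕ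
  | 0, S => if S = {r} then 1 else 0
  | n + 1, S => ∑ u ∈ S, if ∃ p ∈ S.erase u, G.Adj p u then hist G r n (S.erase u) else 0

lemma hist_succ (r : V) (n : ℕ) (S : Finset V) : hist G r (n + 1) S =
    ∑ u ∈ S, if ∃ p ∈ S.erase u, G.Adj p u then hist G r n (S.erase u) else 0 := rfl

lemma good_singleton (r : V) : Good G r {r} :=
  ⟨Finset.mem_singleton_self r, fun _ hv h => absurd (Finset.mem_singleton.1 hv) h⟩

lemma Good.of_erase (hG : G.IsTree) {r u : V} {S : Finset V} (hu : u ∈ S)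
    (hp : ∃ p ∈ S.erase u, G.Adj p u) (h : Good G r (S.erase u)) : Good G r S := by
  obtain ⟨p, hp, hpu⟩ := hp
  refine ⟨Finset.mem_of_mem_erase h.1, fun v hv hvr => ?_⟩
  by_cases hvu : v = u
  · subst hvu
    rcases hG.dist_eq_dist_add_one_of_adj r hpu with h1 | h1
    · have hpr : p ≠ r := by rintro rfl; simp at h1
      have h2 := par_eq hG hpu.symm h1.symm
      have := h.2 p hp hpr
      rw [h2] at this
      simp at this
    · rw [par_eq hG hpu h1.symm]; exact Finset.mem_of_mem_erase hp
  · exact Finset.mem_of_mem_erase (h.2 v (Finset.mem_erase.2 ⟨hvu, hv⟩) hvr)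

lemma good_of_hist_ne_zero (hG : G.IsTree) {r : V} {n : ℕ} {S : Finset V}
    (h : hist G r n S ≠ 0) : Good G r S ∧ S.card = n + 1 := by
  induction n generalizing S with
  | zero =>
    have : S = {r} := by by_contra hS; simp [hist, hS] at h
    subst this
    exact ⟨good_singleton r, by simp⟩
  | succ n ih =>
    rw [hist_succ] at h
    obtain ⟨u, hu, hne⟩ := Finset.exists_ne_zero_of_sum_ne_zero h
    split_ifs at hne with hp
    · obtain ⟨h1, h2⟩ := ih hne
      refine ⟨h1.of_erase hG hu hp, ?_⟩
      rw [Finset.card_erase_of_mem hu] at h2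
      have := Finset.card_pos.2 ⟨u, hu⟩
      omega
    · exact absurd rfl hne

/-- Histories on the two sides of an edge can be interleaved arbitrarily, except that the source
comes first. -/
lemma hist_union (hG : G.IsTree) {v w : V} (h : G.Adj v w) (n : ℕ) : ∀ (a b : ℕ) (A B : Finset V),
    a + b = n → (∀ y ∈ A, y ∉ side G v w) → (∀ y ∈ B, y ∈ side G v w) →
    A.card = a + 1 → B.card = b + 1 →
    hist G v (a + b + 1) (A ∪ B) = hist G v a A * hist G w b B * (a + b + 1).choose (b + 1) := by
  induction n using Nat.strong_induction_on with
  | _ n ih =>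
  intro a b A B hn hA hB hca hcb
  have hdisj : Disjoint A B := Finset.disjoint_left.2 fun x hx hx' => hA x hx (hB x hx')
  have hvB : v ∉ B := fun hv => notMem_side_self (hB v hv)
  have eA : ∀ u ∈ A, (A ∪ B).erase u = A.erase u ∪ B := by
    intro u hu
    rw [Finset.erase_union_distrib, Finset.erase_eq_of_notMem (Finset.disjoint_left.1 hdisj hu)]
  have eB : ∀ u ∈ B, (A ∪ B).erase u = A ∪ B.erase u := by
    intro u hu
    rw [Finset.erase_union_distrib, Finset.erase_eq_of_notMem (Finset.disjoint_right.1 hdisj hu)]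
  -- The node added last lies in `A` or in `B`; the two cases contribute the two terms of Pascal's
  -- rule for the number of interleavings.
  have sumA : ∑ u ∈ A, (if ∃ p ∈ (A ∪ B).erase u, G.Adj p u then
      hist G v (a + b) ((A ∪ B).erase u) else 0) =
      hist G v a A * hist G w b B * (a + b).choose (b + 1) := by
    cases a with
    | zero =>
      -- A single node of `A` cannot come last: what remains is `B`, which does not contain the
      -- source `v`.
      rw [Nat.choose_eq_zero_of_lt (by omega), mul_zero]
      refine Finset.sum_eq_zero fun u hu => ?_
      obtain ⟨x, rfl⟩ := Finset.card_eq_one.1 hca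
      rw [Finset.mem_singleton] at hu
      subst hu
      rw [eA u (by simp)]
      simp only [Finset.erase_singleton, Finset.empty_union]
      have : hist G v (0 + b) B = 0 := by
        by_contra hne
        exact hvB (good_of_hist_ne_zero hG hne).1.1
      rw [this, ite_self]
    | succ a =>
      rw [hist_succ, Finset.sum_mul, Finset.sum_mul]
      refine Finset.sum_congr rfl fun u hu => ?_
      have hc : (A.erase u).card = a + 1 := by rw [Finset.card_erase_of_mem hu]; omega
      have key := ih (a + b) (by omega) a b (A.erase u) B rfl
        (fun y hy => hA y (Finset.mem_of_mem_erase hy)) hB hc hcb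
      rw [eA u hu]
      have e1 : a + 1 + b = a + b + 1 := by ring
      rw [e1, key]
      by_cases h0 : hist G v a (A.erase u) = 0
      · simp [h0]
      · have hv : v ∈ A.erase u := (good_of_hist_ne_zero hG h0).1.1
        -- A node of `A` adjacent to `B` can only be `v`, and `v` is still present after `u` has
        -- been removed.
        have hcond : (∃ p ∈ A.erase u ∪ B, G.Adj p u) ↔ ∃ p ∈ A.erase u, G.Adj p u := by
          constructor
          · rintro ⟨p, hp, hpu⟩
            rcases Finset.mem_union.1 hp with hp | hp
            · exact ⟨p, hp, hpu⟩
            · have := edge_cross hG h (hA u hu) (hB p hp) hpu.symm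
              exact absurd this.1.symm (Finset.ne_of_mem_erase hv)
          · rintro ⟨p, hp, hpu⟩
            exact ⟨p, Finset.mem_union_left _ hp, hpu⟩
        simp only [hcond]
        split_ifs <;> simp
  have sumB : ∑ u ∈ B, (if ∃ p ∈ (A ∪ B).erase u, G.Adj p u then
      hist G v (a + b) ((A ∪ B).erase u) else 0) =
      hist G v a A * hist G w b B * (a + b).choose b := by
    cases b with
    | zero =>
      obtain ⟨x, rfl⟩ := Finset.card_eq_one.1 hcb
      rw [Finset.sum_singleton, eB x (by simp)]
      simp only [Finset.erase_singleton, Finset.union_empty, add_zero, Nat.choose_zero_right,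
        mul_one]
      by_cases h0 : hist G v a A = 0
      · simp [h0]
      · have hv : v ∈ A := (good_of_hist_ne_zero hG h0).1.1
        -- The first node of `B` has to be reached across the edge from `v` to `w`, so it is `w`.
        have hcond : (∃ p ∈ A, G.Adj p x) ↔ ({x} : Finset V) = {w} := by
          rw [Finset.singleton_inj]
          constructor
          · rintro ⟨p, hp, hpx⟩
            exact (edge_cross hG h (hA p hp) (hB x (by simp)) hpx).2
          · rintro rfl
            exact ⟨v, hv, h⟩
        simp only [hcond, hist]
        split_ifs <;> simp
    | succ b =>
      rw [hist_succ, Finset.mul_sum, Finset.sum_mul]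
      refine Finset.sum_congr rfl fun u hu => ?_
      have hc : (B.erase u).card = b + 1 := by rw [Finset.card_erase_of_mem hu]; omega
      have key := ih (a + b) (by omega) a b A (B.erase u) rfl hA
        (fun y hy => hB y (Finset.mem_of_mem_erase hy)) hca hc
      rw [eB u hu]
      have e1 : a + (b + 1) = a + b + 1 := by ring
      rw [e1, key]
      by_cases h0 : hist G w b (B.erase u) = 0
      · simp [h0]
      · have hw : w ∈ B.erase u := (good_of_hist_ne_zero hG h0).1.1
        have hcond : (∃ p ∈ A ∪ B.erase u, G.Adj p u) ↔ ∃ p ∈ B.erase u, G.Adj p u := by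
          constructor
          · rintro ⟨p, hp, hpu⟩
            rcases Finset.mem_union.1 hp with hp | hp
            · have := edge_cross hG h (hA p hp) (hB u hu) hpu
              exact absurd this.2.symm (Finset.ne_of_mem_erase hw)
            · exact ⟨p, hp, hpu⟩
          · rintro ⟨p, hp, hpu⟩
            exact ⟨p, Finset.mem_union_right _ hp, hpu⟩
        simp only [hcond]
        split_ifs <;> simp
  rw [hist_succ, Finset.sum_union hdisj, sumA, sumB, ← mul_add, Nat.choose_succ_succ, add_comm
    ((a + b).choose b)]

/-- Comparison of the numbers of histories from two adjacent sources. -/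
lemma hist_mul_card_side (hG : G.IsTree) {v w : V} (h : G.Adj v w) {n : ℕ} {S : Finset V}
    (hS : S.card = n + 1) (hv : v ∈ S) (hw : w ∈ S) :
    hist G v n S * (S.filter (· ∈ side G v w)).card =
      hist G w n S * (S.filter (· ∉ side G v w)).card := by
  set A := S.filter (· ∉ side G v w) with hA
  set B := S.filter (· ∈ side G v w) with hB
  have hAB : A ∪ B = S := by rw [Finset.union_comm]; exact Finset.filter_union_filter_not_eq _ _
  have hdisj : Disjoint A B := (Finset.disjoint_filter_filter_not S S _).symm
  have hcard : A.card + B.card = n + 1 := by rw [← Finset.card_union_of_disjoint hdisj, hAB, hS]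
  have hA0 : 0 < A.card := Finset.card_pos.2 ⟨v, by simp [hA, hv, notMem_side_self]⟩
  have hB0 : 0 < B.card := Finset.card_pos.2 ⟨w, by simp [hB, hw, mem_side_self h]⟩
  obtain ⟨a, ha⟩ : ∃ a, A.card = a + 1 := ⟨A.card - 1, by omega⟩
  obtain ⟨b, hb⟩ : ∃ b, B.card = b + 1 := ⟨B.card - 1, by omega⟩
  have e1 := hist_union hG h (a + b) a b A B rfl (fun y hy => (Finset.mem_filter.1 hy).2)
    (fun y hy => (Finset.mem_filter.1 hy).2) ha hb
  have e2 := hist_union hG h.symm (b + a) b a B A rfl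
    (fun y hy => by rw [notMem_side hG h.symm]; exact (Finset.mem_filter.1 hy).2)
    (fun y hy => (notMem_side hG h).1 (Finset.mem_filter.1 hy).2) hb ha
  rw [hAB] at e1
  rw [Finset.union_comm, hAB, add_comm b a] at e2
  have hn : n = a + b + 1 := by omega
  -- The two history numbers share the factors for `A` and `B` and differ only in the binomial
  -- coefficients `(a + b + 1).choose (b + 1)` and `(a + b + 1).choose (a + 1)`, whose ratio is `(a
  -- + 1) / (b + 1)`.
  have e3 := Nat.choose_succ_right_eq (a + b + 1) b
  have e4 : (a + b + 1).choose b = (a + b + 1).choose (a + 1) := by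
    rw [← Nat.choose_symm (by omega : b ≤ a + b + 1)]
    congr 1; omega
  have e5 : a + b + 1 - b = a + 1 := by omega
  rw [e4, e5] at e3
  rw [hn, e1, e2, ha, hb, mul_assoc, e3]
  ring

/-- If the majority of the nodes of `S` is on one side of an edge, then so is every node with a
maximal number of histories. -/
lemma mem_side_of_hist_max (hG : G.IsTree) {u v x : V} (h : G.Adj u v) {n : ℕ} {S : Finset V}
    (hS : S.card = n + 1) (hx0 : hist G x n S ≠ 0) (hmax : ∀ y ∈ S, hist G y n S ≤ hist G x n S)
    (hmaj : n + 1 < 2 * (S.filter (· ∈ side G u v)).card) : x ∈ side G u v := by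
  by_contra hx
  have hgood := (good_of_hist_ne_zero hG hx0).1
  obtain ⟨z, hz⟩ : (S.filter (· ∈ side G u v)).Nonempty := by
    rw [← Finset.card_pos]; omega
  obtain ⟨hzS, hz⟩ := Finset.mem_filter.1 hz
  have hxv : v ≠ x := by rintro rfl; exact hx (mem_side_self h)
  have hxz : z ≠ x := by rintro rfl; exact hx hz
  -- Step from `x` to the neighbour `p` towards `v`. The far side of the edge from `x` to `p`
  -- contains `side G u v`, hence the majority, so `p` has more histories than `x`, against
  -- maximality.
  obtain ⟨hpx, hpd⟩ := par_spec hG hxv.symm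
  set p := par G v x with hp
  have hcr : ∀ y ∈ side G u v, G.dist y p + 1 = G.dist y x := by
    intro y hy
    have h1 := dist_cross hG h hx hy
    have h2 := dist_cross hG h hx (mem_side_self h)
    rw [SimpleGraph.dist_self] at h2
    have h3 := hG.connected.dist_triangle (u := y) (v := v) (w := p)
    rw [dist_comm_tree x y] at h1
    rw [dist_comm_tree x v] at h2
    rw [dist_comm_tree y v] at h3
    rcases hG.dist_eq_dist_add_one_of_adj y hpx with h4 | h4 <;> omega
  obtain ⟨q, hqS, hqx, hqd⟩ := hgood.exists_first_step hG hzS hxz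
  have hpq : p = q := by
    rw [← par_eq hG hqx hqd, ← par_eq hG hpx (hcr z hz)]
  rw [← hpq] at hqS
  have hsub : S.filter (· ∈ side G u v) ⊆ S.filter (· ∈ side G x p) := by
    intro y hy
    obtain ⟨hyS, hy⟩ := Finset.mem_filter.1 hy
    exact Finset.mem_filter.2 ⟨hyS, (hcr y hy).symm⟩
  have hle := Finset.card_le_card hsub
  have hsum : (S.filter (· ∈ side G x p)).card + (S.filter (· ∉ side G x p)).card = n + 1 := by
    rw [Finset.card_filter_add_card_filter_not, hS]
  have key := hist_mul_card_side hG hpx.symm hS hgood.1 hqS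
  have hm := hmax p hqS
  have hpos : 0 < hist G x n S := Nat.pos_of_ne_zero hx0
  have hlt : (S.filter (· ∉ side G x p)).card < (S.filter (· ∈ side G x p)).card := by omega
  have h1 := Nat.mul_lt_mul_of_pos_left hlt hpos
  have h2 := Nat.mul_le_mul_right (S.filter (· ∉ side G x p)).card hm
  omega

end History

/-! ### Races between exponential clocks -/

section Race

instance isProbabilityMeasure_expMeasure_one : IsProbabilityMeasure (expMeasure 1) :=
  isProbabilityMeasure_expMeasure one_pos

instance nullSingletonClass_expMeasure_one : NullSingletonClass (expMeasure 1) :=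
  inferInstanceAs (NullSingletonClass (volume.withDensity (gammaPDF 1 1)))

lemma expMeasure_Ioi {a : ℝ} (ha : 0 ≤ a) :
    expMeasure 1 (Set.Ioi a) = ENNReal.ofReal (Real.exp (-a)) := by
  have h := cdf_expMeasure_eq one_pos a
  rw [if_pos ha, one_mul, cdf_eq_real] at h
  have h2 : (expMeasure 1).real (Set.Ioi a) = Real.exp (-a) := by
    rw [← Set.compl_Iic, probReal_compl_eq_one_sub measurableSet_Iic, h]; ring
  rw [← h2, ofReal_measureReal]

/-- If one clock of age `a` rings at `t`, then each of `m` others outlives it with probability `exp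
(-(t - a))` given survival so far. The integral produces the factor `1 / (m + 1)` of the race. -/
lemma lintegral_expMeasure_Ioi {a : ℝ} (ha : 0 ≤ a) {m : ℝ} (hm : 0 ≤ m) :
    ∫⁻ t in Set.Ioi a, ENNReal.ofReal (Real.exp (-(m * (t - a)))) ∂expMeasure 1 =
      ENNReal.ofReal (Real.exp (-a) / (m + 1)) := by
  rw [expMeasure, gammaMeasure, setLIntegral_withDensity_eq_setLIntegral_mul _
    (f := gammaPDF 1 1) (measurable_gammaPDFReal 1 1).ennreal_ofReal (by fun_prop) measurableSet_Ioi]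
  have h1 : ∀ t ∈ Set.Ioi a, (gammaPDF 1 1 * fun t => ENNReal.ofReal (Real.exp (-(m * (t - a))))) t
      = ENNReal.ofReal (Real.exp (m * a) * Real.exp (-(m + 1) * t)) := by
    intro t ht
    have ht' : 0 ≤ t := ha.trans (le_of_lt ht)
    have := exponentialPDF_of_nonneg (r := 1) ht'
    rw [Pi.mul_apply]
    change exponentialPDF 1 t * _ = _
    rw [this, ← ENNReal.ofReal_mul (by positivity), one_mul, one_mul, ← Real.exp_add,
      ← Real.exp_add]
    ring_nf
  rw [setLIntegral_congr_fun measurableSet_Ioi h1, ← ofReal_integral_eq_lintegral_ofReal]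
  · rw [integral_const_mul, integral_exp_mul_Ioi (by linarith), neg_div_neg_eq, mul_div_assoc',
      ← Real.exp_add]
    ring_nf
  · exact (integrableOn_exp_mul_Ioi (by linarith) a).const_mul _
  · exact Eventually.of_forall fun t => by positivity

variable {ι : Type*} [Fintype ι]

lemma pi_exp_survive {c : ι → ℝ} (hc : ∀ i, 0 ≤ c i) :
    (Measure.pi fun _ : ι => expMeasure 1) {x | ∀ j, c j < x j} =
      ENNReal.ofReal (Real.exp (-∑ j, c j)) := by
  have h : {x : ι → ℝ | ∀ j, c j < x j} = Set.univ.pi fun j => Set.Ioi (c j) := by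
    ext x; simp [Set.mem_pi]
  rw [h, Measure.pi_pi, Finset.prod_congr rfl fun j _ => expMeasure_Ioi (hc j),
    ← ENNReal.ofReal_prod_of_nonneg (fun _ _ => (Real.exp_pos _).le), ← Real.exp_sum,
    Finset.sum_neg_distrib]

lemma measurableSet_race (i : ι) : MeasurableSet {y : (ι → ℝ) × (ι → ℝ) |
    (∀ j, y.1 j < y.2 j) ∧ ∀ j, j ≠ i → y.2 i - y.1 i < y.2 j - y.1 j} := by
  have h : ∀ j, Measurable fun y : (ι → ℝ) × (ι → ℝ) => y.1 j := fun j =>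
    (measurable_pi_apply j).comp measurable_fst
  have h' : ∀ j, Measurable fun y : (ι → ℝ) × (ι → ℝ) => y.2 j := fun j =>
    (measurable_pi_apply j).comp measurable_snd
  simp only [Set.ofPred_and, Set.ofPred_forall]
  refine MeasurableSet.inter (MeasurableSet.iInter fun j => measurableSet_lt (h j) (h' j)) ?_
  exact MeasurableSet.iInter fun j => MeasurableSet.iInter fun _ =>
    measurableSet_lt ((h' i).sub (h i)) ((h' j).sub (h j))

/-- Given that clock `i` rings at `t > c i`, every other clock `j` has to exceed `t - c i + c j`.
This is a product of exponential tails, and integrating over `t` leaves the survival probability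
divided by the number of clocks, for whatever ages `c`. -/
lemma pi_exp_race {c : ι → ℝ} (hc : ∀ i, 0 ≤ c i) (i : ι) :
    (Measure.pi fun _ : ι => expMeasure 1)
      {x | (∀ j, c j < x j) ∧ ∀ j, j ≠ i → x i - c i < x j - c j} =
      ENNReal.ofReal (Real.exp (-∑ j, c j) / Fintype.card ι) := by
  set A : Set (ι → ℝ) := {x | (∀ j, c j < x j) ∧ ∀ j, j ≠ i → x i - c i < x j - c j} with hA
  have hAm : MeasurableSet A := (measurable_const.prodMk measurable_id : Measurable
    fun x : ι → ℝ => (c, x)) (measurableSet_race i)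
  have hf : Measurable (A.indicator (1 : (ι → ℝ) → ENNReal)) := measurable_one.indicator hAm
  rw [← lintegral_indicator_one hAm, lintegral_eq_lmarginal_univ (fun _ => (0 : ℝ)),
    lmarginal_erase _ hf (Finset.mem_univ i)]
  have key : ∀ t : ℝ, (∫⋯∫⁻_(Finset.univ.erase i), A.indicator 1 ∂(fun _ : ι => expMeasure 1))
      (Function.update (fun _ => 0) i t) =
      (Set.Ioi (c i)).indicator (fun t => ENNReal.ofReal (Real.exp (-(∑ j, c j - c i))) *
        ENNReal.ofReal (Real.exp (-((Fintype.card ι - 1 : ℝ) * (t - c i))))) t := by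
    intro t
    rw [lmarginal]
    by_cases ht : c i < t
    · rw [Set.indicator_of_mem (by exact ht)]
      have h1 : ∀ y : ((j : (Finset.univ.erase i : Finset ι)) → ℝ),
          A.indicator (1 : (ι → ℝ) → ENNReal) (Function.updateFinset
            (Function.update (fun _ => (0 : ℝ)) i t) (Finset.univ.erase i) y) =
          (Set.univ.pi fun j : (Finset.univ.erase i : Finset ι) =>
            Set.Ioi (t - c i + c j)).indicator 1 y := by
        intro y
        have hi : Function.updateFinset (Function.update (fun _ => (0 : ℝ)) i t)
            (Finset.univ.erase i) y i = t := by simp [Function.updateFinset]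
        have hj : ∀ j (hj : j ≠ i), Function.updateFinset (Function.update (fun _ => (0 : ℝ)) i t)
            (Finset.univ.erase i) y j = y ⟨j, by simp [hj]⟩ := by
          intro j hj; simp [Function.updateFinset, hj]
        by_cases hy : y ∈ Set.univ.pi fun j : (Finset.univ.erase i : Finset ι) =>
            Set.Ioi (t - c i + c j)
        · rw [Set.indicator_of_mem hy, Set.indicator_of_mem]
          · rfl
          have hy' : ∀ j (hj : j ≠ i), t - c i + c j < y ⟨j, by simp [hj]⟩ := fun j hj =>
            hy ⟨j, by simp [hj]⟩ (Set.mem_univ _)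
          refine ⟨fun j => ?_, fun j hji => ?_⟩
          · by_cases hji : j = i
            · subst hji; rw [hi]; exact ht
            · rw [hj j hji]; have := hy' j hji; linarith
          · rw [hi, hj j hji]; have := hy' j hji; linarith
        · rw [Set.indicator_of_notMem hy, Set.indicator_of_notMem]
          rintro ⟨h1, h2⟩
          refine hy fun j _ => ?_
          have hji := Finset.ne_of_mem_erase j.2
          have := h2 j hji
          rw [hi, hj j hji] at this
          simp only [Set.mem_Ioi]
          linarith
      simp_rw [h1]
      rw [lintegral_indicator_one (MeasurableSet.univ_pi fun _ => measurableSet_Ioi),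
        Measure.pi_pi, Finset.prod_congr rfl fun (j : (Finset.univ.erase i : Finset ι)) _ =>
          expMeasure_Ioi (add_nonneg (sub_nonneg.2 ht.le) (hc j)),
        Finset.univ_eq_attach, Finset.prod_attach (Finset.univ.erase i)
          (fun j => ENNReal.ofReal (Real.exp (-(t - c i + c j)))),
        ← ENNReal.ofReal_prod_of_nonneg (fun _ _ => (Real.exp_pos _).le), ← Real.exp_sum,
        ← ENNReal.ofReal_mul (Real.exp_pos _).le, ← Real.exp_add, Finset.sum_neg_distrib,
        Finset.sum_add_distrib, Finset.sum_const, Finset.card_erase_of_mem (Finset.mem_univ i),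
        Finset.card_univ, nsmul_eq_mul, Nat.cast_pred (Fintype.card_pos_iff.2 ⟨i⟩),
        ← Finset.add_sum_erase _ c (Finset.mem_univ i)]
      ring_nf
    · rw [Set.indicator_of_notMem (by exact ht)]
      have h1 : ∀ y : ((j : (Finset.univ.erase i : Finset ι)) → ℝ),
          A.indicator (1 : (ι → ℝ) → ENNReal) (Function.updateFinset
            (Function.update (fun _ => (0 : ℝ)) i t) (Finset.univ.erase i) y) = 0 := by
        intro y
        refine Set.indicator_of_notMem ?_ _
        rintro ⟨h1, -⟩
        have := h1 i
        simp [Function.updateFinset] at this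
        exact ht this
      simp [h1]
  have hcard : (1 : ℝ) ≤ Fintype.card ι := by
    exact_mod_cast Fintype.card_pos_iff.2 ⟨i⟩
  simp_rw [key]
  rw [lintegral_indicator measurableSet_Ioi, lintegral_const_mul _ (by fun_prop),
    lintegral_expMeasure_Ioi (hc i) (by linarith), ← ENNReal.ofReal_mul (Real.exp_pos _).le,
    mul_div_assoc', ← Real.exp_add]
  ring_nf

variable {Ω : Type*} [MeasurableSpace Ω] {P : Measure Ω} [IsProbabilityMeasure P]

/-- Among exponential clocks that have not rung yet, each one is equally likely to be the next. -/
lemma measureReal_race {C X : ι → Ω → ℝ} (hC : ∀ i, Measurable (C i)) (hX : ∀ i, Measurable (X i))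
    (hC0 : ∀ i ω, 0 ≤ C i ω) (hind : IndepFun (fun ω i => C i ω) (fun ω i => X i ω) P)
    (hlaw : P.map (fun ω i => X i ω) = Measure.pi fun _ => expMeasure 1) (i : ι) :
    P.real {ω | (∀ j, C j ω < X j ω) ∧ ∀ j, j ≠ i → X i ω - C i ω < X j ω - C j ω} =
      P.real {ω | ∀ j, C j ω < X j ω} / Fintype.card ι := by
  have hCm : Measurable fun ω i => C i ω := measurable_pi_iff.2 hC
  have hXm : Measurable fun ω i => X i ω := measurable_pi_iff.2 hX
  have hmap := hind.map_prod_eq_prod_map_map hCm.aemeasurable hXm.aemeasurable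
  rw [hlaw] at hmap
  have : IsProbabilityMeasure (P.map fun ω i => C i ω) :=
    Measure.isProbabilityMeasure_map hCm.aemeasurable
  have hae : ∀ᵐ c ∂(P.map fun ω i => C i ω), ∀ i, 0 ≤ c i := by
    rw [ae_map_iff hCm.aemeasurable]
    · exact Eventually.of_forall fun ω i => hC0 i ω
    · simp only [Set.ofPred_forall]
      exact MeasurableSet.iInter fun i => measurableSet_le measurable_const (measurable_pi_apply i)
  have hm2 : MeasurableSet {y : (ι → ℝ) × (ι → ℝ) | ∀ j, y.1 j < y.2 j} := by
    simp only [Set.ofPred_forall]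
    exact MeasurableSet.iInter fun j => measurableSet_lt
      ((measurable_pi_apply j).comp measurable_fst) ((measurable_pi_apply j).comp measurable_snd)
  have e1 : P {ω | (∀ j, C j ω < X j ω) ∧ ∀ j, j ≠ i → X i ω - C i ω < X j ω - C j ω} =
      ∫⁻ c, ENNReal.ofReal (Real.exp (-∑ j, c j) / Fintype.card ι)
        ∂(P.map fun ω i => C i ω) := by
    rw [← lintegral_congr_ae (hae.mono fun c hc => pi_exp_race hc i)]
    have := Measure.map_apply (μ := P) (hCm.prodMk hXm) (measurableSet_race i)
    rw [hmap, Measure.prod_apply (measurableSet_race i)] at this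
    exact this.symm
  have e2 : P {ω | ∀ j, C j ω < X j ω} =
      ∫⁻ c, ENNReal.ofReal (Real.exp (-∑ j, c j)) ∂(P.map fun ω i => C i ω) := by
    rw [← lintegral_congr_ae (hae.mono fun c hc => pi_exp_survive hc)]
    have := Measure.map_apply (μ := P) (hCm.prodMk hXm) hm2
    rw [hmap, Measure.prod_apply hm2] at this
    exact this.symm
  have hcard : (0 : ℝ) < Fintype.card ι := by exact_mod_cast Fintype.card_pos_iff.2 ⟨i⟩
  rw [measureReal_def, measureReal_def, e1, e2]
  simp_rw [div_eq_mul_inv, ENNReal.ofReal_mul (Real.exp_pos _).le]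
  rw [lintegral_mul_const _ (by fun_prop), ENNReal.toReal_mul, ENNReal.toReal_ofReal (by positivity)]

/-- An exponential clock does not ring at a time that is independent of it. -/
lemma measure_eq_indep {X Z : Ω → ℝ} (hX : Measurable X) (hZ : Measurable Z)
    (hind : IndepFun Z X P) (hlaw : P.map X = expMeasure 1) : P {ω | X ω = Z ω} = 0 := by
  have hmap := hind.map_prod_eq_prod_map_map hZ.aemeasurable hX.aemeasurable
  have hm : MeasurableSet {y : ℝ × ℝ | y.2 = y.1} :=
    measurableSet_eq_fun measurable_snd measurable_fst
  have h := Measure.map_apply (μ := P) (hZ.prodMk hX) hm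
  rw [hmap, Measure.prod_apply hm, hlaw] at h
  have h0 : ∀ z : ℝ, expMeasure 1 (Prod.mk z ⁻¹' {y : ℝ × ℝ | y.2 = y.1}) = 0 := by
    intro z
    have : (Prod.mk z ⁻¹' {y : ℝ × ℝ | y.2 = y.1}) = {z} := by ext; simp
    rw [this, measure_singleton]
  simp only [h0, lintegral_zero] at h
  exact h.symm

end Race

/-! ### First passage times in a rooted tree -/

section Passage

variable {V Ω : Type*} {G : SimpleGraph V}

/-- `T` is the first passage time from `s` with edge times `X`, where `X v` belongs to the edge from
the parent of `v` to `v`. -/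
structure IsPassage (G : SimpleGraph V) (s : V) (T X : V → Ω → ℝ) : Prop where
  root : ∀ ω, T s ω = 0
  step : ∀ v, v ≠ s → ∀ ω, T v ω = T (par G s v) ω + X v ω

variable {s : V} {T X : V → Ω → ℝ}

lemma IsPassage.nonneg (hG : G.IsTree) (h : IsPassage G s T X) {ω : Ω} (hX : ∀ v, 0 < X v ω)
    (v : V) : 0 ≤ T v ω := by
  obtain ⟨n, hn⟩ : ∃ n, G.dist s v = n := ⟨_, rfl⟩
  induction n generalizing v with
  | zero => rw [← dist_eq_zero' hG hn, h.root]
  | succ n ih =>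
    have hv : v ≠ s := by rintro rfl; simp at hn
    have := ih (par G s v) (by have := (par_spec hG hv).2; omega)
    rw [h.step v hv]
    linarith [hX v]

lemma IsPassage.pos (hG : G.IsTree) (h : IsPassage G s T X) {ω : Ω} (hX : ∀ v, 0 < X v ω)
    {v : V} (hv : v ≠ s) : 0 < T v ω := by
  rw [h.step v hv]
  linarith [hX v, h.nonneg hG hX (par G s v)]

/-- Passage times inside a subtree use only the edge times inside it, so they are independent of the
edge times at the boundary. -/
lemma IsPassage.rep (hG : G.IsTree) (h : IsPassage G s T X) {S : Finset V} (hS : Good G s S)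
    {v : V} (hv : v ∈ S) :
    ∃ Φ : (S → ℝ) → ℝ, Measurable Φ ∧ ∀ ω, T v ω = Φ fun i => X i ω := by
  obtain ⟨n, hn⟩ : ∃ n, G.dist s v = n := ⟨_, rfl⟩
  induction n generalizing v with
  | zero =>
    rw [← dist_eq_zero' hG hn]
    exact ⟨fun _ => 0, measurable_const, h.root⟩
  | succ n ih =>
    have hvs : v ≠ s := by rintro rfl; simp at hn
    obtain ⟨Φ, hΦ, hr⟩ := ih (hS.2 v hv hvs) (by have := (par_spec hG hvs).2; omega)
    refine ⟨fun y => Φ y + y ⟨v, hv⟩, hΦ.add (measurable_pi_apply _), fun ω => ?_⟩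
    rw [h.step v hvs, hr]

variable [MeasurableSpace Ω]

lemma IsPassage.measurable (hG : G.IsTree) (h : IsPassage G s T X) (hX : ∀ v, Measurable (X v))
    (v : V) : Measurable (T v) := by
  obtain ⟨n, hn⟩ : ∃ n, G.dist s v = n := ⟨_, rfl⟩
  induction n generalizing v with
  | zero =>
    rw [← dist_eq_zero' hG hn]
    have : T s = fun _ => 0 := funext h.root
    rw [this]; exact measurable_const
  | succ n ih =>
    have hv : v ≠ s := by rintro rfl; simp at hn
    have : T v = fun ω => T (par G s v) ω + X v ω := funext (h.step v hv)
    rw [this]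
    exact (ih _ (by have := (par_spec hG hv).2; omega)).add (hX v)

variable [G.LocallyFinite]

/-- The event that all the nodes of `S` are reached before the nodes of its boundary. -/
def stageEvent (G : SimpleGraph V) [G.LocallyFinite] (s : V) (T : V → Ω → ℝ) (S : Finset V) :
    Set Ω :=
  {ω | ∀ v ∈ S, ∀ w ∈ bdry G s S, T v ω < T w ω}

/-- The event that, in addition, `u` is the first node of the boundary to be reached. -/
def nextEvent (G : SimpleGraph V) [G.LocallyFinite] (s : V) (T : V → Ω → ℝ) (S : Finset V) (u : V) :
    Set Ω :=
  {ω | ω ∈ stageEvent G s T S ∧ ∀ w ∈ bdry G s S, w ≠ u → T u ω < T w ω}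

/-- The nodes of `S` that can have been added last. -/
def leaves (G : SimpleGraph V) [G.LocallyFinite] (s : V) (S : Finset V) : Finset V :=
  S.filter fun u => Good G s (S.erase u) ∧ u ∈ bdry G s (S.erase u)

lemma hist_succ_leaves (hG : G.IsTree) (s : V) (n : ℕ) (S : Finset V) :
    hist G s (n + 1) S = ∑ u ∈ leaves G s S, hist G s n (S.erase u) := by
  rw [hist_succ, leaves, Finset.sum_filter]
  refine Finset.sum_congr rfl fun u hu => ?_
  by_cases hg : Good G s (S.erase u)
  · have hcond : (Good G s (S.erase u) ∧ u ∈ bdry G s (S.erase u)) ↔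
        ∃ p ∈ S.erase u, G.Adj p u := by
      constructor
      · rintro ⟨-, hb⟩
        obtain ⟨h1, h2, h3⟩ := (mem_bdry hG).1 hb
        exact ⟨_, h3, (par_spec hG h2).1⟩
      · rintro ⟨p, hp, hpu⟩
        exact ⟨hg, hg.mem_bdry_of_adj hG (Finset.notMem_erase u S) hp hpu⟩
    simp only [hcond]
  · have : hist G s n (S.erase u) = 0 := by
      by_contra hne
      exact hg (good_of_hist_ne_zero hG hne).1
    simp [this]

lemma measurableSet_stageEvent (hT : ∀ v, Measurable (T v)) (S : Finset V) :
    MeasurableSet (stageEvent G s T S) := by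
  simp only [stageEvent, Set.ofPred_forall]
  exact Finset.measurableSet_biInter _ fun v _ => Finset.measurableSet_biInter _ fun w _ =>
    measurableSet_lt (hT v) (hT w)

lemma measurableSet_nextEvent (hT : ∀ v, Measurable (T v)) (S : Finset V) (u : V) :
    MeasurableSet (nextEvent G s T S u) := by
  have h : MeasurableSet {ω | ∀ w ∈ bdry G s S, w ≠ u → T u ω < T w ω} := by
    simp only [Set.ofPred_forall]
    exact Finset.measurableSet_biInter _ fun w _ => MeasurableSet.iInter fun _ =>
      measurableSet_lt (hT u) (hT w)
  exact (measurableSet_stageEvent hT S).inter h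

variable {P : Measure Ω} [IsProbabilityMeasure P]

/-- Memorylessness. At the time when the last node of `S` is reached, the clock on the edge to the
boundary node `j` has run for that time minus the passage time of the parent of `j`. These ages
depend only on edge times inside `S`, so `measureReal_race` applies: `stageEvent` says that no clock
has rung, and the residual times order the arrivals at the boundary. -/
lemma IsPassage.measureReal_nextEvent (hG : G.IsTree) (h : IsPassage G s T X)
    (hX : ∀ v, Measurable (X v)) (hind : iIndepFun X P)
    (hlaw : ∀ v, P.map (X v) = expMeasure 1) {S : Finset V} (hS : Good G s S) {u : V}
    (hu : u ∈ bdry G s S) :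
    P.real (nextEvent G s T S u) = P.real (stageEvent G s T S) / (bdry G s S).card := by
  have hrep : ∀ v : S, ∃ Φ : (S → ℝ) → ℝ, Measurable Φ ∧ ∀ ω, T v ω = Φ fun i => X i ω :=
    fun v => h.rep hG hS v.2
  choose Φ hΦ hr using hrep
  have hb : ∀ w : bdry G s S, (w : V) ∉ S ∧ (w : V) ≠ s ∧ par G s w ∈ S := fun w =>
    (mem_bdry hG).1 w.2
  have hne : (Finset.univ : Finset S).Nonempty := ⟨⟨s, hS.1⟩, Finset.mem_univ _⟩
  set ψ : (S → ℝ) → (bdry G s S → ℝ) := fun y j =>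
    Finset.univ.sup' hne (fun v => Φ v y) - Φ ⟨par G s j, (hb j).2.2⟩ y with hψ
  have hM : Measurable fun y : S → ℝ => Finset.univ.sup' hne (fun v => Φ v y) := by
    have := Finset.measurable_sup' hne (f := Φ) (fun v _ => hΦ v)
    convert this using 1
    ext y
    rw [Finset.sup'_apply]
  have hψm : Measurable ψ := measurable_pi_iff.2 fun j => hM.sub (hΦ _)
  set C : bdry G s S → Ω → ℝ := fun j ω => ψ (fun i => X i ω) j with hC
  have hXS : Measurable fun ω (i : S) => X i ω := measurable_pi_iff.2 fun i => hX i
  have hCm : ∀ j, Measurable (C j) := fun j =>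
    (measurable_pi_apply j).comp (hψm.comp hXS)
  have hdisj : Disjoint S (bdry G s S) := Finset.disjoint_left.2 fun x hx hx' =>
    ((mem_bdry hG).1 hx').1 hx
  have hi := hind.indepFun_finset S (bdry G s S) hdisj hX
  have hi2 : IndepFun (fun ω j => C j ω) (fun ω (j : bdry G s S) => X j ω) P :=
    hi.comp hψm measurable_id
  have hlaw2 : P.map (fun ω (j : bdry G s S) => X j ω) = Measure.pi fun _ => expMeasure 1 := by
    have := iIndepFun.map_fun_eq_pi_map (f := fun (j : bdry G s S) => X j)
      (fun j => (hX j).aemeasurable) (hind.restrict (bdry G s S))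
    refine this.trans ?_
    congr 1
    ext1 j
    exact hlaw j
  have hTle : ∀ v ∈ S, ∀ ω, T v ω ≤ Finset.univ.sup' hne (fun v => Φ v fun i => X i ω) := by
    intro v hv ω
    rw [hr ⟨v, hv⟩]
    exact Finset.le_sup' (fun v : S => Φ v fun i => X i ω) (Finset.mem_univ (⟨v, hv⟩ : S))
  have hXC : ∀ (j : bdry G s S) ω, X j ω - C j ω =
      T j ω - Finset.univ.sup' hne (fun v => Φ v fun i => X i ω) := by
    intro j ω
    rw [h.step j (hb j).2.1, hr ⟨par G s j, (hb j).2.2⟩, hC]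
    simp only [hψ]
    ring
  have hrace := measureReal_race (P := P) hCm (fun j : bdry G s S => hX j) (fun j ω => by
    have h1 := hTle _ (hb j).2.2 ω
    have h2 := hr ⟨_, (hb j).2.2⟩ ω
    simp only [hC, hψ]
    linarith) hi2 hlaw2 ⟨u, hu⟩
  have hE : {ω | ∀ j : bdry G s S, C j ω < X j ω} = stageEvent G s T S := by
    ext ω
    constructor
    · intro hω v hv w hw
      have h1 := hω ⟨w, hw⟩
      have h2 := hXC ⟨w, hw⟩ ω
      have h3 := hTle v hv ω
      simp only at h2
      linarith
    · intro hω j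
      have h2 := hXC j ω
      have h4 : Finset.univ.sup' hne (fun v => Φ v fun i => X i ω) < T j ω := by
        rw [Finset.sup'_lt_iff]
        intro v _
        rw [← hr v]
        exact hω v v.2 j j.2
      linarith
  have hF : {ω | (∀ j : bdry G s S, C j ω < X j ω) ∧ ∀ j : bdry G s S, j ≠ ⟨u, hu⟩ →
      X u ω - C ⟨u, hu⟩ ω < X j ω - C j ω} = nextEvent G s T S u := by
    ext ω
    rw [nextEvent, ← hE]
    refine and_congr Iff.rfl ?_
    have hu2 := hXC ⟨u, hu⟩ ω
    simp only at hu2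
    constructor
    · intro hω w hw hwu
      have h1 := hω ⟨w, hw⟩ (by simpa using hwu)
      rw [hXC, hu2] at h1
      simp only at h1
      linarith
    · intro hω j hju
      have h1 := hω j j.2 (fun h => hju (Subtype.ext h))
      rw [hXC, hu2]
      linarith
  rw [hE, hF, Fintype.card_coe] at hrace
  exact hrace

/-- A tie would make `X u` equal to a function of the edge times inside `S`, of which it is
independent. -/
lemma IsPassage.measure_tie (hG : G.IsTree) (h : IsPassage G s T X)
    (hX : ∀ v, Measurable (X v)) (hind : iIndepFun X P)
    (hlaw : ∀ v, P.map (X v) = expMeasure 1) {S : Finset V} (hS : Good G s S) {u v : V}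
    (hu : u ∈ bdry G s S) (hv : v ∈ S) : P {ω | T v ω = T u ω} = 0 := by
  obtain ⟨hu1, hu2, hu3⟩ := (mem_bdry hG).1 hu
  obtain ⟨Φ, hΦ, hr⟩ := h.rep hG hS hv
  obtain ⟨Φ', hΦ', hr'⟩ := h.rep hG hS hu3
  have hi := hind.indepFun_finset S {u} (Finset.disjoint_singleton_right.2 hu1) hX
  have hi2 : IndepFun (fun ω => Φ (fun i : S => X i ω) - Φ' (fun i : S => X i ω)) (X u) P :=
    hi.comp (φ := fun y => Φ y - Φ' y)
      (ψ := fun y : ({u} : Finset V) → ℝ => y ⟨u, Finset.mem_singleton_self u⟩)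
      (hΦ.sub hΦ') (measurable_pi_apply _)
  have hXS : Measurable fun ω (i : S) => X i ω := measurable_pi_iff.2 fun i => hX i
  have := measure_eq_indep (P := P) (hX u) ((hΦ.comp hXS).sub (hΦ'.comp hXS)) hi2 (hlaw u)
  convert this using 2
  ext ω
  simp only [Set.mem_ofPred_eq]
  rw [h.step u hu2, hr', hr]
  simp only [Function.comp, Pi.sub_apply]
  constructor <;> intro h <;> linarith

lemma ae_pos_of_exp [Countable V] (hX : ∀ v, Measurable (X v))
    (hlaw : ∀ v, P.map (X v) = expMeasure 1) : ∀ᵐ ω ∂P, ∀ v, 0 < X v ω := by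
  rw [ae_all_iff]
  intro v
  have h1 : P (X v ⁻¹' Set.Ioi 0) = 1 := by
    rw [← Measure.map_apply (hX v) measurableSet_Ioi, hlaw, expMeasure_Ioi le_rfl]
    simp
  exact (prob_compl_eq_zero_iff (hX v measurableSet_Ioi)).2 h1

/-- The last infected node `u` of `S` is a leaf, because passage times increase away from the
source, and it was the first boundary node of `S.erase u` to be reached. Almost sure absence of ties
makes it strictly last. -/
lemma IsPassage.stageEvent_ae_eq (hG : G.IsTree) [Countable V] (h : IsPassage G s T X)
    (hX : ∀ v, Measurable (X v)) (hind : iIndepFun X P)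
    (hlaw : ∀ v, P.map (X v) = expMeasure 1) {S : Finset V} (hS : Good G s S) (hc : 1 < S.card) :
    stageEvent G s T S =ᵐ[P] (⋃ u ∈ leaves G s S, nextEvent G s T (S.erase u) u : Set Ω) := by
  have hties : ∀ᵐ ω ∂P, ∀ u ∈ leaves G s S, ∀ v ∈ S.erase u, T v ω ≠ T u ω := by
    rw [Filter.eventually_all_finset]
    intro u hu
    rw [Filter.eventually_all_finset]
    intro v hv
    obtain ⟨-, h1, h2⟩ := Finset.mem_filter.1 hu
    have := h.measure_tie hG hX hind hlaw h1 h2 hv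
    rw [ae_iff]
    convert this using 3
    simp
  filter_upwards [hties, ae_pos_of_exp hX hlaw] with ω hω hpos
  have hlt : ∀ v, v ≠ s → T (par G s v) ω < T v ω := fun v hv => by
    rw [h.step v hv]; linarith [hpos v]
  refine propext ⟨fun hE => ?_, fun hF => ?_⟩
  · obtain ⟨u, huS, hmax⟩ := S.exists_max_image (fun v => T v ω) ⟨s, hS.1⟩
    have hus : u ≠ s := by
      rintro rfl
      obtain ⟨v, hv, hvs⟩ := Finset.exists_mem_ne hc u
      have := h.pos hG hpos hvs
      have := hmax v hv
      rw [h.root] at this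
      linarith
    have hadj := (par_spec hG hus).1
    have hgood : Good G s (S.erase u) := by
      refine ⟨Finset.mem_erase.2 ⟨hus.symm, hS.1⟩, fun v hv hvs => ?_⟩
      have hvS := Finset.mem_of_mem_erase hv
      refine Finset.mem_erase.2 ⟨fun he => ?_, hS.2 v hvS hvs⟩
      have h1 := hlt v hvs
      rw [he] at h1
      exact absurd (hmax v hvS) (not_le.2 h1)
    have hub : u ∈ bdry G s (S.erase u) := by
      rw [mem_bdry hG]
      exact ⟨Finset.notMem_erase u S, hus,
        Finset.mem_erase.2 ⟨hadj.ne, hS.2 u huS hus⟩⟩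
    have hleaf : u ∈ leaves G s S := Finset.mem_filter.2 ⟨huS, hgood, hub⟩
    have hnext : ∀ w ∈ bdry G s (S.erase u), w ≠ u → T u ω < T w ω := by
      intro w hw hwu
      obtain ⟨h1, h2, h3⟩ := (mem_bdry hG).1 hw
      refine hE u huS w ((mem_bdry hG).2 ⟨fun hwS => h1 (Finset.mem_erase.2 ⟨hwu, hwS⟩), h2,
        Finset.mem_of_mem_erase h3⟩)
    refine Set.mem_biUnion hleaf ⟨fun v hv w hw => ?_, hnext⟩
    have h1 := lt_of_le_of_ne (hmax v (Finset.mem_of_mem_erase hv)) (hω u hleaf v hv)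
    by_cases hwu : w = u
    · rw [hwu]; exact h1
    · exact h1.trans (hnext w hw hwu)
  · obtain ⟨u, hleaf, hE, hnext⟩ := Set.mem_iUnion₂.1 hF
    obtain ⟨huS, hgood, hub⟩ := Finset.mem_filter.1 hleaf
    intro v hv w hw
    obtain ⟨h1, h2, h3⟩ := (mem_bdry hG).1 hw
    have hvu : T v ω ≤ T u ω := by
      by_cases hvu : v = u
      · rw [hvu]
      · exact (hE v (Finset.mem_erase.2 ⟨hvu, hv⟩) u hub).le
    refine hvu.trans_lt ?_
    by_cases hpw : par G s w = u
    · rw [← hpw]; exact hlt w h2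
    · refine hnext w ((mem_bdry hG).2 ⟨fun hwS => h1 (Finset.mem_of_mem_erase hwS), h2,
        Finset.mem_erase.2 ⟨hpw, h3⟩⟩) ?_
      rintro rfl
      exact h1 huS

lemma IsPassage.measureReal_stageEvent_succ (hG : G.IsTree) [Countable V] (h : IsPassage G s T X)
    (hX : ∀ v, Measurable (X v)) (hind : iIndepFun X P)
    (hlaw : ∀ v, P.map (X v) = expMeasure 1) {S : Finset V} (hS : Good G s S) (hc : 1 < S.card) :
    P.real (stageEvent G s T S) = ∑ u ∈ leaves G s S,
      P.real (stageEvent G s T (S.erase u)) / (bdry G s (S.erase u)).card := by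
  have hT := h.measurable hG hX
  rw [measureReal_congr (h.stageEvent_ae_eq hG hX hind hlaw hS hc),
    measureReal_biUnion_finset _ fun u _ => measurableSet_nextEvent hT _ u]
  · refine Finset.sum_congr rfl fun u hu => ?_
    obtain ⟨-, h1, h2⟩ := Finset.mem_filter.1 hu
    exact h.measureReal_nextEvent hG hX hind hlaw h1 h2
  · intro u hu u' hu' hne
    obtain ⟨huS, -, hub⟩ := Finset.mem_filter.1 hu
    obtain ⟨huS', -, hub'⟩ := Finset.mem_filter.1 hu'
    refine Set.disjoint_left.2 fun ω hω hω' => ?_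
    have h1 := hω.1 u' (Finset.mem_erase.2 ⟨hne.symm, huS'⟩) u hub
    have h2 := hω'.1 u (Finset.mem_erase.2 ⟨hne, huS⟩) u' hub'
    exact lt_asymm h1 h2

/-- The number of spreading histories of `n + 1` infected nodes in the regular tree. -/
def totalHist (δ n : ℕ) : ℝ := ∏ k ∈ Finset.range n, ((δ - 2 : ℕ) * (k + 1 : ℝ) + 2)

lemma totalHist_pos (δ n : ℕ) : 0 < totalHist δ n :=
  Finset.prod_pos fun k _ => by positivity

/-- Both sides satisfy the same recursion over the node added last. Every single history has the
probability `1 / totalHist`, since each boundary size on the way depends only on the number of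
nodes. -/
lemma IsPassage.measureReal_stageEvent (hG : G.IsTree) [Countable V] {δ : ℕ} (hδ : 3 ≤ δ)
    (hreg : G.IsRegularOfDegree δ) (h : IsPassage G s T X)
    (hX : ∀ v, Measurable (X v)) (hind : iIndepFun X P)
    (hlaw : ∀ v, P.map (X v) = expMeasure 1) {n : ℕ} {S : Finset V} (hS : Good G s S)
    (hn : S.card = n + 1) :
    P.real (stageEvent G s T S) = hist G s n S / totalHist δ n := by
  induction n generalizing S with
  | zero =>
    obtain ⟨x, rfl⟩ := Finset.card_eq_one.1 hn
    have hx := Finset.mem_singleton.1 hS.1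
    subst hx
    have : stageEvent G s T {s} =ᵐ[P] (Set.univ : Set Ω) := by
      filter_upwards [ae_pos_of_exp hX hlaw] with ω hpos
      refine propext ⟨fun _ => trivial, fun _ v hv w hw => ?_⟩
      rw [Finset.mem_singleton.1 hv, h.root]
      exact h.pos hG hpos ((mem_bdry hG).1 hw).2.1
    rw [measureReal_congr this]
    simp [hist, totalHist]
  | succ n ih =>
    rw [h.measureReal_stageEvent_succ hG hX hind hlaw hS (by omega), hist_succ_leaves hG,
      Nat.cast_sum, Finset.sum_div]
    refine Finset.sum_congr rfl fun u hu => ?_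
    obtain ⟨huS, hg, -⟩ := Finset.mem_filter.1 hu
    have hc : (S.erase u).card = n + 1 := by rw [Finset.card_erase_of_mem huS]; omega
    rw [ih hg hc, card_bdry hG hδ hreg hg, hc, totalHist, totalHist, Finset.prod_range_succ,
      div_div]
    push_cast
    ring

end Passage

/-! ### The law of the infected network -/

section Network

variable {V Ω : Type*} {G : SimpleGraph V}

lemma infectionTime_eq (hG : G.IsTree) (τ : G.Dart → Ω → ℝ) {s v : V} (p : G.Walk s v)
    (hp : p.IsPath) (ω : Ω) :
    infectionTime τ s v ω = (p.darts.map fun e => τ e ω).sum := by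
  have := hG.isAcyclic.subsingleton_path s v
  exact ciInf_subsingleton (⟨p, hp⟩ : G.Path s v) _

/-- The source has no parent, but an arbitrary dart into it, whose time is never used, lets the edge
times be indexed by all nodes. Distinct heads make the assignment injective, so independence carries
over. -/
lemma exists_inDart [G.LocallyFinite] {δ : ℕ} (hG : G.IsTree) (hδ : 3 ≤ δ)
    (hreg : G.IsRegularOfDegree δ) (s : V) :
    ∃ e : V → G.Dart, (∀ v, (e v).snd = v) ∧ ∀ v, v ≠ s → (e v).fst = par G s v := by
  have h : ∀ v, ∃ e : G.Dart, e.snd = v ∧ (v ≠ s → e.fst = par G s v) := by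
    intro v
    by_cases hv : v = s
    · have : 0 < (G.neighborFinset v).card := by
        rw [SimpleGraph.card_neighborFinset_eq_degree, hreg v]; omega
      obtain ⟨w, hw⟩ := Finset.card_pos.1 this
      rw [SimpleGraph.mem_neighborFinset] at hw
      exact ⟨⟨(w, v), hw.symm⟩, rfl, fun h => absurd hv h⟩
    · exact ⟨⟨(par G s v, v), (par_spec hG hv).1⟩, rfl, fun _ => rfl⟩
  choose e h1 h2 using h
  exact ⟨e, h1, h2⟩

lemma isPassage_infectionTime (hG : G.IsTree) (τ : G.Dart → Ω → ℝ) {s : V} {e : V → G.Dart}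
    (he : ∀ v, (e v).snd = v) (he' : ∀ v, v ≠ s → (e v).fst = par G s v) :
    IsPassage G s (infectionTime τ s) (fun v => τ (e v)) where
  root ω := by rw [infectionTime_eq hG τ SimpleGraph.Walk.nil (by simp)]; simp
  step v hv ω := by
    obtain ⟨ha, hd⟩ := par_spec hG hv
    obtain ⟨p, hp, hl⟩ := hG.connected.exists_path_of_dist s (par G s v)
    have hv' : v ∉ p.support := by
      intro hmem
      have := SimpleGraph.dist_le (p.takeUntil v hmem)
      have := p.length_takeUntil_le_length hmem
      omega
    rw [infectionTime_eq hG τ _ (hp.concat hv' ha), infectionTime_eq hG τ _ hp,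
      SimpleGraph.Walk.darts_concat]
    have : e v = ⟨(par G s v, v), ha⟩ := by
      apply SimpleGraph.Dart.ext
      exact Prod.ext (he' v hv) (he v)
    simp [this]

lemma infectedNetwork_spec {τ : G.Dart → Ω → ℝ} {s : V} {S : Finset V} {ω : Ω} {t : ℝ}
    (h : infectedAt τ s ω t = S) : infectedNetwork τ s S.card ω = S := by
  have hex : ∃ S' : Finset V, S'.card = S.card ∧ ∃ t : ℝ, infectedAt τ s ω t = (S' : Set V) :=
    ⟨S, rfl, t, h⟩
  rw [infectedNetwork, dif_pos hex]
  obtain ⟨h1, t', h2⟩ := hex.choose_spec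
  have hmono : ∀ {a b : ℝ}, a ≤ b → infectedAt τ s ω a ⊆ infectedAt τ s ω b :=
    fun hab v hv => le_trans hv hab
  rcases le_total t t' with ht | ht
  · have := hmono ht
    rw [h, h2, Finset.coe_subset] at this
    exact (Finset.eq_of_subset_of_card_le this h1.le).symm
  · have := hmono ht
    rw [h, h2, Finset.coe_subset] at this
    exact Finset.eq_of_subset_of_card_le this h1.ge

lemma exists_time_of_infectedNetwork {τ : G.Dart → Ω → ℝ} {s : V} {S : Finset V} {ω : Ω}
    (hS : S.Nonempty) (h : infectedNetwork τ s S.card ω = S) :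
    ∃ t, infectedAt τ s ω t = S := by
  by_cases hex : ∃ S' : Finset V, S'.card = S.card ∧ ∃ t : ℝ, infectedAt τ s ω t = (S' : Set V)
  · obtain ⟨h1, t', h2⟩ := hex.choose_spec
    rw [infectedNetwork, dif_pos hex] at h
    exact ⟨t', by rw [h2, h]⟩
  · rw [infectedNetwork, dif_neg hex] at h
    exact absurd h.symm hS.ne_empty

lemma infectedNetwork_iff [G.LocallyFinite] (hG : G.IsTree) {τ : G.Dart → Ω → ℝ} {s : V} {X : V → Ω → ℝ}
    (hp : IsPassage G s (infectionTime τ s) X) {ω : Ω} (hpos : ∀ v, 0 < X v ω) {S : Finset V}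
    (hne : S.Nonempty) :
    infectedNetwork τ s S.card ω = S ↔ Good G s S ∧ ω ∈ stageEvent G s (infectionTime τ s) S := by
  have hlt : ∀ v, v ≠ s → infectionTime τ s (par G s v) ω < infectionTime τ s v ω := fun v hv => by
    rw [hp.step v hv]; linarith [hpos v]
  constructor
  · intro h
    obtain ⟨t, ht⟩ := exists_time_of_infectedNetwork hne h
    have hmem : ∀ v, v ∈ S ↔ infectionTime τ s v ω ≤ t := fun v => by
      rw [← Finset.mem_coe, ← ht]; rfl
    refine ⟨⟨?_, fun v hv hvs => ?_⟩, fun v hv w hw => ?_⟩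
    · obtain ⟨v, hv⟩ := hne
      rw [hmem] at hv ⊢
      rw [hp.root]
      exact (hp.nonneg hG hpos v).trans hv
    · rw [hmem] at hv ⊢
      exact (hlt v hvs).le.trans hv
    · have h1 := ((mem_bdry hG).1 hw).1
      rw [hmem] at hv h1
      exact hv.trans_lt (not_le.1 h1)
  · rintro ⟨hS, hE⟩
    obtain ⟨u, huS, hmax⟩ := S.exists_max_image (fun v => infectionTime τ s v ω) hne
    apply infectedNetwork_spec (t := infectionTime τ s u ω)
    ext v
    rw [Finset.mem_coe]
    refine ⟨fun hv => ?_, fun hv => hmax v hv⟩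
    by_contra hvS
    -- Nodes beyond the boundary are reached even later: walk back towards the source until the path
    -- meets the boundary.
    have key : ∀ n v, G.dist s v = n → v ∉ S →
        infectionTime τ s u ω < infectionTime τ s v ω := by
      intro n
      induction n with
      | zero => intro v hn hvS; exact absurd (dist_eq_zero' hG hn ▸ hS.1) hvS
      | succ n ih =>
        intro v hn hvS
        have hvs : v ≠ s := by rintro rfl; simp at hn
        by_cases hpS : par G s v ∈ S
        · exact hE u huS v ((mem_bdry hG).2 ⟨hvS, hvs, hpS⟩)
        · exact (ih _ (by have := (par_spec hG hvs).2; omega) hpS).trans (hlt v hvs)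
    exact absurd hv (not_le.2 (key _ v rfl hvS))

variable [MeasurableSpace Ω]

lemma mlNodes_nonempty {P : Measure Ω} {τ : G.Dart → Ω → ℝ} {S : Finset V} (hS : S.Nonempty) :
    (mlNodes P τ S).Nonempty := by
  obtain ⟨x, hx, hmax⟩ := S.exists_max_image (likelihood P τ S) hS
  exact ⟨x, Finset.mem_filter.2 ⟨hx, hmax⟩⟩

/-- The spreading model on the regular tree. -/
structure ExpSpread (G : SimpleGraph V) [G.LocallyFinite] (δ : ℕ) (P : Measure Ω)
    (τ : G.Dart → Ω → ℝ) : Prop where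
  tree : G.IsTree
  deg : 3 ≤ δ
  reg : G.IsRegularOfDegree δ
  meas : ∀ e, Measurable (τ e)
  indep : iIndepFun τ P
  law : ∀ e, HasLaw (τ e) (expMeasure 1) P

variable [G.LocallyFinite] {δ : ℕ} {P : Measure Ω} {τ : G.Dart → Ω → ℝ}

lemma ExpSpread.exists_passage (M : ExpSpread G δ P τ) (s : V) :
    ∃ X : V → Ω → ℝ, IsPassage G s (infectionTime τ s) X ∧ (∀ v, Measurable (X v)) ∧
      iIndepFun X P ∧ ∀ v, P.map (X v) = expMeasure 1 := by
  obtain ⟨e, h1, h2⟩ := exists_inDart M.tree M.deg M.reg s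
  refine ⟨fun v => τ (e v), isPassage_infectionTime M.tree τ h1 h2, fun v => M.meas _,
    M.indep.precomp (g := e) fun v w h => ?_, fun v => (M.law _).map_eq⟩
  rw [← h1 v, ← h1 w, h]

variable [IsProbabilityMeasure P] [Countable V]

lemma ExpSpread.network_ae_eq (M : ExpSpread G δ P τ) (s : V) {S : Finset V}
    (hne : S.Nonempty) : {ω | infectedNetwork τ s S.card ω = S} =ᵐ[P]
      (if Good G s S then stageEvent G s (infectionTime τ s) S else ∅ : Set Ω) := by
  obtain ⟨X, hp, hX, hind, hlaw⟩ := M.exists_passage s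
  filter_upwards [ae_pos_of_exp hX hlaw] with ω hpos
  have := infectedNetwork_iff M.tree hp hpos hne
  by_cases h : Good G s S
  · rw [if_pos h]
    exact propext (this.trans (and_iff_right h))
  · rw [if_neg h]
    exact propext (this.trans ⟨fun h' => h h'.1, False.elim⟩)

/-- Only null measurability is available in this way, since the description by `stageEvent` needs
positive edge times, which hold almost surely. -/
lemma ExpSpread.nullMeasurableSet_network (M : ExpSpread G δ P τ) (s : V) {S : Finset V}
    (hne : S.Nonempty) : NullMeasurableSet {ω | infectedNetwork τ s S.card ω = S} P := by
  obtain ⟨X, hp, hX, hind, hlaw⟩ := M.exists_passage s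
  refine NullMeasurableSet.congr ?_ (M.network_ae_eq s hne).symm
  split_ifs
  · exact (measurableSet_stageEvent (hp.measurable M.tree hX) S).nullMeasurableSet
  · exact MeasurableSet.empty.nullMeasurableSet

lemma ExpSpread.measureReal_network (M : ExpSpread G δ P τ) (s : V) {S : Finset V} {n : ℕ}
    (hn : S.card = n + 1) :
    P.real {ω | infectedNetwork τ s S.card ω = S} = hist G s n S / totalHist δ n := by
  have hne : S.Nonempty := Finset.card_pos.1 (by omega)
  obtain ⟨X, hp, hX, hind, hlaw⟩ := M.exists_passage s
  rw [measureReal_congr (M.network_ae_eq s hne)]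
  split_ifs with h
  · exact hp.measureReal_stageEvent M.tree M.deg M.reg hX hind hlaw h hn
  · have : hist G s n S = 0 := by
      by_contra h0
      exact h (good_of_hist_ne_zero M.tree h0).1
    simp [this]

lemma ExpSpread.likelihood_eq (M : ExpSpread G δ P τ) (v : V) {S : Finset V} {n : ℕ}
    (hn : S.card = n + 1) : likelihood P τ S v = hist G v n S / totalHist δ n :=
  M.measureReal_network v hn

/-- If the majority of the infected nodes is on one side of an edge, then so is every
maximum likelihood node. -/
lemma ExpSpread.mlNodes_subset_side (M : ExpSpread G δ P τ) {s u v : V} (h : G.Adj u v)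
    {S : Finset V} {n : ℕ} (hn : S.card = n + 1) (hs : hist G s n S ≠ 0)
    (hmaj : n + 1 < 2 * (S.filter (· ∈ side G u v)).card) :
    ∀ x ∈ mlNodes P τ S, x ∈ side G u v := by
  intro x hx
  obtain ⟨hxS, hmax⟩ := Finset.mem_filter.1 hx
  have hmax' : ∀ y ∈ S, hist G y n S ≤ hist G x n S := by
    intro y hy
    have := hmax y hy
    rw [M.likelihood_eq y hn, M.likelihood_eq x hn,
      div_le_div_iff_of_pos_right (totalHist_pos δ n)] at this
    exact_mod_cast this
  have hsS := (good_of_hist_ne_zero M.tree hs).1.1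
  exact mem_side_of_hist_max M.tree h hn (by have := hmax' s hsS; omega) hmax' hmaj

lemma ExpSpread.mlNodes_subset_desc (M : ExpSpread G δ P τ) {s w : V} (hw : w ≠ s)
    {S : Finset V} {n : ℕ} (hn : S.card = n + 1) (hs : hist G s n S ≠ 0)
    (hmaj : n + 1 < 2 * descCount G s w S) : ∀ x ∈ mlNodes P τ S, x ∈ desc G s w :=
  M.mlNodes_subset_side (par_spec M.tree hw).1 hn hs hmaj

lemma ExpSpread.mlNodes_disjoint_desc (M : ExpSpread G δ P τ) {s w : V} (hw : w ≠ s)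
    {S : Finset V} {n : ℕ} (hn : S.card = n + 1) (hs : hist G s n S ≠ 0)
    (hmaj : 2 * descCount G s w S < n + 1) : ∀ x ∈ mlNodes P τ S, x ∉ desc G s w := by
  intro x hx
  have ha := (par_spec M.tree hw).1
  rw [desc, notMem_side M.tree ha]
  refine M.mlNodes_subset_side ha.symm hn hs ?_ x hx
  have h1 : S.filter (· ∈ side G w (par G s w)) = S.filter (· ∉ desc G s w) := by
    refine Finset.filter_congr fun y _ => ?_
    rw [desc, notMem_side M.tree ha]
  have h2 := Finset.card_filter_add_card_filter_not (s := S) (· ∈ desc G s w)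
  rw [h1]
  rw [descCount] at hmaj
  omega

end Network

/-! ### The growth process -/

section Growth

variable {V : Type*} {G : SimpleGraph V} {δ : ℕ} {s : V}

lemma descCount_eq_zero (hG : G.IsTree) {w : V} (hw : w ≠ s) {S : Finset V} (hS : Good G s S)
    (hwS : w ∉ S) : descCount G s w S = 0 := by
  rw [descCount, Finset.card_eq_zero, Finset.filter_eq_empty_iff]
  have key : ∀ n x, G.dist s x = n → x ∈ S → x ∉ desc G s w := by
    intro n
    induction n with
    | zero =>
      intro x hn _
      rw [← dist_eq_zero' hG hn]
      exact root_notMem_desc hG hw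
    | succ n ih =>
      intro x hn hx hxd
      have hxs : x ≠ s := by rintro rfl; simp at hn
      rcases (mem_desc_iff hG hw hxs).1 hxd with rfl | h
      · exact hwS hx
      · exact ih _ (by have := (par_spec hG hxs).2; omega) (hS.2 x hx hxs) h
  exact fun x hx => key _ x rfl hx

lemma descCount_insert {w u : V} {S : Finset V} (hu : u ∉ S) :
    descCount G s w (insert u S) = descCount G s w S + if u ∈ desc G s w then 1 else 0 := by
  rw [descCount, Finset.filter_insert]
  split_ifs
  · rw [Finset.card_insert_of_notMem (by simp [hu]), descCount]
  · rw [descCount, add_zero]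

variable [G.LocallyFinite]

/-- The subtrees with `n + 1` nodes that contain the root. -/
def stageSets (G : SimpleGraph V) [G.LocallyFinite] (s : V) : ℕ → Finset (Finset V)
  | 0 => {{s}}
  | n + 1 => (stageSets G s n).biUnion fun S => (bdry G s S).image fun u => insert u S

lemma mem_stageSets (hG : G.IsTree) {s : V} {n : ℕ} {S : Finset V} :
    S ∈ stageSets G s n ↔ Good G s S ∧ S.card = n + 1 := by
  induction n generalizing S with
  | zero =>
    rw [stageSets, Finset.mem_singleton]
    constructor
    · rintro rfl; exact ⟨good_singleton s, by simp⟩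
    · rintro ⟨h1, h2⟩
      obtain ⟨x, rfl⟩ := Finset.card_eq_one.1 h2
      rw [Finset.mem_singleton.1 h1.1]
  | succ n ih =>
    simp only [stageSets, Finset.mem_biUnion, Finset.mem_image]
    constructor
    · rintro ⟨S, hS, u, hu, rfl⟩
      obtain ⟨h1, h2⟩ := ih.1 hS
      exact ⟨h1.insert hG hu, by
        rw [Finset.card_insert_of_notMem ((mem_bdry hG).1 hu).1, h2]⟩
    · rintro ⟨h1, h2⟩
      -- A node at maximal distance from the root has no child in `S` and may be removed.
      obtain ⟨u, huS, hmax⟩ := S.exists_max_image (fun v => G.dist s v) ⟨s, h1.1⟩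
      have hus : u ≠ s := by
        rintro rfl
        obtain ⟨v, hv, hvs⟩ := Finset.exists_mem_ne (by omega : 1 < S.card) u
        have := hmax v hv
        rw [SimpleGraph.dist_self] at this
        exact hvs (dist_eq_zero' hG (by omega)).symm
      have hadj := (par_spec hG hus).1
      refine ⟨S.erase u, ih.2 ⟨⟨Finset.mem_erase.2 ⟨hus.symm, h1.1⟩, fun v hv hvs => ?_⟩, ?_⟩, u,
        (mem_bdry hG).2 ⟨Finset.notMem_erase u S, hus,
          Finset.mem_erase.2 ⟨hadj.ne, h1.2 u huS hus⟩⟩, Finset.insert_erase huS⟩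
      · have hvS := Finset.mem_of_mem_erase hv
        refine Finset.mem_erase.2 ⟨fun he => ?_, h1.2 v hvS hvs⟩
        have h3 := (par_spec hG hvs).2
        rw [he] at h3
        have := hmax v hvS
        omega
      · rw [Finset.card_erase_of_mem huS]; omega

/-- The size of the boundary of a subtree with `n + 1` nodes. -/
def bdrySize (δ n : ℕ) : ℝ := (δ - 2 : ℕ) * (n + 1 : ℝ) + 2

lemma bdrySize_pos (δ n : ℕ) : 0 < bdrySize δ n := by unfold bdrySize; positivity

lemma totalHist_succ (δ n : ℕ) : totalHist δ (n + 1) = totalHist δ n * bdrySize δ n := by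
  rw [totalHist, Finset.prod_range_succ, totalHist, bdrySize]

/-- The expected value of `φ` at the network with `n + 1` infected nodes. -/
def mean (G : SimpleGraph V) [G.LocallyFinite] (δ : ℕ) (s : V) (n : ℕ) (φ : Finset V → ℝ) : ℝ :=
  ∑ S ∈ stageSets G s n, hist G s n S / totalHist δ n * φ S

lemma mean_zero (φ : Finset V → ℝ) : mean G δ s 0 φ = φ {s} := by
  simp [mean, stageSets, hist, totalHist]

/-- The Markov property of the growth: the next node is uniform on the boundary. Pairs of a set and
its last node correspond to pairs of a smaller set and a boundary node. -/
lemma mean_succ (hG : G.IsTree) (n : ℕ) (φ : Finset V → ℝ) :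
    mean G δ s (n + 1) φ =
      mean G δ s n fun S => (∑ u ∈ bdry G s S, φ (insert u S)) / bdrySize δ n := by
  have e1 : mean G δ s (n + 1) φ = ∑ S ∈ stageSets G s (n + 1), ∑ u ∈ leaves G s S,
      hist G s n (S.erase u) / totalHist δ (n + 1) * φ S := by
    refine Finset.sum_congr rfl fun S _ => ?_
    rw [hist_succ_leaves hG, Nat.cast_sum, Finset.sum_div, Finset.sum_mul]
  have e2 : mean G δ s n (fun S => (∑ u ∈ bdry G s S, φ (insert u S)) / bdrySize δ n) =
      ∑ S ∈ stageSets G s n, ∑ u ∈ bdry G s S,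
        hist G s n S / totalHist δ (n + 1) * φ (insert u S) := by
    refine Finset.sum_congr rfl fun S _ => ?_
    rw [← Finset.mul_sum, totalHist_succ, div_mul_div_comm, mul_div_right_comm]
  rw [e1, e2, Finset.sum_sigma', Finset.sum_sigma']
  refine Finset.sum_bij' (fun x _ => ⟨x.1.erase x.2, x.2⟩) (fun x _ => ⟨insert x.2 x.1, x.2⟩)
    ?_ ?_ ?_ ?_ ?_
  · rintro ⟨S, u⟩ hx
    obtain ⟨hS, hu⟩ := Finset.mem_sigma.1 hx
    obtain ⟨huS, hg, hb⟩ := Finset.mem_filter.1 hu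
    have hc : S.card = n + 1 + 1 := ((mem_stageSets hG).1 hS).2
    refine Finset.mem_sigma.2 ⟨(mem_stageSets hG).2 ⟨hg, ?_⟩, hb⟩
    rw [Finset.card_erase_of_mem huS, hc]
    rfl
  · rintro ⟨S, u⟩ hx
    obtain ⟨hS, hu⟩ := Finset.mem_sigma.1 hx
    obtain ⟨hg, hc⟩ := (mem_stageSets hG).1 hS
    have huS := ((mem_bdry hG).1 hu).1
    refine Finset.mem_sigma.2 ⟨(mem_stageSets hG).2 ⟨hg.insert hG hu, ?_⟩,
      Finset.mem_filter.2 ⟨Finset.mem_insert_self _ _, ?_⟩⟩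
    · rw [Finset.card_insert_of_notMem huS]
      exact congrArg (· + 1) hc
    · rw [Finset.erase_insert huS]; exact ⟨hg, hu⟩
  · rintro ⟨S, u⟩ hx
    obtain ⟨hS, hu⟩ := Finset.mem_sigma.1 hx
    have huS := (Finset.mem_filter.1 hu).1
    simp only [Finset.insert_erase huS]
  · rintro ⟨S, u⟩ hx
    obtain ⟨hS, hu⟩ := Finset.mem_sigma.1 hx
    have huS := ((mem_bdry hG).1 hu).1
    simp only [Finset.erase_insert huS]
  · rintro ⟨S, u⟩ hx
    obtain ⟨hS, hu⟩ := Finset.mem_sigma.1 hx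
    have huS := (Finset.mem_filter.1 hu).1
    simp only [Finset.insert_erase huS]

lemma mean_congr (hG : G.IsTree) {n : ℕ} {φ ψ : Finset V → ℝ}
    (h : ∀ S, Good G s S → S.card = n + 1 → φ S = ψ S) : mean G δ s n φ = mean G δ s n ψ :=
  Finset.sum_congr rfl fun S hS => by
    obtain ⟨h1, h2⟩ := (mem_stageSets hG).1 hS
    rw [h S h1 h2]

lemma mean_add (n : ℕ) (φ ψ : Finset V → ℝ) :
    mean G δ s n (fun S => φ S + ψ S) = mean G δ s n φ + mean G δ s n ψ := by
  simp only [mean, mul_add, Finset.sum_add_distrib]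

lemma mean_mul_const (n : ℕ) (φ : Finset V → ℝ) (c : ℝ) :
    mean G δ s n (fun S => φ S * c) = mean G δ s n φ * c := by
  simp only [mean, ← mul_assoc, Finset.sum_mul]

lemma mean_sum {ι : Type*} (I : Finset ι) (n : ℕ) (φ : ι → Finset V → ℝ) :
    mean G δ s n (fun S => ∑ i ∈ I, φ i S) = ∑ i ∈ I, mean G δ s n (φ i) := by
  simp only [mean, Finset.mul_sum]
  exact Finset.sum_comm

lemma mean_mono (hG : G.IsTree) {n : ℕ} {φ ψ : Finset V → ℝ}
    (h : ∀ S, Good G s S → S.card = n + 1 → φ S ≤ ψ S) : mean G δ s n φ ≤ mean G δ s n ψ :=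
  Finset.sum_le_sum fun S hS => by
    obtain ⟨h1, h2⟩ := (mem_stageSets hG).1 hS
    exact mul_le_mul_of_nonneg_left (h S h1 h2)
      (div_nonneg (Nat.cast_nonneg _) (totalHist_pos δ n).le)

lemma cast_card_bdry (hG : G.IsTree) (hδ : 3 ≤ δ) (hreg : G.IsRegularOfDegree δ) {n : ℕ}
    {S : Finset V} (hS : Good G s S) (hc : S.card = n + 1) :
    ((bdry G s S).card : ℝ) = bdrySize δ n := by
  rw [card_bdry hG hδ hreg hS, hc, bdrySize]
  push_cast
  ring

/-- The weights in `mean` add up to one; with `mean_succ` this is the count of the boundary. -/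
lemma mean_const (hG : G.IsTree) (hδ : 3 ≤ δ) (hreg : G.IsRegularOfDegree δ) (n : ℕ) (c : ℝ) :
    mean G δ s n (fun _ => c) = c := by
  induction n with
  | zero => rw [mean_zero]
  | succ n ih =>
    rw [mean_succ hG]
    refine (mean_congr hG fun S h1 h2 => ?_).trans ih
    rw [Finset.sum_const, nsmul_eq_mul, cast_card_bdry hG hδ hreg h1 h2,
      mul_div_cancel_left₀ _ (bdrySize_pos δ n).ne']

/-! ### Arrival at a node and growth of its subtree -/

/-- The probability that `v` is the `n + 1`-st infected node. -/
def arrival (G : SimpleGraph V) [G.LocallyFinite] (δ : ℕ) (s v : V) : ℕ → ℝ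
  | 0 => if v = s then 1 else 0
  | n + 1 => mean G δ s n (fun S => if v ∈ bdry G s S then 1 else 0) / bdrySize δ n

/-- The alternatives in `h` are the two moments at which the urn for `w` may be started: the arrival
of `w` itself, when one node below it is infected, or the arrival of its parent, when none is but
`w` is a boundary node. -/
lemma mean_desc_zero {v w : V} {i₀ : ℕ} (hG : G.IsTree) (hw : w ≠ s)
    (h : (w = v ∧ i₀ = 1) ∨ (par G s w = v ∧ i₀ = 0)) (ψ : ℕ → ℝ) :
    mean G δ s 0 (fun S => if v ∈ S then ψ (descCount G s w S) else 0) =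
      arrival G δ s v 0 * ψ i₀ := by
  rw [mean_zero, arrival]
  by_cases hv : v = s
  · subst hv
    rcases h with ⟨h, -⟩ | ⟨-, rfl⟩
    · exact absurd h hw
    · rw [descCount_eq_zero hG hw (good_singleton v) (by simpa using hw)]
      simp
  · simp [hv]

/-- If `v` is already infected, `card_bdry_desc` counts the boundary nodes below `w`, the remaining
ones leave the count unchanged, and the step is a draw from an urn. Otherwise only the arrival of
`v` contributes, and the count then starts at `i₀`. -/
lemma mean_desc_succ (hG : G.IsTree) (hδ : 3 ≤ δ) (hreg : G.IsRegularOfDegree δ) {v w : V}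
    {i₀ : ℕ} (hw : w ≠ s) (h : (w = v ∧ i₀ = 1) ∨ (par G s w = v ∧ i₀ = 0)) (n : ℕ) (ψ : ℕ → ℝ) :
    mean G δ s (n + 1) (fun S => if v ∈ S then ψ (descCount G s w S) else 0) =
      mean G δ s n (fun S => if v ∈ S then
        (((δ - 2 : ℕ) * (descCount G s w S : ℝ) + 1) * ψ (descCount G s w S + 1) +
          ((δ - 2 : ℕ) * (n + 1 - descCount G s w S : ℝ) + 1) * ψ (descCount G s w S)) /
          bdrySize δ n else 0) +
      arrival G δ s v (n + 1) * ψ i₀ := by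
  have hb := (bdrySize_pos δ n).ne'
  rw [mean_succ hG, arrival, div_mul_eq_mul_div, ← mean_mul_const, ← mul_one_div, ← mean_mul_const,
    ← mean_add]
  refine mean_congr hG fun S hS hc => ?_
  have hcb := cast_card_bdry hG hδ hreg hS hc
  by_cases hvS : v ∈ S
  · have hp : par G s w ∈ S := by
      rcases h with ⟨rfl, -⟩ | ⟨rfl, -⟩
      · exact hS.2 w hvS hw
      · exact hvS
    have hvb : v ∉ bdry G s S := fun hh => ((mem_bdry hG).1 hh).1 hvS
    rw [if_pos hvS, if_neg hvb, zero_mul, zero_mul, add_zero]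
    have h1 : ∀ u ∈ bdry G s S,
        (if v ∈ insert u S then ψ (descCount G s w (insert u S)) else 0) =
        if u ∈ desc G s w then ψ (descCount G s w S + 1) else ψ (descCount G s w S) := by
      intro u hu
      rw [if_pos (Finset.mem_insert_of_mem hvS), descCount_insert ((mem_bdry hG).1 hu).1]
      split_ifs <;> rfl
    have h2 := Finset.card_filter_add_card_filter_not (s := bdry G s S) (· ∈ desc G s w)
    have h3 := card_bdry_desc hG hδ hreg hw hS hp
    have h4 : ((bdry G s S).filter (· ∉ desc G s w)).card =
        bdrySize δ n - ((δ - 2 : ℕ) * (descCount G s w S : ℝ) + 1) := by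
      rw [← hcb, ← h2, h3]; push_cast; ring
    rw [Finset.sum_congr rfl h1, Finset.sum_ite, Finset.sum_const, Finset.sum_const, nsmul_eq_mul,
      nsmul_eq_mul, h4, h3, bdrySize]
    push_cast
    ring
  · rw [if_neg hvS, zero_add]
    have h1 : ∀ u ∈ bdry G s S,
        (if v ∈ insert u S then ψ (descCount G s w (insert u S)) else 0) =
        if v = u then ψ i₀ else 0 := by
      intro u hu
      have hiff : v ∈ insert u S ↔ v = u := by simp [hvS]
      simp only [hiff]
      split_ifs with hvu
      · subst hvu
        congr 1
        rw [descCount_insert hvS]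
        rcases h with ⟨rfl, rfl⟩ | ⟨rfl, rfl⟩
        · rw [descCount_eq_zero hG hw hS hvS, if_pos (mem_desc_self hG hw)]
        · rw [if_neg par_notMem_desc, descCount_eq_zero hG hw hS fun hh => hvS (hS.2 w hh hw)]
      · rfl
    rw [Finset.sum_congr rfl h1, Finset.sum_ite_eq, ite_mul, ite_mul, one_mul, zero_mul, zero_mul]
    split_ifs
    · ring
    · simp

end Growth

/-! ### The urn -/

section Urn

lemma beta_succ_left {a b : ℝ} (ha : 0 < a) (hb : 0 < b) :
    beta (a + 1) b = a / (a + b) * beta a b := by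
  have h : a + 1 + b = (a + b) + 1 := by ring
  rw [beta, beta, h, Real.Gamma_add_one ha.ne', Real.Gamma_add_one (by positivity)]
  have := (Real.Gamma_pos_of_pos (add_pos ha hb)).ne'
  have := (add_pos ha hb).ne'
  field_simp

lemma beta_symm (a b : ℝ) : beta a b = beta b a := by
  rw [beta, beta, mul_comm, add_comm]

lemma beta_succ_right {a b : ℝ} (ha : 0 < a) (hb : 0 < b) :
    beta a (b + 1) = b / (a + b) * beta a b := by
  rw [beta_symm, beta_succ_left hb ha, beta_symm, add_comm]

/-- The expected value of `φ i`, where `i` is the number of white balls that have been added to an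
urn with initial weights `a` (white) and `b` (black) after `N` draws. -/
def urnMean (a b : ℝ) (N : ℕ) (φ : ℕ → ℝ) : ℝ :=
  ∑ p ∈ Finset.HasAntidiagonal.antidiagonal N,
    (N.choose p.1 : ℝ) * (beta (a + p.1) (b + p.2) / beta a b * φ p.1)

lemma urnMean_zero {a b : ℝ} (ha : 0 < a) (hb : 0 < b) (φ : ℕ → ℝ) : urnMean a b 0 φ = φ 0 := by
  simp [urnMean, (beta_pos ha hb).ne']

/-- Pascal's rule splits the draws according to the last one, and the functional equations of the
beta function supply the probabilities of white and black. This puts the explicit beta-binomial law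
in the same one-step form as the growth of the tree. -/
lemma urnMean_succ {a b : ℝ} (ha : 0 < a) (hb : 0 < b) (N : ℕ) (φ : ℕ → ℝ) :
    urnMean a b (N + 1) φ =
      urnMean a b N fun i => ((a + i) * φ (i + 1) + (b + (N - i)) * φ i) / (a + b + N) := by
  unfold urnMean
  rw [Finset.sum_antidiagonal_choose_succ_mul
    (fun i j => beta (a + i) (b + j) / beta a b * φ i)]
  have h2 : ∑ p ∈ Finset.HasAntidiagonal.antidiagonal N, (N.choose p.2 : ℝ) *
      (beta (a + (p.1 + 1 : ℕ)) (b + p.2) / beta a b * φ (p.1 + 1)) =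
      ∑ p ∈ Finset.HasAntidiagonal.antidiagonal N, (N.choose p.1 : ℝ) *
      (beta (a + (p.1 + 1 : ℕ)) (b + p.2) / beta a b * φ (p.1 + 1)) := by
    refine Finset.sum_congr rfl fun p hp => ?_
    rw [Nat.choose_symm_of_eq_add (Finset.HasAntidiagonal.mem_antidiagonal.1 hp).symm]
  rw [h2, ← Finset.sum_add_distrib]
  refine Finset.sum_congr rfl fun p hp => ?_
  have hN : (N : ℝ) = p.1 + p.2 := by rw [← Finset.HasAntidiagonal.mem_antidiagonal.1 hp]; push_cast; ring
  have ha' : 0 < a + p.1 := by positivity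
  have hb' : 0 < b + p.2 := by positivity
  have h3 : beta (a + p.1) (b + (p.2 + 1 : ℕ)) =
      (b + p.2) / (a + b + N) * beta (a + p.1) (b + p.2) := by
    have : b + ((p.2 + 1 : ℕ) : ℝ) = b + p.2 + 1 := by push_cast; ring
    rw [this, beta_succ_right ha' hb', hN]; congr 2; ring
  have h4 : beta (a + (p.1 + 1 : ℕ)) (b + p.2) =
      (a + p.1) / (a + b + N) * beta (a + p.1) (b + p.2) := by
    have : a + ((p.1 + 1 : ℕ) : ℝ) = a + p.1 + 1 := by push_cast; ring
    rw [this, beta_succ_left ha' hb', hN]; congr 2; ring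
  have h5 : b + (N - p.1) = b + p.2 := by rw [hN]; ring
  simp only [h3, h4, h5]
  ring

end Urn

/-! ### Urn description of a subtree and law of the arrival times -/

section Arrival

variable {V : Type*} {G : SimpleGraph V} [G.LocallyFinite] {δ : ℕ} {s : V}

/-- The relative weight of a boundary edge. -/
def edgeWeight (δ : ℕ) : ℝ := 1 / ((δ : ℝ) - 2)

lemma one_le_deg_sub (hδ : 3 ≤ δ) : (1 : ℝ) ≤ (δ : ℝ) - 2 := by
  have : (3 : ℝ) ≤ δ := by exact_mod_cast hδ
  linarith

lemma edgeWeight_pos (hδ : 3 ≤ δ) : 0 < edgeWeight δ :=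
  one_div_pos.2 (by linarith [one_le_deg_sub hδ])

lemma edgeWeight_le_one (hδ : 3 ≤ δ) : edgeWeight δ ≤ 1 := by
  rw [edgeWeight, div_le_one (by linarith [one_le_deg_sub hδ])]
  exact one_le_deg_sub hδ

lemma cast_deg_sub (hδ : 3 ≤ δ) : ((δ - 2 : ℕ) : ℝ) = (edgeWeight δ)⁻¹ := by
  rw [Nat.cast_sub (by omega), edgeWeight, one_div, inv_inv]; norm_num

lemma bdrySize_eq (hδ : 3 ≤ δ) (n : ℕ) :
    bdrySize δ n = (n + 1 + 2 * edgeWeight δ) / edgeWeight δ := by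
  have := (edgeWeight_pos hδ).ne'
  rw [bdrySize, cast_deg_sub hδ]
  field_simp

/-- The size of the subtree of `w`, given the arrival time at `w` or at its parent, is the number of
white balls in an urn. -/
lemma mean_desc (hG : G.IsTree) (hδ : 3 ≤ δ) (hreg : G.IsRegularOfDegree δ) {v w : V}
    {i₀ : ℕ} (hw : w ≠ s) (h : (w = v ∧ i₀ = 1) ∨ (par G s w = v ∧ i₀ = 0)) (n : ℕ) (ψ : ℕ → ℝ) :
    mean G δ s n (fun S => if v ∈ S then ψ (descCount G s w S) else 0) =
      ∑ k ∈ Finset.range (n + 1), arrival G δ s v k *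
        urnMean (i₀ + edgeWeight δ) (k + 1 - i₀ + edgeWeight δ) (n - k) fun i => ψ (i₀ + i) := by
  have hα := edgeWeight_pos hδ
  have hi₀ : (i₀ : ℝ) ≤ 1 := by rcases h with ⟨-, rfl⟩ | ⟨-, rfl⟩ <;> simp
  have hb : ∀ k : ℕ, 0 < (k : ℝ) + 1 - i₀ + edgeWeight δ := fun k => by
    have : (0 : ℝ) ≤ k := Nat.cast_nonneg k
    linarith
  have ha : 0 < (i₀ : ℝ) + edgeWeight δ := by positivity
  induction n generalizing ψ with
  | zero =>
    rw [mean_desc_zero hG hw h, zero_add, Finset.sum_range_one, Nat.sub_zero,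
      urnMean_zero ha (hb 0), add_zero]
  | succ n ih =>
    rw [mean_desc_succ hG hδ hreg hw h, ih fun y => (((δ - 2 : ℕ) * (y : ℝ) + 1) * ψ (y + 1) +
          ((δ - 2 : ℕ) * (n + 1 - y : ℝ) + 1) * ψ y) / bdrySize δ n,
      Finset.sum_range_succ _ (n + 1), Nat.sub_self, urnMean_zero ha (hb _), add_zero]
    congr 1
    refine Finset.sum_congr rfl fun k hk => ?_
    have hkn : k ≤ n := Nat.lt_succ_iff.1 (Finset.mem_range.1 hk)
    rw [Nat.succ_sub hkn, urnMean_succ ha (hb k)]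
    congr 2
    ext i
    -- The total weight after `n - k` draws is `edgeWeight δ * bdrySize δ n`: in units in which
    -- every infected node adds weight one, a boundary edge counts `edgeWeight δ`.
    have e1 : (i₀ : ℝ) + edgeWeight δ + (k + 1 - i₀ + edgeWeight δ) + (n - k : ℕ) =
        n + 1 + 2 * edgeWeight δ := by rw [Nat.cast_sub hkn]; ring
    have hpos : (0 : ℝ) < n + 1 + 2 * edgeWeight δ := by positivity
    rw [e1, bdrySize_eq hδ, cast_deg_sub hδ, Nat.cast_sub hkn, ← add_assoc i₀ i 1]
    push_cast
    field_simp
    ring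

/-- A boundary node stays one unless it is chosen, and `v` becomes one when its parent, then a
boundary node, is chosen. -/
lemma mean_bdry_succ (hG : G.IsTree) (hδ : 3 ≤ δ) (hreg : G.IsRegularOfDegree δ) {v : V}
    (hv : v ≠ s) (n : ℕ) :
    mean G δ s (n + 1) (fun S => if v ∈ bdry G s S then 1 else 0) =
      mean G δ s n (fun S => if v ∈ bdry G s S then 1 else 0) * (1 - 1 / bdrySize δ n) +
      mean G δ s n (fun S => if par G s v ∈ bdry G s S then 1 else 0) * (1 / bdrySize δ n) := by
  have hb := (bdrySize_pos δ n).ne'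
  rw [mean_succ hG, ← mean_mul_const, ← mean_mul_const, ← mean_add]
  refine mean_congr hG fun S hS hc => ?_
  have hcb := cast_card_bdry hG hδ hreg hS hc
  have hadj := (par_spec hG hv).1
  have h1 : ∀ u ∈ bdry G s S, (if v ∈ bdry G s (insert u S) then (1 : ℝ) else 0) =
      (if v ∈ bdry G s S then 1 - (if v = u then 1 else 0) else 0) +
        if par G s v = u then 1 else 0 := by
    intro u hu
    obtain ⟨huS, hus, hup⟩ := (mem_bdry hG).1 hu
    simp only [mem_bdry hG, Finset.mem_insert, not_or]
    by_cases hpu : par G s v = u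
    · have hvu : v ≠ u := by rintro rfl; exact hadj.ne hpu
      have hvS : v ∉ S := fun hvS => huS (hpu ▸ hS.2 v hvS hv)
      simp [hpu, hvu, hvS, hv, huS]
    · simp only [hpu, hv, ne_eq, not_false_eq_true, true_and, false_or, if_false, add_zero]
      by_cases hvu : v = u
      · simp [hvu]
      · simp [hvu]
  rw [Finset.sum_congr rfl h1, Finset.sum_add_distrib, Finset.sum_ite_eq]
  by_cases hvb : v ∈ bdry G s S
  · simp only [hvb, if_true]
    rw [Finset.sum_sub_distrib, Finset.sum_ite_eq, if_pos hvb, Finset.sum_const, nsmul_eq_mul,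
      mul_one, hcb]
    split_ifs <;> field_simp
  · simp only [hvb, if_false, Finset.sum_const_zero]
    split_ifs <;> ring

lemma zetaSum_zero_right (k : ℕ) (x : ℝ) : zetaSum k 0 x = 1 := by simp [zetaSum]

lemma zetaSum_zero_left (d : ℕ) (x : ℝ) : zetaSum 0 (d + 1) x = 0 := by
  have : (Finset.Icc 1 0).powersetCard (d + 1) = ∅ := Finset.powersetCard_eq_empty.2 (by simp)
  rw [zetaSum, this, Finset.sum_empty]

lemma zetaSum_succ (k d : ℕ) (x : ℝ) :
    zetaSum (k + 1) (d + 1) x = zetaSum k (d + 1) x + zetaSum k d x / ((k + 1 : ℕ) + x) := by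
  have h : Finset.Icc 1 (k + 1) = insert (k + 1) (Finset.Icc 1 k) := by
    ext; simp only [Finset.mem_Icc, Finset.mem_insert]; omega
  have hn : k + 1 ∉ Finset.Icc 1 k := by simp
  rw [zetaSum, h, Finset.powersetCard_succ_insert hn, Finset.sum_union, Finset.sum_image,
    zetaSum, zetaSum, Finset.sum_div]
  · congr 1
    refine Finset.sum_congr rfl fun J hJ => ?_
    have : k + 1 ∉ J := fun hh => hn ((Finset.mem_powersetCard.1 hJ).1 hh)
    rw [Finset.prod_insert this]
    ring
  · intro J hJ J' hJ' he
    have h1 : k + 1 ∉ J := fun hh => hn ((Finset.mem_powersetCard.1 hJ).1 hh)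
    have h2 : k + 1 ∉ J' := fun hh => hn ((Finset.mem_powersetCard.1 hJ').1 hh)
    rw [← Finset.erase_insert h1, he, Finset.erase_insert h2]
  · rw [Finset.disjoint_left]
    intro J hJ hJ'
    obtain ⟨J', -, rfl⟩ := Finset.mem_image.1 hJ'
    exact hn ((Finset.mem_powersetCard.1 hJ).1 (Finset.mem_insert_self _ _))

/-- A boundary node survives a step with probability `(n + 1 + α) / (n + 1 + 2 α)` and is chosen
with probability `α / (n + 1 + 2 α)`, where `α = edgeWeight δ`. After division by the product of the
survival probabilities, `mean_bdry_succ` becomes the recursion `zetaSum_succ`. -/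
lemma mean_bdry (hG : G.IsTree) (hδ : 3 ≤ δ) (hreg : G.IsRegularOfDegree δ) {v : V} {d : ℕ}
    (hv : G.dist s v = d + 1) (n : ℕ) :
    mean G δ s n (fun S => if v ∈ bdry G s S then 1 else 0) =
      (∏ i ∈ Finset.range n, (i + 1 + edgeWeight δ) / (i + 1 + 2 * edgeWeight δ)) *
        (edgeWeight δ ^ d * zetaSum n d (edgeWeight δ)) := by
  have hα := edgeWeight_pos hδ
  induction n generalizing v d with
  | zero =>
    have hvs : v ≠ s := by rintro rfl; simp at hv
    obtain ⟨ha, hd⟩ := par_spec hG hvs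
    rw [mean_zero, Finset.prod_range_zero, one_mul]
    have : v ∈ bdry G s {s} ↔ d = 0 := by
      simp only [mem_bdry hG, Finset.mem_singleton]
      constructor
      · rintro ⟨-, -, hp⟩
        rw [hp, SimpleGraph.dist_self] at hd
        omega
      · rintro rfl
        exact ⟨hvs, hvs, (dist_eq_zero' hG (by omega)).symm⟩
    simp only [this]
    cases d with
    | zero => simp [zetaSum_zero_right]
    | succ d => simp [zetaSum_zero_left]
  | succ n ih =>
    have hvs : v ≠ s := by rintro rfl; simp at hv
    obtain ⟨ha, hd⟩ := par_spec hG hvs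
    have hpos : (0 : ℝ) < n + 1 + 2 * edgeWeight δ := by positivity
    have hpos' : (0 : ℝ) < n + 1 + edgeWeight δ := by positivity
    rw [mean_bdry_succ hG hδ hreg hvs, ih hv, Finset.prod_range_succ, bdrySize_eq hδ]
    cases d with
    | zero =>
      have hps : par G s v = s := (dist_eq_zero' hG (by omega)).symm
      have : mean G δ s n (fun S => if par G s v ∈ bdry G s S then 1 else 0) = 0 := by
        rw [hps]
        have h0 : ∀ S, (if s ∈ bdry G s S then (1 : ℝ) else 0) = 0 := fun S =>
          if_neg fun hh => ((mem_bdry hG).1 hh).2.1 rfl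
        simp [mean, h0]
      rw [this]
      simp only [zetaSum_zero_right]
      field_simp
      ring
    | succ d =>
      rw [ih (by omega : G.dist s (par G s v) = d + 1), zetaSum_succ]
      push_cast
      field_simp
      ring

/-- Index `n + 1` of `arrival` means the infected node number `n + 2`, whence the argument of `p₁`.
The factor `2` in `p₁` cancels against the first factors `α` and `2 α` of the two rising factorials.
-/
lemma arrival_eq (hG : G.IsTree) (hδ : 3 ≤ δ) (hreg : G.IsRegularOfDegree δ) {v : V} {d : ℕ}
    (hv : G.dist s v = d + 1) (n : ℕ) : arrival G δ s v (n + 1) = p₁ δ (d + 1) (n + 2) := by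
  have hα := edgeWeight_pos hδ
  have e1 : ((1 : ℝ) / ((δ : ℝ) - 2)) = edgeWeight δ := rfl
  have e2 : ((2 : ℝ) / ((δ : ℝ) - 2)) = 2 * edgeWeight δ := by rw [edgeWeight]; ring
  have e3 : (2 : ℝ) / ((δ : ℝ) - 2) ^ (d + 1) = 2 * edgeWeight δ ^ (d + 1) := by
    rw [edgeWeight, div_pow, one_pow]; ring
  rw [arrival, mean_bdry hG hδ hreg hv, bdrySize_eq hδ, p₁, e1, e2, e3, Nat.add_sub_cancel,
    Nat.add_sub_cancel, (by omega : n + 2 - 1 = n + 1), risingFactorial, risingFactorial,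
    Finset.prod_range_succ', Finset.prod_range_succ', Finset.prod_range_succ,
    Finset.prod_div_distrib]
  have h1 : ∏ i ∈ Finset.range n, (edgeWeight δ + ((i + 1 : ℕ) : ℝ)) =
      ∏ i ∈ Finset.range n, ((i : ℝ) + 1 + edgeWeight δ) :=
    Finset.prod_congr rfl fun i _ => by push_cast; ring
  have h2 : ∏ i ∈ Finset.range n, (2 * edgeWeight δ + ((i + 1 : ℕ) : ℝ)) =
      ∏ i ∈ Finset.range n, ((i : ℝ) + 1 + 2 * edgeWeight δ) :=
    Finset.prod_congr rfl fun i _ => by push_cast; ring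
  have h3 : ∏ i ∈ Finset.range n, ((i : ℝ) + 1 + 2 * edgeWeight δ) ≠ 0 :=
    (Finset.prod_pos fun i _ => by positivity).ne'
  have hpos : (0 : ℝ) < n + 1 + 2 * edgeWeight δ := by positivity
  have hpos' : (0 : ℝ) < 2 * edgeWeight δ + (n + 1) := by positivity
  rw [h1, h2]
  push_cast
  field_simp
  ring

end Arrival

/-! ### The limit of the urn -/

section UrnLimit

/-- The density of the beta distribution up to normalization. -/
def betaDensity (a b x : ℝ) : ℝ := x ^ (a - 1) * (1 - x) ^ (b - 1)

lemma measurable_betaDensity (a b : ℝ) : Measurable (betaDensity a b) := by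
  unfold betaDensity; fun_prop

lemma betaDensity_nonneg (a b : ℝ) {x : ℝ} (hx : x ∈ Set.Ioo (0 : ℝ) 1) :
    0 ≤ betaDensity a b x :=
  mul_nonneg (Real.rpow_nonneg hx.1.le _) (Real.rpow_nonneg (by linarith [hx.2]) _)

lemma betaDensity_ae_nonneg (a b : ℝ) :
    0 ≤ᵐ[volume.restrict (Set.Ioo (0 : ℝ) 1)] betaDensity a b :=
  ae_restrict_of_forall_mem measurableSet_Ioo fun _ hx => betaDensity_nonneg a b hx

lemma lintegral_betaDensity {a b : ℝ} (ha : 0 < a) (hb : 0 < b) :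
    ∫⁻ x in Set.Ioo (0 : ℝ) 1, ENNReal.ofReal (betaDensity a b x) =
      ENNReal.ofReal (beta a b) := by
  have h := lintegral_betaPDF_eq_one ha hb
  have hB := beta_pos ha hb
  rw [lintegral_betaPDF] at h
  have h1 : ∀ x, ENNReal.ofReal (1 / beta a b * x ^ (a - 1) * (1 - x) ^ (b - 1)) =
      ENNReal.ofReal (1 / beta a b) * ENNReal.ofReal (betaDensity a b x) := by
    intro x
    rw [← ENNReal.ofReal_mul (by positivity), betaDensity, mul_assoc]
  simp_rw [h1] at h
  rw [lintegral_const_mul _ (measurable_betaDensity a b).ennreal_ofReal] at h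
  have h2 := congrArg (ENNReal.ofReal (beta a b) * ·) h
  simp only [← mul_assoc, mul_one] at h2
  rwa [← ENNReal.ofReal_mul hB.le, mul_one_div_cancel hB.ne', ENNReal.ofReal_one, one_mul] at h2

lemma integrableOn_betaDensity {a b : ℝ} (ha : 0 < a) (hb : 0 < b) :
    IntegrableOn (betaDensity a b) (Set.Ioo 0 1) := by
  refine ⟨(measurable_betaDensity a b).aestronglyMeasurable, ?_⟩
  rw [hasFiniteIntegral_iff_ofReal (betaDensity_ae_nonneg a b), lintegral_betaDensity ha hb]
  exact ENNReal.ofReal_lt_top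

lemma integral_betaDensity {a b : ℝ} (ha : 0 < a) (hb : 0 < b) :
    ∫ x in Set.Ioo (0 : ℝ) 1, betaDensity a b x = beta a b := by
  rw [integral_eq_lintegral_of_nonneg_ae (betaDensity_ae_nonneg a b)
    (measurable_betaDensity a b).aestronglyMeasurable, lintegral_betaDensity ha hb,
    ENNReal.toReal_ofReal (beta_pos ha hb).le]

/-- The expected value of `φ` under the binomial distribution. -/
def binomMean (N : ℕ) (φ : ℕ → ℝ) (x : ℝ) : ℝ :=
  ∑ i ∈ Finset.range (N + 1), (N.choose i : ℝ) * x ^ i * (1 - x) ^ (N - i) * φ i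

lemma measurable_binomMean (N : ℕ) (φ : ℕ → ℝ) : Measurable (binomMean N φ) := by
  unfold binomMean; fun_prop

lemma binomMean_one (N : ℕ) (x : ℝ) : binomMean N (fun _ => 1) x = 1 := by
  have h := congrArg (Polynomial.eval x) (bernsteinPolynomial.sum ℝ N)
  rw [Polynomial.eval_finsetSum, Polynomial.eval_one] at h
  refine Eq.trans ?_ h
  rw [binomMean]
  refine Finset.sum_congr rfl fun i _ => ?_
  simp [bernsteinPolynomial]

lemma binomMean_sq (N : ℕ) (x : ℝ) :
    binomMean N (fun i => ((i : ℝ) - N * x) ^ 2) x = N * x * (1 - x) := by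
  have h := congrArg (Polynomial.eval x) (bernsteinPolynomial.variance ℝ N)
  rw [Polynomial.eval_finsetSum] at h
  simp only [nsmul_eq_mul, Polynomial.eval_mul, Polynomial.eval_pow, Polynomial.eval_sub,
    Polynomial.eval_X, Polynomial.eval_natCast, Polynomial.eval_one] at h
  refine Eq.trans ?_ h
  rw [binomMean]
  refine Finset.sum_congr rfl fun i _ => ?_
  simp [bernsteinPolynomial]
  ring

lemma binomMean_mono {N : ℕ} {φ ψ : ℕ → ℝ} {x : ℝ} (hx : x ∈ Set.Icc (0 : ℝ) 1)
    (h : ∀ i, φ i ≤ ψ i) : binomMean N φ x ≤ binomMean N ψ x := by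
  refine Finset.sum_le_sum fun i _ => mul_le_mul_of_nonneg_left (h i) ?_
  have := hx.1
  have : 0 ≤ 1 - x := by linarith [hx.2]
  positivity

lemma binomMean_mul_left (N : ℕ) (c : ℝ) (φ : ℕ → ℝ) (x : ℝ) :
    binomMean N (fun i => c * φ i) x = c * binomMean N φ x := by
  rw [binomMean, binomMean, Finset.mul_sum]
  exact Finset.sum_congr rfl fun i _ => by ring

lemma binomMean_sub (N : ℕ) (φ ψ : ℕ → ℝ) (x : ℝ) :
    binomMean N (fun i => φ i - ψ i) x = binomMean N φ x - binomMean N ψ x := by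
  simp only [binomMean, mul_sub, Finset.sum_sub_distrib]

lemma binomMean_mem_Icc {N : ℕ} {φ : ℕ → ℝ} (h : ∀ i, φ i ∈ Set.Icc (0 : ℝ) 1) {x : ℝ}
    (hx : x ∈ Set.Icc (0 : ℝ) 1) : binomMean N φ x ∈ Set.Icc (0 : ℝ) 1 := by
  constructor
  · have := binomMean_mono (N := N) hx (fun i => (h i).1)
    simpa [binomMean] using this
  · rw [← binomMean_one N x]
    exact binomMean_mono hx fun i => (h i).2

/-- De Finetti's theorem for the urn: the draws are a mixture of independent coin tosses whose bias
has a beta law, because `x ^ i * (1 - x) ^ j` merely shifts the parameters of the beta density. -/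
lemma urnMean_eq_integral {a b : ℝ} (ha : 0 < a) (hb : 0 < b) (N : ℕ) (φ : ℕ → ℝ) :
    urnMean a b N φ =
      (∫ x in Set.Ioo (0 : ℝ) 1, binomMean N φ x * betaDensity a b x) / beta a b := by
  have h1 : ∀ x ∈ Set.Ioo (0 : ℝ) 1, binomMean N φ x * betaDensity a b x =
      ∑ p ∈ Finset.HasAntidiagonal.antidiagonal N,
        (N.choose p.1 : ℝ) * φ p.1 * betaDensity (a + p.1) (b + p.2) x := by
    intro x hx
    rw [binomMean, ← Finset.Nat.sum_antidiagonal_eq_sum_range_succ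
      (fun i j => (N.choose i : ℝ) * x ^ i * (1 - x) ^ j * φ i), Finset.sum_mul]
    refine Finset.sum_congr rfl fun p _ => ?_
    have e1 : x ^ (a + p.1 - 1) = x ^ (a - 1) * x ^ p.1 := by
      rw [← Real.rpow_add_natCast hx.1.ne']; congr 1; ring
    have e2 : (1 - x) ^ (b + p.2 - 1) = (1 - x) ^ (b - 1) * (1 - x) ^ p.2 := by
      rw [← Real.rpow_add_natCast (by linarith [hx.2])]; congr 1; ring
    rw [betaDensity, betaDensity, e1, e2]
    ring
  have hpos : ∀ p : ℕ × ℕ, 0 < a + p.1 ∧ 0 < b + p.2 := fun p => ⟨by positivity, by positivity⟩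
  rw [setIntegral_congr_fun measurableSet_Ioo h1, integral_finsetSum]
  · rw [urnMean, Finset.sum_div]
    refine Finset.sum_congr rfl fun p _ => ?_
    rw [integral_const_mul, integral_betaDensity (hpos p).1 (hpos p).2]
    ring
  · exact fun p _ => (integrableOn_betaDensity (hpos p).1 (hpos p).2).const_mul _

/-- Chebyshev's inequality with the variance of the binomial law. The slack `K` leaves the values
near a tie free, so strict and weak majorities and bounded shifts are treated alike. -/
lemma tendsto_binomMean {φ : ℕ → ℕ → ℝ} (h01 : ∀ N i, φ N i ∈ Set.Icc (0 : ℝ) 1) {K : ℝ}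
    (h1 : ∀ N i : ℕ, (N : ℝ) + K < 2 * i → φ N i = 1) (h0 : ∀ N i : ℕ, 2 * (i : ℝ) < N - K → φ N i = 0)
    {x : ℝ} (hx : x ∈ Set.Ioo (0 : ℝ) 1) (hx2 : x ≠ 1 / 2) :
    Tendsto (fun N => binomMean N (φ N) x) atTop (𝓝 (if 1 / 2 < x then 1 else 0)) := by
  set l : ℝ := if 1 / 2 < x then 1 else 0 with hl
  set η := |x - 1 / 2| with hη
  have hη0 : 0 < η := abs_pos.2 (sub_ne_zero.2 hx2)
  have hxI : x ∈ Set.Icc (0 : ℝ) 1 := ⟨hx.1.le, hx.2.le⟩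
  -- For `φ N i` to differ from its limit, `i` has to be at distance at least `N η - K / 2 ≥ N η /
  -- 2` from `N x`; hence the constant `4 / (N η) ^ 2`.
  have key : ∀ N : ℕ, 1 ≤ N → K ≤ N * η → ∀ i,
      |φ N i - l| ≤ 4 / (N * η) ^ 2 * ((i : ℝ) - N * x) ^ 2 := by
    intro N hN hK i
    have hN0 : (0 : ℝ) < N := by exact_mod_cast hN
    by_cases he : φ N i = l
    · rw [he, sub_self, abs_zero]; positivity
    have hle : |φ N i - l| ≤ 1 := by
      have := (h01 N i).1
      have := (h01 N i).2
      rw [abs_le, hl]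
      split_ifs <;> constructor <;> linarith
    refine hle.trans ?_
    have hsq : (N * η / 2) ^ 2 ≤ ((i : ℝ) - N * x) ^ 2 := by
      rw [sq_le_sq, abs_of_nonneg (by positivity : (0 : ℝ) ≤ N * η / 2)]
      by_cases hx3 : 1 / 2 < x
      · have hle2 : 2 * (i : ℝ) ≤ N + K := by
          by_contra hcon
          refine he ?_
          rw [h1 N i (not_le.1 hcon), hl, if_pos hx3]
        have : η = x - 1 / 2 := abs_of_pos (by linarith)
        rw [abs_sub_comm]
        refine le_trans ?_ (le_abs_self _)
        rw [this] at hK ⊢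
        linarith
      · have hle2 : (N : ℝ) - K ≤ 2 * i := by
          by_contra hcon
          refine he ?_
          rw [h0 N i (not_le.1 hcon), hl, if_neg hx3]
        have : η = 1 / 2 - x := by rw [hη, abs_sub_comm]; exact abs_of_nonneg (by linarith)
        refine le_trans ?_ (le_abs_self _)
        rw [this] at hK ⊢
        linarith
    have hpos : (0 : ℝ) < (N * η) ^ 2 := by positivity
    rw [div_mul_eq_mul_div, le_div_iff₀ hpos]
    nlinarith
  have hbound : ∀ N : ℕ, 1 ≤ N → K ≤ N * η → |binomMean N (φ N) x - l| ≤ 4 / η ^ 2 / N := by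
    intro N hN hK
    have hN0 : (0 : ℝ) < N := by exact_mod_cast hN
    have e1 : binomMean N (φ N) x - l = binomMean N (fun i => φ N i - l * 1) x := by
      rw [binomMean_sub, binomMean_mul_left, binomMean_one, mul_one]
    have e2 : binomMean N (fun i => 4 / (N * η) ^ 2 * ((i : ℝ) - N * x) ^ 2) x ≤ 4 / η ^ 2 / N := by
      rw [binomMean_mul_left, binomMean_sq]
      have : 4 / (N * η) ^ 2 * (N * x * (1 - x)) = 4 / η ^ 2 / N * (x * (1 - x)) := by
        field_simp
      rw [this]
      have hx1 : x * (1 - x) ≤ 1 := by nlinarith [hx.1, hx.2]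
      exact mul_le_of_le_one_right (by positivity) hx1
    rw [e1, abs_le]
    constructor
    · refine le_trans (neg_le_neg e2) ?_
      have := binomMean_mono (N := N) hxI
        (φ := fun i => -1 * (4 / (N * η) ^ 2 * ((i : ℝ) - N * x) ^ 2))
        (ψ := fun i => φ N i - l * 1) fun i => by
          have := (abs_le.1 (key N hN hK i)).1; linarith
      rw [binomMean_mul_left] at this
      linarith
    · refine le_trans (binomMean_mono hxI fun i => ?_) e2
      have := (abs_le.1 (key N hN hK i)).2; linarith
  rw [tendsto_iff_norm_sub_tendsto_zero]
  refine squeeze_zero' (Eventually.of_forall fun _ => norm_nonneg _) ?_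
    (tendsto_const_div_atTop_nhds_zero_nat (4 / η ^ 2))
  obtain ⟨N₀, hN₀⟩ := exists_nat_ge (K / η)
  filter_upwards [eventually_ge_atTop (max 1 N₀)] with N hN
  refine hbound N (le_of_max_le_left hN) ?_
  rw [← div_le_iff₀ hη0]
  exact hN₀.trans (by exact_mod_cast le_of_max_le_right hN)

/-- The reflection of the interval moves the upper half to the lower half and exchanges the
parameters. -/
lemma setIntegral_upper_half {a b : ℝ} (ha : 0 < a) (hb : 0 < b) :
    (∫ x in Set.Ioo (0 : ℝ) 1, (if 1 / 2 < x then 1 else 0) * betaDensity a b x) / beta a b =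
      regIncBeta (1 / 2) b a := by
  have h1 : ∀ x : ℝ, (if 1 / 2 < x then (1 : ℝ) else 0) * betaDensity a b x =
      (Set.Ioi (1 / 2 : ℝ)).indicator (betaDensity a b) x := by
    intro x
    rw [Set.indicator_apply]
    simp only [Set.mem_Ioi]
    split_ifs <;> simp
  simp_rw [h1]
  have h2 : Set.Ioi (1 / 2 : ℝ) ∩ Set.Ioo 0 1 = Set.Ioo (1 / 2) 1 := by
    ext x; simp only [Set.mem_inter_iff, Set.mem_Ioi, Set.mem_Ioo]
    constructor
    · rintro ⟨h, -, h'⟩; exact ⟨h, h'⟩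
    · rintro ⟨h, h'⟩; exact ⟨h, by linarith, h'⟩
  rw [integral_indicator measurableSet_Ioi, Measure.restrict_restrict measurableSet_Ioi, h2,
    ← integral_Ioc_eq_integral_Ioo, ← intervalIntegral.integral_of_le (by norm_num)]
  have h3 := intervalIntegral.integral_comp_sub_left (a := 0) (b := 1 / 2) (betaDensity a b) 1
  rw [sub_zero, (by norm_num : (1 : ℝ) - 1 / 2 = 1 / 2)] at h3
  have h4 : (∫ x in (1 / 2 : ℝ)..1, betaDensity a b x) =
      ∫ t in (0 : ℝ)..1 / 2, t ^ (b - 1) * (1 - t) ^ (a - 1) := by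
    rw [← h3]
    refine intervalIntegral.integral_congr fun t _ => ?_
    simp only [betaDensity]
    rw [sub_sub_cancel]
    ring
  have hg := (Real.Gamma_pos_of_pos ha).ne'
  have hg' := (Real.Gamma_pos_of_pos hb).ne'
  have hg2 := (Real.Gamma_pos_of_pos (add_pos ha hb)).ne'
  rw [h4, regIncBeta, beta, add_comm b a]
  field_simp

lemma urnMean_nonneg {a b : ℝ} (ha : 0 < a) (hb : 0 < b) (N : ℕ) {φ : ℕ → ℝ}
    (h : ∀ i, 0 ≤ φ i) : 0 ≤ urnMean a b N φ :=
  Finset.sum_nonneg fun p _ => mul_nonneg (Nat.cast_nonneg _) (mul_nonneg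
    (div_nonneg (beta_pos (by positivity) (by positivity)).le (beta_pos ha hb).le) (h _))

lemma urnMean_const {a b : ℝ} (ha : 0 < a) (hb : 0 < b) (N : ℕ) :
    urnMean a b N (fun _ => 1) = 1 := by
  rw [urnMean_eq_integral ha hb]
  simp_rw [binomMean_one, one_mul]
  rw [integral_betaDensity ha hb, div_self (beta_pos ha hb).ne']

lemma urnMean_le_one {a b : ℝ} (ha : 0 < a) (hb : 0 < b) (N : ℕ) {φ : ℕ → ℝ}
    (h : ∀ i, φ i ≤ 1) : urnMean a b N φ ≤ 1 := by
  rw [← urnMean_const ha hb N]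
  exact Finset.sum_le_sum fun p _ => mul_le_mul_of_nonneg_left
    (mul_le_mul_of_nonneg_left (h _) (div_nonneg (beta_pos (by positivity) (by positivity)).le
      (beta_pos ha hb).le)) (Nat.cast_nonneg _)

/-- The limit of the probability that the white balls have the majority. -/
lemma tendsto_urnMean {a b : ℝ} (ha : 0 < a) (hb : 0 < b) {φ : ℕ → ℕ → ℝ}
    (h01 : ∀ N i, φ N i ∈ Set.Icc (0 : ℝ) 1) {K : ℝ}
    (h1 : ∀ N i : ℕ, (N : ℝ) + K < 2 * i → φ N i = 1) (h0 : ∀ N i : ℕ, 2 * (i : ℝ) < N - K → φ N i = 0) :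
    Tendsto (fun N => urnMean a b N (φ N)) atTop (𝓝 (regIncBeta (1 / 2) b a)) := by
  simp_rw [urnMean_eq_integral ha hb, ← setIntegral_upper_half ha hb]
  refine Tendsto.div_const ?_ _
  refine tendsto_integral_of_dominated_convergence (betaDensity a b)
    (fun N => ((measurable_binomMean N _).mul (measurable_betaDensity a b)).aestronglyMeasurable)
    (integrableOn_betaDensity ha hb) (fun N => ?_) ?_
  · refine ae_restrict_of_forall_mem measurableSet_Ioo fun x hx => ?_
    have h2 := binomMean_mem_Icc (N := N) (h01 N) (x := x) ⟨hx.1.le, hx.2.le⟩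
    have h3 := betaDensity_nonneg a b hx
    rw [Real.norm_of_nonneg (mul_nonneg h2.1 h3)]
    exact mul_le_of_le_one_left h3 h2.2
  -- The balanced point, where nothing is known about convergence, is a null set.
  · have hne : ∀ᵐ x : ℝ ∂(volume.restrict (Set.Ioo 0 1)), x ≠ 1 / 2 :=
      ae_restrict_of_ae (Measure.ae_ne volume (1 / 2))
    filter_upwards [hne, ae_restrict_mem measurableSet_Ioo] with x hx hxI
    exact (tendsto_binomMean h01 h1 h0 hxI hx).mul_const _

end UrnLimit

/-! ### The estimate and the majority -/

section Levels

variable {V : Type*} {G : SimpleGraph V} {δ : ℕ} {s : V}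

lemma dist_of_mem_desc (hG : G.IsTree) {w x : V} (hw : w ≠ s) (hx : x ∈ desc G s w) :
    G.dist s x = G.dist s w + G.dist w x := by
  obtain ⟨ha, hd⟩ := par_spec hG hw
  rw [dist_cross hG ha (root_notMem_desc hG hw) hx, hd]

lemma exists_mem_desc (hG : G.IsTree) {d : ℕ} {x : V} (hx : d + 1 ≤ G.dist s x) :
    ∃ w, G.dist s w = d + 1 ∧ x ∈ desc G s w := by
  obtain ⟨n, hn⟩ : ∃ n, G.dist s x = d + 1 + n := ⟨G.dist s x - (d + 1), by omega⟩
  clear hx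
  have hxs : ∀ {x : V} {m : ℕ}, G.dist s x = d + 1 + m → x ≠ s := by
    intro x m h hx
    rw [hx, SimpleGraph.dist_self] at h
    omega
  induction n generalizing x with
  | zero => exact ⟨x, hn, mem_desc_self hG (hxs hn)⟩
  | succ n ih =>
    have hd := (par_spec hG (hxs hn)).2
    obtain ⟨w, hw, hmem⟩ := ih (x := par G s x) (by omega)
    exact ⟨w, hw, (mem_desc_iff hG (hxs (m := 0) hw) (hxs hn)).2 (Or.inr hmem)⟩

lemma desc_disjoint (hG : G.IsTree) {d : ℕ} {w w' : V} (hw : G.dist s w = d + 1)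
    (hw' : G.dist s w' = d + 1) (hne : w ≠ w') : Disjoint (desc G s w) (desc G s w') := by
  have hxs : ∀ {x : V} {m : ℕ}, G.dist s x = d + 1 + m → x ≠ s := by
    intro x m h hx
    rw [hx, SimpleGraph.dist_self] at h
    omega
  have hws := hxs (m := 0) hw
  have hws' := hxs (m := 0) hw'
  have key : ∀ n x, G.dist s x = d + 1 + n → x ∈ desc G s w → x ∉ desc G s w' := by
    intro n
    induction n with
    | zero =>
      intro x hx h1 h2
      have e1 := dist_of_mem_desc hG hws h1
      have e2 := dist_of_mem_desc hG hws' h2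
      exact hne ((dist_eq_zero' hG (by omega)).trans
        (dist_eq_zero' hG (by omega : G.dist w' x = 0)).symm)
    | succ n ih =>
      intro x hx h1 h2
      have hp := (par_spec hG (hxs hx)).2
      have e1 := dist_of_mem_desc hG hws h1
      have e2 := dist_of_mem_desc hG hws' h2
      have hx1 : x ≠ w := by rintro rfl; omega
      have hx2 : x ≠ w' := by rintro rfl; omega
      exact ih (par G s x) (by omega)
        (((mem_desc_iff hG hws (hxs hx)).1 h1).resolve_left hx1)
        (((mem_desc_iff hG hws' (hxs hx)).1 h2).resolve_left hx2)
  refine Set.disjoint_left.2 fun x h1 h2 => ?_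
  have e1 := dist_of_mem_desc hG hws h1
  exact key (G.dist w x) x (by omega) h1 h2

variable [G.LocallyFinite]

/-- The nodes at a given distance from the root. -/
def level (G : SimpleGraph V) [G.LocallyFinite] (s : V) : ℕ → Finset V
  | 0 => {s}
  | n + 1 => (level G s n).biUnion (children G s)

lemma mem_level (hG : G.IsTree) {n : ℕ} {v : V} : v ∈ level G s n ↔ G.dist s v = n := by
  induction n generalizing v with
  | zero =>
    rw [level, Finset.mem_singleton]
    exact ⟨fun h => by simp [h], fun h => (dist_eq_zero' hG h).symm⟩
  | succ n ih =>
    simp only [level, Finset.mem_biUnion, mem_children hG, ih]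
    constructor
    · rintro ⟨a, ha, hv, rfl⟩
      rw [← (par_spec hG hv).2, ha]
    · intro h
      have hv : v ≠ s := by rintro rfl; simp at h
      exact ⟨_, by have := (par_spec hG hv).2; omega, hv, rfl⟩

lemma card_level (hG : G.IsTree) (hreg : G.IsRegularOfDegree δ) (n : ℕ) :
    (level G s (n + 1)).card = δ * (δ - 1) ^ n := by
  induction n with
  | zero =>
    rw [level, level, Finset.singleton_biUnion, card_children_root hreg, pow_zero, mul_one]
  | succ n ih =>
    rw [level, card_biUnion_children hG, Finset.sum_congr rfl fun v hv => card_children hG hreg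
      (by rintro rfl; rw [mem_level hG] at hv; simp at hv : v ≠ s), Finset.sum_const, ih, pow_succ,
      smul_eq_mul, mul_assoc]

end Levels

/-! ### Bounds for the law of the estimate by probabilities of a majority -/

section Estimate

variable {V Ω : Type*} {G : SimpleGraph V} [MeasurableSpace Ω] [Countable V]
  {δ : ℕ} {P : Measure Ω} {τ : G.Dart → Ω → ℝ} {s : V}

lemma IsMLEstimate.measurableSet_mem {n : ℕ} {Vh : Ω → V} (h : IsMLEstimate P τ s n Vh)
    (D : Set V) : MeasurableSet {ω | Vh ω ∈ D} := by
  have : {ω | Vh ω ∈ D} = ⋃ v ∈ D, {ω | Vh ω = v} := by ext; simp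
  rw [this]
  exact MeasurableSet.biUnion (Set.to_countable D) fun v _ => h.measurableSet_eq v

variable [G.LocallyFinite] [IsProbabilityMeasure P]

/-- A lower bound for the probability that the estimate is in `D`. -/
lemma ExpSpread.mean_le_estimate (M : ExpSpread G δ P τ) {N : ℕ} {Vh : Ω → V}
    (h : IsMLEstimate P τ s (N + 1) Vh) {D : Set V} {Q : Finset V → Prop}
    [DecidablePred Q]
    (hQ : ∀ S, S.card = N + 1 → hist G s N S ≠ 0 → Q S → ∀ x ∈ mlNodes P τ S, x ∈ D) :
    mean G δ s N (fun S => if Q S then 1 else 0) ≤ P.real {ω | Vh ω ∈ D} := by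
  -- Sets without a history are discarded: they have weight zero, and `hQ` does not cover them.
  set I := ((stageSets G s N).filter fun S => hist G s N S ≠ 0 ∧ Q S) with hI
  set A : (_ : Finset V) × V → Set Ω := fun p => {ω | infectedNetwork τ s (N + 1) ω = p.1 ∧ Vh ω = p.2}
    with hA
  have hS : ∀ S ∈ I, S.card = N + 1 ∧ hist G s N S ≠ 0 ∧ Q S := fun S hS =>
    ⟨((mem_stageSets M.tree).1 (Finset.mem_filter.1 hS).1).2, (Finset.mem_filter.1 hS).2⟩
  have hd : Set.Pairwise (↑(I.sigma fun S => mlNodes P τ S)) (Function.onFun (AEDisjoint P) A) := by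
    rintro ⟨S, v⟩ _ ⟨S', v'⟩ _ hne
    refine Disjoint.aedisjoint (Set.disjoint_left.2 ?_)
    rintro ω ⟨h1, h2⟩ ⟨h3, h4⟩
    simp only at h1 h2 h3 h4
    rw [h1] at h3
    rw [h2] at h4
    subst h3 h4
    exact hne rfl
  have hm : ∀ p ∈ I.sigma fun S => mlNodes P τ S, NullMeasurableSet (A p) P := by
    rintro ⟨S, v⟩ hp
    obtain ⟨h1, -, -⟩ := hS S (Finset.mem_sigma.1 hp).1
    have h2 := M.nullMeasurableSet_network s (S := S) (Finset.card_pos.1 (by omega))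
    rw [h1] at h2
    exact h2.inter (h.measurableSet_eq v).nullMeasurableSet
  have hsub : (⋃ p ∈ I.sigma fun S => mlNodes P τ S, A p) ⊆ {ω | Vh ω ∈ D} := by
    refine Set.iUnion₂_subset ?_
    rintro ⟨S, v⟩ hp ω ⟨-, hω⟩
    obtain ⟨hp1, hp2⟩ := Finset.mem_sigma.1 hp
    obtain ⟨h1, h2, h3⟩ := hS S hp1
    simp only at hω
    change Vh ω ∈ D
    rw [hω]
    exact hQ S h1 h2 h3 v hp2
  refine le_trans (le_of_eq ?_) (measureReal_mono hsub)
  rw [measureReal_biUnion_finset₀ hd hm, Finset.sum_sigma]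
  have e1 : mean G δ s N (fun S => if Q S then 1 else 0) =
      ∑ S ∈ I, (hist G s N S : ℝ) / totalHist δ N := by
    rw [hI, Finset.sum_filter, mean]
    refine Finset.sum_congr rfl fun S _ => ?_
    by_cases h0 : hist G s N S = 0
    · simp [h0]
    · by_cases hq : Q S <;> simp [h0, hq]
  rw [e1]
  refine Finset.sum_congr rfl fun S hSI => ?_
  obtain ⟨h1, h2, h3⟩ := hS S hSI
  have hne := mlNodes_nonempty (P := P) (τ := τ) (S := S) (Finset.card_pos.1 (by omega))
  have e2 : ∀ v ∈ mlNodes P τ S, P.real (A ⟨S, v⟩) =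
      hist G s N S / totalHist δ N * (1 / ((mlNodes P τ S).card : ℝ)) := by
    intro v hv
    have := h.law S v
    rw [if_pos hv] at this
    rw [← M.measureReal_network s h1, h1]
    exact this
  have hc : ((mlNodes P τ S).card : ℝ) ≠ 0 := by exact_mod_cast (Finset.card_pos.2 hne).ne'
  rw [Finset.sum_congr rfl e2, Finset.sum_const, nsmul_eq_mul]
  field_simp

lemma ExpSpread.estimate_desc_ge (M : ExpSpread G δ P τ) {N : ℕ} {Vh : Ω → V}
    (h : IsMLEstimate P τ s (N + 1) Vh) {w : V} (hw : w ≠ s) :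
    mean G δ s N (fun S => if N + 1 < 2 * descCount G s w S then 1 else 0) ≤
      P.real {ω | Vh ω ∈ desc G s w} :=
  M.mean_le_estimate h fun _ h1 h2 h3 => M.mlNodes_subset_desc hw h1 h2 h3

/-- The lower bound `mean_le_estimate` is applied to the complement: if strictly less than half of
the nodes are below `w`, the estimate is not below `w`. -/
lemma ExpSpread.estimate_desc_le (M : ExpSpread G δ P τ) {N : ℕ} {Vh : Ω → V}
    (h : IsMLEstimate P τ s (N + 1) Vh) {w : V} (hw : w ≠ s) :
    P.real {ω | Vh ω ∈ desc G s w} ≤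
      mean G δ s N (fun S => if N + 1 ≤ 2 * descCount G s w S then 1 else 0) := by
  have h1 := M.mean_le_estimate h (D := (desc G s w)ᶜ)
    (Q := fun S => 2 * descCount G s w S < N + 1)
    fun _ h1 h2 h3 => M.mlNodes_disjoint_desc hw h1 h2 h3
  have h2 : {ω | Vh ω ∈ (desc G s w)ᶜ} = {ω | Vh ω ∈ desc G s w}ᶜ := rfl
  rw [h2, probReal_compl_eq_one_sub (h.measurableSet_mem _)] at h1
  have h3 : mean G δ s N (fun S => if N + 1 ≤ 2 * descCount G s w S then 1 else 0) +
      mean G δ s N (fun S => if 2 * descCount G s w S < N + 1 then 1 else 0) = 1 := by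
    rw [← mean_add]
    refine (mean_congr M.tree fun S _ _ => ?_).trans (mean_const M.tree M.deg M.reg (s := s) N 1)
    split_ifs <;> first | omega | norm_num
  linarith

/-- The distance of the estimate from the source in terms of the subtrees. -/
lemma ExpSpread.estimate_dist (M : ExpSpread G δ P τ) {n : ℕ} {Vh : Ω → V}
    (h : IsMLEstimate P τ s n Vh) (d : ℕ) :
    P.real {ω | G.dist (Vh ω) s ≤ d} =
      1 - ∑ w ∈ level G s (d + 1), P.real {ω | Vh ω ∈ desc G s w} := by
  have hns : ∀ w ∈ level G s (d + 1), w ≠ s := by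
    rintro w hw rfl
    rw [mem_level M.tree] at hw
    simp at hw
  have h1 : {ω | G.dist (Vh ω) s ≤ d} =
      (⋃ w ∈ level G s (d + 1), {ω | Vh ω ∈ desc G s w})ᶜ := by
    ext ω
    simp only [Set.mem_ofPred_eq, Set.mem_compl_iff, Set.mem_iUnion, not_exists]
    rw [dist_comm_tree]
    constructor
    · intro hle w hw hmem
      have := dist_of_mem_desc M.tree (hns w hw) hmem
      rw [mem_level M.tree] at hw
      omega
    · intro hall
      by_contra hcon
      obtain ⟨w, hw, hmem⟩ := exists_mem_desc M.tree (s := s) (d := d) (x := Vh ω) (by omega)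
      exact hall w ((mem_level M.tree).2 hw) hmem
  rw [h1, probReal_compl_eq_one_sub
    (Finset.measurableSet_biUnion _ fun w _ => h.measurableSet_mem _),
    measureReal_biUnion_finset _ fun w _ => h.measurableSet_mem _]
  intro w hw w' hw' hne
  have := desc_disjoint M.tree ((mem_level M.tree).1 hw) ((mem_level M.tree).1 hw') hne
  exact Set.disjoint_left.2 fun ω h1 h2 => Set.disjoint_left.1 this h1 h2

end Estimate

/-! ### The limiting probability of a majority below a node -/

section Majority

variable {V : Type*} {G : SimpleGraph V} [G.LocallyFinite] {δ : ℕ} {s : V}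

lemma arrival_nonneg (v : V) (k : ℕ) : 0 ≤ arrival G δ s v k := by
  cases k with
  | zero => rw [arrival]; split_ifs <;> norm_num
  | succ k =>
    refine div_nonneg (Finset.sum_nonneg fun S _ => mul_nonneg
      (div_nonneg (Nat.cast_nonneg _) (totalHist_pos δ k).le) ?_) (bdrySize_pos δ k).le
    dsimp only
    split_ifs <;> norm_num

/-- The value is a limit of probabilities, namely of a white majority in the urn. -/
lemma regIncBeta_half_mem_Icc {a b : ℝ} (ha : 0 < a) (hb : 0 < b) :
    regIncBeta (1 / 2) b a ∈ Set.Icc (0 : ℝ) 1 := by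
  have h01 : ∀ N i : ℕ, (if N < 2 * i then (1 : ℝ) else 0) ∈ Set.Icc (0 : ℝ) 1 := by
    intro N i; split_ifs <;> simp
  have := tendsto_urnMean ha hb (φ := fun N i => if N < 2 * i then 1 else 0) (K := 0) h01
    (fun N i h => if_pos (by rw [add_zero] at h; exact_mod_cast h))
    (fun N i h => if_neg (by rw [sub_zero] at h; have : 2 * i < N := by exact_mod_cast h
                             omega))
  exact isClosed_Icc.mem_of_tendsto this (Eventually.of_forall fun N =>
    ⟨urnMean_nonneg ha hb N fun i => (h01 N i).1, urnMean_le_one ha hb N fun i => (h01 N i).2⟩)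

lemma shape_pos (hδ : 3 ≤ δ) {i₀ : ℕ} (hi₀ : i₀ ≤ 1) (k : ℕ) :
    0 < (i₀ : ℝ) + edgeWeight δ ∧ 0 < (k : ℝ) + 1 - i₀ + edgeWeight δ := by
  have hα := edgeWeight_pos hδ
  have h1 : (i₀ : ℝ) ≤ 1 := by exact_mod_cast hi₀
  have h2 : (0 : ℝ) ≤ k := Nat.cast_nonneg k
  exact ⟨by positivity, by linarith⟩

/-- By `mean_desc` with the constant function, the partial sums are the probabilities that `v` is
among the first nodes to be infected. -/
lemma summable_arrival (hG : G.IsTree) (hδ : 3 ≤ δ) (hreg : G.IsRegularOfDegree δ) {v w : V}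
    {i₀ : ℕ} (hw : w ≠ s) (h : (w = v ∧ i₀ = 1) ∨ (par G s w = v ∧ i₀ = 0)) :
    Summable (arrival G δ s v) := by
  have hi₀ : i₀ ≤ 1 := by rcases h with ⟨-, rfl⟩ | ⟨-, rfl⟩ <;> simp
  refine summable_of_sum_range_le (c := 1) (arrival_nonneg v) fun n => ?_
  cases n with
  | zero => simp
  | succ n =>
    have h1 := mean_desc hG hδ hreg hw h n fun _ => 1
    simp only [urnMean_const (shape_pos hδ hi₀ 0).1 (shape_pos hδ hi₀ _).2, mul_one] at h1
    rw [← h1]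
    refine (mean_mono hG fun S _ _ => ?_).trans_eq (mean_const hG hδ hreg (s := s) n 1)
    split_ifs <;> norm_num

/-- The limit of the probability that the majority of the infected nodes is below `w`. -/
lemma tendsto_majority (hG : G.IsTree) (hδ : 3 ≤ δ) (hreg : G.IsRegularOfDegree δ) {v w : V}
    {i₀ : ℕ} (hw : w ≠ s) (h : (w = v ∧ i₀ = 1) ∨ (par G s w = v ∧ i₀ = 0)) {ψ : ℕ → ℕ → ℝ}
    (h01 : ∀ N y, ψ N y ∈ Set.Icc (0 : ℝ) 1) (h1 : ∀ N y, N + 1 < 2 * y → ψ N y = 1)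
    (h0 : ∀ N y, 2 * y < N + 1 → ψ N y = 0) :
    Tendsto (fun N => mean G δ s N fun S => ψ N (descCount G s w S)) atTop
      (𝓝 (∑' k, arrival G δ s v k *
        regIncBeta (1 / 2) (k + 1 - i₀ + edgeWeight δ) (i₀ + edgeWeight δ))) := by
  have hi₀ : i₀ ≤ 1 := by rcases h with ⟨-, rfl⟩ | ⟨-, rfl⟩ <;> simp
  have ha := (shape_pos hδ hi₀ 0).1
  have hb : ∀ k : ℕ, _ := fun k => (shape_pos (δ := δ) hδ hi₀ k).2
  set u : ℕ → ℕ → ℝ := fun N k => if k ≤ N then arrival G δ s v k *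
    urnMean (i₀ + edgeWeight δ) (k + 1 - i₀ + edgeWeight δ) (N - k) (fun i => ψ N (i₀ + i)) else 0
    with hu
  have e1 : ∀ N, mean G δ s N (fun S => ψ N (descCount G s w S)) = ∑' k, u N k := by
    intro N
    -- If `v` is not infected, nothing below `w` is, and `ψ` vanishes there by `h0`; so restricting
    -- to sets that contain `v` costs nothing.
    have e2 : mean G δ s N (fun S => ψ N (descCount G s w S)) =
        mean G δ s N (fun S => if v ∈ S then ψ N (descCount G s w S) else 0) := by
      refine mean_congr hG fun S hS _ => ?_
      split_ifs with hv
      · rfl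
      · have hwS : w ∉ S := by
          rcases h with ⟨rfl, -⟩ | ⟨rfl, -⟩
          · exact hv
          · exact fun hh => hv (hS.2 w hh hw)
        rw [descCount_eq_zero hG hw hS hwS]
        exact h0 N 0 (by omega)
    rw [e2, mean_desc hG hδ hreg hw h, tsum_eq_sum (s := Finset.range (N + 1))]
    · refine Finset.sum_congr rfl fun k hk => ?_
      rw [hu]
      simp only
      rw [if_pos (Nat.lt_succ_iff.1 (Finset.mem_range.1 hk))]
    · intro k hk
      rw [hu]
      simp only
      rw [if_neg fun hh => hk (Finset.mem_range.2 (Nat.lt_succ_iff.2 hh))]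
  simp_rw [e1]
  refine tendsto_tsum_of_dominated_convergence (bound := arrival G δ s v)
    (summable_arrival hG hδ hreg hw h) (fun k => ?_) (Eventually.of_forall fun N k => ?_)
  -- The slack `k + 3` absorbs the nodes infected before the urn starts and the initial count `i₀ ≤
  -- 1`.
  · have h2 := tendsto_urnMean ha (hb k) (φ := fun M i => ψ (k + M) (i₀ + i)) (K := k + 3)
      (fun M i => h01 _ _)
      (fun M i hlt => h1 _ _ (by
        have : M + (k + 3) < 2 * i := by exact_mod_cast hlt
        omega))
      (fun M i hlt => h0 _ _ (by
        have : 2 * i + (k + 3) < M := by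
          have : 2 * (i : ℝ) + (k + 3) < M := by linarith
          exact_mod_cast this
        omega))
    have h3 := (h2.comp (tendsto_sub_atTop_nat k)).const_mul (arrival G δ s v k)
    refine h3.congr' ?_
    filter_upwards [eventually_ge_atTop k] with N hN
    simp only [Function.comp, hu]
    rw [if_pos hN, Nat.add_sub_cancel' hN]
  · rw [hu]
    simp only
    split_ifs
    · have h2 := urnMean_nonneg ha (hb k) (N - k) (φ := fun i => ψ N (i₀ + i))
        fun i => (h01 _ _).1
      have h3 := urnMean_le_one ha (hb k) (N - k) (φ := fun i => ψ N (i₀ + i))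
        fun i => (h01 _ _).2
      rw [Real.norm_of_nonneg (mul_nonneg (arrival_nonneg v k) h2)]
      exact mul_le_of_le_one_right (arrival_nonneg v k) h3
    · rw [norm_zero]; exact arrival_nonneg v k

end Majority

section EstimateLimit

variable {V Ω : Type*} {G : SimpleGraph V} [G.LocallyFinite] [MeasurableSpace Ω] [Countable V]
  {δ : ℕ} {P : Measure Ω} [IsProbabilityMeasure P] {τ : G.Dart → Ω → ℝ} {s : V}

/-- The probability is squeezed between those of a strict and of a weak majority, which have the
same limit because `tendsto_majority` does not prescribe the value at a tie. -/
lemma ExpSpread.tendsto_estimate_desc (M : ExpSpread G δ P τ) {Vh : ℕ → Ω → V}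
    (hVh : ∀ n, 1 ≤ n → IsMLEstimate P τ s n (Vh n)) {v w : V}
    {i₀ : ℕ} (hw : w ≠ s) (h : (w = v ∧ i₀ = 1) ∨ (par G s w = v ∧ i₀ = 0)) :
    Tendsto (fun n => P.real {ω | Vh n ω ∈ desc G s w}) atTop
      (𝓝 (∑' k, arrival G δ s v k *
        regIncBeta (1 / 2) (k + 1 - i₀ + edgeWeight δ) (i₀ + edgeWeight δ))) := by
  rw [← tendsto_add_atTop_iff_nat 1]
  refine tendsto_of_tendsto_of_tendsto_of_le_of_le
    (tendsto_majority M.tree M.deg M.reg hw h (ψ := fun N y => if N + 1 < 2 * y then 1 else 0)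
      ?_ ?_ ?_)
    (tendsto_majority M.tree M.deg M.reg hw h (ψ := fun N y => if N + 1 ≤ 2 * y then 1 else 0)
      ?_ ?_ ?_)
    (fun N => M.estimate_desc_ge (hVh (N + 1) (by omega)) hw)
    (fun N => M.estimate_desc_le (hVh (N + 1) (by omega)) hw)
  · intro N y; split_ifs <;> simp
  · intro N y hy; exact if_pos hy
  · intro N y hy; exact if_neg (by omega)
  · intro N y; split_ifs <;> simp
  · intro N y hy; exact if_pos (by omega)
  · intro N y hy; exact if_neg (by omega)

end EstimateLimit

/-! ### The limiting distribution of the distance -/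

/-- The full beta integral is cut at the midpoint; the upper piece is `setIntegral_upper_half`. -/
lemma regIncBeta_half_add {a b : ℝ} (ha : 0 < a) (hb : 0 < b) :
    regIncBeta (1 / 2) a b + regIncBeta (1 / 2) b a = 1 := by
  have hi := integrableOn_betaDensity ha hb
  have e0 : Set.Ioo (0 : ℝ) 1 = Set.Ioc 0 (1 / 2) ∪ Set.Ioo (1 / 2) 1 :=
    (Set.Ioc_union_Ioo_eq_Ioo (by norm_num) (by norm_num)).symm
  have hdisj : Disjoint (Set.Ioc (0 : ℝ) (1 / 2)) (Set.Ioo (1 / 2) 1) :=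
    Set.disjoint_left.2 fun x h1 h2 => absurd h1.2 (not_le.2 h2.1)
  have h1 : ∫ x in Set.Ioo (0 : ℝ) 1, betaDensity a b x =
      (∫ x in Set.Ioc (0 : ℝ) (1 / 2), betaDensity a b x) +
        ∫ x in Set.Ioo (1 / 2 : ℝ) 1, betaDensity a b x := by
    rw [e0, setIntegral_union hdisj measurableSet_Ioo (hi.mono_set (by rw [e0]; simp))
      (hi.mono_set (by rw [e0]; simp))]
  have h2 : ∫ x in Set.Ioo (0 : ℝ) 1, (if 1 / 2 < x then 1 else 0) * betaDensity a b x =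
      ∫ x in Set.Ioo (1 / 2 : ℝ) 1, betaDensity a b x := by
    have : ∀ x : ℝ, (if 1 / 2 < x then (1 : ℝ) else 0) * betaDensity a b x =
        (Set.Ioi (1 / 2 : ℝ)).indicator (betaDensity a b) x := by
      intro x
      by_cases hx : 1 / 2 < x
      · rw [if_pos hx, one_mul, Set.indicator_of_mem (Set.mem_Ioi.2 hx)]
      · rw [if_neg hx, zero_mul, Set.indicator_of_notMem (by simpa using hx)]
    simp_rw [this]
    rw [setIntegral_indicator measurableSet_Ioi]
    congr 2
    ext x
    simp only [Set.mem_inter_iff, Set.mem_Ioo, Set.mem_Ioi]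
    constructor
    · rintro ⟨⟨-, h⟩, h'⟩; exact ⟨h', h⟩
    · rintro ⟨h, h'⟩; exact ⟨⟨by linarith, h'⟩, h⟩
  have hβ := beta_pos ha hb
  have h3 : regIncBeta (1 / 2) a b =
      (∫ x in Set.Ioc (0 : ℝ) (1 / 2), betaDensity a b x) / beta a b := by
    rw [regIncBeta, intervalIntegral.integral_of_le (by norm_num), beta]
    have h4 := Real.Gamma_pos_of_pos ha
    have h5 := Real.Gamma_pos_of_pos hb
    have h6 := Real.Gamma_pos_of_pos (add_pos ha hb)
    simp only [betaDensity]
    field_simp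
  rw [integral_betaDensity ha hb] at h1
  rw [h3, ← setIntegral_upper_half ha hb, h2, ← add_div, ← h1, div_self hβ.ne']

/-- Read off from the tree: `p₁` is the arrival law of any node at the corresponding distance. -/
lemma summable_p₁ {V : Type*} {G : SimpleGraph V} [G.LocallyFinite] {δ : ℕ} {s : V}
    (hG : G.IsTree) (hδ : 3 ≤ δ) (hreg : G.IsRegularOfDegree δ) (d : ℕ) :
    Summable fun n => p₁ δ (d + 1) (n + 2) := by
  obtain ⟨w, hw⟩ : (level G s (d + 1)).Nonempty := by
    rw [← Finset.card_pos, card_level hG hreg]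
    exact Nat.mul_pos (by omega) (pow_pos (by omega) _)
  rw [mem_level hG] at hw
  have hws : w ≠ s := by rintro rfl; simp at hw
  have h := summable_arrival hG hδ hreg (v := w) hws (Or.inl ⟨rfl, rfl⟩)
  rw [← summable_nat_add_iff 1] at h
  exact h.congr fun n => arrival_eq hG hδ hreg hw n

lemma summable_p₁_mul {V : Type*} {G : SimpleGraph V} [G.LocallyFinite] {δ : ℕ}
    (hG : G.IsTree) (hδ : 3 ≤ δ) (hreg : G.IsRegularOfDegree δ) (s : V) (d : ℕ)
    {c : ℕ → ℝ} (hc : ∀ n, c n ∈ Set.Icc (0 : ℝ) 1) :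
    Summable fun n => p₁ δ (d + 1) (n + 2) * c n := by
  have h := summable_p₁ (s := s) hG hδ hreg d
  refine Summable.of_norm_bounded h.norm fun n => ?_
  rw [norm_mul]
  refine mul_le_of_le_one_right (norm_nonneg _) ?_
  rw [Real.norm_of_nonneg (hc n).1]
  exact (hc n).2

lemma tsum_arrival_mul {V : Type*} {G : SimpleGraph V} [G.LocallyFinite] {δ : ℕ} {s v : V}
    (hG : G.IsTree) (hδ : 3 ≤ δ) (hreg : G.IsRegularOfDegree δ) {d : ℕ} (hv : G.dist s v = d + 1)
    {c : ℕ → ℝ} (hc : ∀ n, c n ∈ Set.Icc (0 : ℝ) 1) :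
    ∑' k, arrival G δ s v k * c k = ∑' n, p₁ δ (d + 1) (n + 2) * c (n + 1) := by
  have hvs : v ≠ s := by rintro rfl; simp at hv
  have h : Summable fun n => arrival G δ s v (n + 1) * c (n + 1) :=
    (summable_p₁_mul hG hδ hreg s d fun n => hc (n + 1)).congr fun n => by
      rw [arrival_eq hG hδ hreg hv]
  rw [tsum_eq_zero_add' h]
  simp only [arrival_eq hG hδ hreg hv]
  rw [arrival, if_neg hvs, zero_mul, zero_add]

lemma one_add_edgeWeight {δ : ℕ} (hδ : 3 ≤ δ) :
    ((δ : ℝ) - 1) / ((δ : ℝ) - 2) = 1 + edgeWeight δ := by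
  have h := one_le_deg_sub hδ
  rw [edgeWeight]
  field_simp
  ring

lemma p₂_eq {δ : ℕ} (hδ : 3 ≤ δ) (n : ℕ) :
    p₂ δ (n + 2) = regIncBeta (1 / 2) (n + 1 + edgeWeight δ) (1 + edgeWeight δ) -
      ((δ : ℝ) - 1) * regIncBeta (1 / 2) (n + 2 + edgeWeight δ) (edgeWeight δ) := by
  rw [p₂, one_add_edgeWeight hδ, ← edgeWeight]
  push_cast
  congr 2
  · ring
  · congr 1; ring

section Limit

variable {V Ω : Type*} {G : SimpleGraph V} [G.LocallyFinite] [MeasurableSpace Ω] [Countable V]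
  {δ : ℕ} {P : Measure Ω} [IsProbabilityMeasure P] {τ : G.Dart → Ω → ℝ} {s : V}

/-- The limit in terms of the arrival time at the root of the subtree. -/
lemma ExpSpread.tendsto_estimate_desc_of_arrival (M : ExpSpread G δ P τ) {Vh : ℕ → Ω → V}
    (hVh : ∀ n, 1 ≤ n → IsMLEstimate P τ s n (Vh n)) {d : ℕ} {w : V}
    (hw : G.dist s w = d + 1) :
    Tendsto (fun n => P.real {ω | Vh n ω ∈ desc G s w}) atTop
      (𝓝 (∑' n : ℕ, p₁ δ (d + 1) (n + 2) *
        regIncBeta (1 / 2) (n + 1 + edgeWeight δ) (1 + edgeWeight δ))) := by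
  have hws : w ≠ s := by rintro rfl; simp at hw
  have h := M.tendsto_estimate_desc hVh (v := w) hws (Or.inl ⟨rfl, rfl⟩)
  rw [tsum_arrival_mul M.tree M.deg M.reg hw fun k => regIncBeta_half_mem_Icc
    (shape_pos M.deg le_rfl k).1 (shape_pos M.deg le_rfl k).2] at h
  push_cast at h
  simpa only [add_sub_cancel_right] using h

/-- The parent of `w` is the source, whose arrival time is deterministic, so the series reduces to
its first term. -/
lemma ExpSpread.tendsto_estimate_desc_zero (M : ExpSpread G δ P τ) {Vh : ℕ → Ω → V}
    (hVh : ∀ n, 1 ≤ n → IsMLEstimate P τ s n (Vh n)) {w : V} (hw : G.dist s w = 1) :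
    Tendsto (fun n => P.real {ω | Vh n ω ∈ desc G s w}) atTop
      (𝓝 (regIncBeta (1 / 2) (1 + edgeWeight δ) (edgeWeight δ))) := by
  have hws : w ≠ s := by rintro rfl; simp at hw
  have hps : par G s w = s := by
    have := (par_spec M.tree hws).2
    exact (dist_eq_zero' M.tree (by omega)).symm
  have h := M.tendsto_estimate_desc hVh (v := s) hws (Or.inr ⟨hps, rfl⟩)
  convert h using 2
  rw [tsum_eq_single 0]
  · simp [arrival]
  · intro k hk
    obtain ⟨n, rfl⟩ := Nat.exists_eq_succ_of_ne_zero hk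
    have h0 : ∀ S, (if s ∈ bdry G s S then (1 : ℝ) else 0) = 0 := fun S =>
      if_neg fun hh => ((mem_bdry M.tree).1 hh).2.1 rfl
    simp [arrival, mean, h0]

/-- The limit in terms of the arrival time at the parent of the root of the subtree. -/
lemma ExpSpread.tendsto_estimate_desc_of_arrival_par (M : ExpSpread G δ P τ) {Vh : ℕ → Ω → V}
    (hVh : ∀ n, 1 ≤ n → IsMLEstimate P τ s n (Vh n)) {d : ℕ} {w : V}
    (hw : G.dist s w = d + 2) :
    Tendsto (fun n => P.real {ω | Vh n ω ∈ desc G s w}) atTop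
      (𝓝 (∑' n : ℕ, p₁ δ (d + 1) (n + 2) *
        regIncBeta (1 / 2) (n + 2 + edgeWeight δ) (edgeWeight δ))) := by
  have hws : w ≠ s := by rintro rfl; simp at hw
  have hd : G.dist s (par G s w) = d + 1 := by
    have := (par_spec M.tree hws).2
    omega
  have hps : par G s w ≠ s := by intro h; rw [h] at hd; simp at hd
  have h := M.tendsto_estimate_desc hVh (v := par G s w) hws (Or.inr ⟨rfl, rfl⟩)
  rw [tsum_arrival_mul M.tree M.deg M.reg hd fun k => regIncBeta_half_mem_Icc
    (shape_pos M.deg zero_le_one k).1 (shape_pos M.deg zero_le_one k).2] at h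
  push_cast at h
  simpa only [sub_zero, zero_add, add_assoc, one_add_one_eq_two] using h

lemma ExpSpread.tendsto_dist (M : ExpSpread G δ P τ) {Vh : ℕ → Ω → V}
    (hVh : ∀ n, 1 ≤ n → IsMLEstimate P τ s n (Vh n)) {d : ℕ} {q : ℝ}
    (h : ∀ w, G.dist s w = d + 1 → Tendsto (fun n => P.real {ω | Vh n ω ∈ desc G s w}) atTop (𝓝 q)) :
    Tendsto (fun n => P.real {ω | G.dist (Vh n ω) s ≤ d}) atTop
      (𝓝 (1 - δ * ((δ : ℝ) - 1) ^ d * q)) := by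
  have h1 : Tendsto (fun n => 1 - ∑ w ∈ level G s (d + 1), P.real {ω | Vh n ω ∈ desc G s w}) atTop
      (𝓝 (1 - ∑ w ∈ level G s (d + 1), q)) :=
    tendsto_const_nhds.sub (tendsto_finsetSum _ fun w hw => h w ((mem_level M.tree).1 hw))
  have h2 : (1 : ℝ) - ∑ w ∈ level G s (d + 1), q = 1 - δ * ((δ : ℝ) - 1) ^ d * q := by
    have := M.deg
    rw [Finset.sum_const, card_level M.tree M.reg, nsmul_eq_mul]
    push_cast [Nat.cast_sub (by omega : 1 ≤ δ)]
    rfl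
  rw [← h2]
  refine h1.congr' ?_
  filter_upwards [eventually_ge_atTop 1] with n hn
  rw [M.estimate_dist (hVh n hn)]

/-- The limiting distribution function of the distance of the estimate from the source. -/
theorem ExpSpread.tendsto_dist_le (M : ExpSpread G δ P τ) {Vh : ℕ → Ω → V}
    (hVh : ∀ n, 1 ≤ n → IsMLEstimate P τ s n (Vh n)) (d : ℕ) :
    Tendsto (fun n => P.real {ω | G.dist (Vh n ω) s ≤ d}) atTop
      (𝓝 (correctLimit δ + ∑ l ∈ Finset.range d,
        δ * ((δ : ℝ) - 1) ^ l * ∑' n : ℕ, p₁ δ (l + 1) (n + 2) * p₂ δ (n + 2))) := by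
  have hα := edgeWeight_pos M.deg
  induction d with
  | zero =>
    convert M.tendsto_dist hVh (d := 0) fun w hw => M.tendsto_estimate_desc_zero hVh hw using 2
    -- By this symmetry `1 - δ * I(1 + α, α)` becomes `correctLimit δ`, which is written with the
    -- parameters exchanged.
    have h := regIncBeta_half_add hα (add_pos one_pos hα)
    rw [correctLimit, one_add_edgeWeight M.deg, ← edgeWeight, eq_sub_of_add_eq h]
    simp
    ring
  | succ d ih =>
    obtain ⟨w, hw⟩ : (level G s (d + 1)).Nonempty := by
      have := M.deg
      rw [← Finset.card_pos, card_level M.tree M.reg]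
      exact Nat.mul_pos (by omega) (pow_pos (by omega) _)
    -- The limit for `d` is rewritten through the arrival of the nodes at distance `d + 1`; the
    -- limit for `d + 1` below uses the arrival of the parents, which have the same distance. Both
    -- series thus carry the weights `p₁ δ (d + 1)`, and their difference is the series with `p₂`.
    have h1 := tendsto_nhds_unique ih
      (M.tendsto_dist hVh fun w hw => M.tendsto_estimate_desc_of_arrival hVh hw)
    convert M.tendsto_dist hVh (d := d + 1)
      fun w hw => M.tendsto_estimate_desc_of_arrival_par hVh hw using 2
    rw [Finset.sum_range_succ, ← add_assoc, h1]
    have h2 : ∑' n : ℕ, p₁ δ (d + 1) (n + 2) * p₂ δ (n + 2) =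
        (∑' n : ℕ, p₁ δ (d + 1) (n + 2) *
          regIncBeta (1 / 2) (n + 1 + edgeWeight δ) (1 + edgeWeight δ)) - ((δ : ℝ) - 1) *
        ∑' n : ℕ, p₁ δ (d + 1) (n + 2) *
          regIncBeta (1 / 2) (n + 2 + edgeWeight δ) (edgeWeight δ) := by
      rw [← tsum_mul_left, ← Summable.tsum_sub]
      · refine tsum_congr fun n => ?_
        rw [p₂_eq M.deg]
        ring
      · exact summable_p₁_mul M.tree M.deg M.reg s d fun n =>
          regIncBeta_half_mem_Icc (by positivity) (by positivity)
      · exact (summable_p₁_mul M.tree M.deg M.reg s d fun n =>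
          regIncBeta_half_mem_Icc (by positivity) (by positivity)).mul_left _
    rw [h2]
    ring

end Limit

/-! ### The tail of the series -/

section SecondFactor

variable {δ : ℕ}

lemma continuousOn_rpow_mul_rpow {p q : ℝ} (hp : 0 ≤ p) :
    ContinuousOn (fun t : ℝ => t ^ p * (1 - t) ^ q) (Set.uIcc 0 (1 / 2)) := by
  refine (Real.continuous_rpow_const hp).continuousOn.mul
    ((continuous_const.sub continuous_id).continuousOn.rpow_const fun t ht => Or.inl ?_)
  rw [Set.uIcc_of_le (by norm_num)] at ht
  have := ht.2
  change 1 - t ≠ 0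
  linarith

/-- The integrand is the derivative of `t ^ a * (1 - t) ^ α`, which vanishes at zero. -/
lemma integral_by_parts_half {a α : ℝ} (ha : 1 ≤ a) :
    a * (∫ t in (0 : ℝ)..1 / 2, t ^ (a - 1) * (1 - t) ^ α) -
      α * (∫ t in (0 : ℝ)..1 / 2, t ^ a * (1 - t) ^ (α - 1)) = (1 / 2) ^ (a + α) := by
  have h1 := (continuousOn_rpow_mul_rpow (p := a - 1) (q := α) (by linarith)).intervalIntegrable
    (μ := volume)
  have h2 := (continuousOn_rpow_mul_rpow (p := a) (q := α - 1) (by linarith)).intervalIntegrable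
    (μ := volume)
  have h3 := intervalIntegral.integral_eq_sub_of_hasDerivAt (a := 0) (b := 1 / 2)
    (f := fun t : ℝ => t ^ a * (1 - t) ^ α)
    (f' := fun t => a * (t ^ (a - 1) * (1 - t) ^ α) - α * (t ^ a * (1 - t) ^ (α - 1)))
    (fun t ht => by
      rw [Set.uIcc_of_le (by norm_num)] at ht
      have h5 := (Real.hasDerivAt_rpow_const (x := t) (p := a) (Or.inr ha)).mul
        (((hasDerivAt_id t).const_sub 1).rpow_const (p := α)
          (Or.inl (by have := ht.2; simp only [id]; linarith)))
      refine h5.congr_deriv ?_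
      simp only [id]
      ring) ((h1.const_mul a).sub (h2.const_mul α))
  rw [intervalIntegral.integral_sub (h1.const_mul a) (h2.const_mul α),
    intervalIntegral.integral_const_mul, intervalIntegral.integral_const_mul] at h3
  rw [h3, Real.zero_rpow (by linarith), zero_mul, sub_zero, Real.rpow_add (by norm_num)]
  norm_num

/-- Since `δ - 1 = (1 + α) / α`, the two terms of `p₂` have a common Gamma factor. Integration by
parts then removes the first integral and leaves a difference whose sign can be seen. -/
lemma p₂_eq_integral (hδ : 3 ≤ δ) (n : ℕ) :
    p₂ δ (n + 2) = Real.Gamma (n + 2 + 2 * edgeWeight δ) /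
      (Real.Gamma (n + 2 + edgeWeight δ) * Real.Gamma (1 + edgeWeight δ)) *
      ((1 / 2) ^ ((n : ℝ) + 1 + 2 * edgeWeight δ) -
        ∫ t in (0 : ℝ)..1 / 2, t ^ ((n : ℝ) + 1 + edgeWeight δ) * (1 - t) ^ (edgeWeight δ - 1)) := by
  have hα := edgeWeight_pos hδ
  have hn : (0 : ℝ) ≤ n := Nat.cast_nonneg n
  have hc : (δ : ℝ) - 1 = (1 + edgeWeight δ) / edgeWeight δ := by
    rw [eq_div_iff hα.ne', ← one_add_edgeWeight hδ, edgeWeight]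
    ring
  rw [p₂_eq hδ, regIncBeta, regIncBeta, hc]
  generalize edgeWeight δ = α at *
  have h := integral_by_parts_half (a := n + 1 + α) (α := α) (by linarith)
  have e1 : (n : ℝ) + 2 + α = (n + 1 + α) + 1 := by ring
  have e2 : (n : ℝ) + 1 + α + (1 + α) = n + 2 + 2 * α := by ring
  have e3 : (n : ℝ) + 1 + α + 1 + α = n + 2 + 2 * α := by ring
  have e4 : (n : ℝ) + 1 + 2 * α = n + 1 + α + α := by ring
  have g1 : Real.Gamma (n + 1 + α + 1) = (n + 1 + α) * Real.Gamma (n + 1 + α) :=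
    Real.Gamma_add_one (by positivity)
  have g2 : Real.Gamma (1 + α) = α * Real.Gamma α := by
    rw [add_comm, Real.Gamma_add_one hα.ne']
  have p1 : Real.Gamma α ≠ 0 := (Real.Gamma_pos_of_pos hα).ne'
  have p2 : Real.Gamma (n + 1 + α) ≠ 0 := (Real.Gamma_pos_of_pos (by positivity)).ne'
  have p3 : (n : ℝ) + 1 + α ≠ 0 := by positivity
  rw [e1, e2, e3, e4, ← h, g1, g2, add_sub_cancel_left, add_sub_cancel_right]
  field_simp
  ring

/-- On the interval both factors are largest at `1/2`, the second one because its exponent is not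
positive; the length of the interval supplies the last factor `1/2`. -/
lemma integral_half_mem_Icc {a α : ℝ} (ha : 0 ≤ a) (hα : α ≤ 1) :
    ∫ t in (0 : ℝ)..1 / 2, t ^ a * (1 - t) ^ (α - 1) ∈ Set.Icc (0 : ℝ) ((1 / 2) ^ (a + α)) := by
  constructor
  · refine intervalIntegral.integral_nonneg (by norm_num) fun t ht => ?_
    exact mul_nonneg (Real.rpow_nonneg ht.1 _) (Real.rpow_nonneg (by linarith [ht.2]) _)
  · have h1 : ∫ t in (0 : ℝ)..1 / 2, t ^ a * (1 - t) ^ (α - 1) ≤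
        ∫ t in (0 : ℝ)..1 / 2, (1 / 2 : ℝ) ^ (a + α - 1) := by
      refine intervalIntegral.integral_mono_on (by norm_num)
        (continuousOn_rpow_mul_rpow ha).intervalIntegrable intervalIntegrable_const fun t ht => ?_
      rw [add_sub_assoc, Real.rpow_add (by norm_num)]
      refine mul_le_mul (Real.rpow_le_rpow ht.1 ht.2 ha) ?_
        (Real.rpow_nonneg (by linarith [ht.2]) _) (by positivity)
      exact Real.rpow_le_rpow_of_nonpos (by norm_num) (by linarith [ht.2]) (by linarith)
    refine h1.trans ?_
    rw [intervalIntegral.integral_const, Real.rpow_sub_one (by norm_num), smul_eq_mul]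
    exact le_of_eq (by ring)

/-- In `p₂_eq_integral` the difference is between zero and `(1 / 2) ^ (n + 1)`. The Gamma factor is
at most `2 * (n + 3)`, by monotonicity of Gamma from `2` on; this also gives `Γ(1 + α) ≥ 1/2`. -/
lemma p₂_mem_Icc (hδ : 3 ≤ δ) (n : ℕ) :
    p₂ δ (n + 2) ∈ Set.Icc (0 : ℝ) ((n + 3) * (1 / 2) ^ n) := by
  have hα := edgeWeight_pos hδ
  have hα1 := edgeWeight_le_one hδ
  have hn : (0 : ℝ) ≤ n := Nat.cast_nonneg n
  rw [p₂_eq_integral hδ]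
  generalize edgeWeight δ = α at *
  have h := integral_half_mem_Icc (a := n + 1 + α) (α := α) (by positivity) hα1
  have e4 : (n : ℝ) + 1 + 2 * α = n + 1 + α + α := by ring
  rw [← e4] at h
  have p1 : 0 < Real.Gamma (1 + α) := Real.Gamma_pos_of_pos (by positivity)
  have p2 : 0 < Real.Gamma (n + 2 + α) := Real.Gamma_pos_of_pos (by positivity)
  have p3 : 0 < Real.Gamma (n + 2 + 2 * α) := Real.Gamma_pos_of_pos (by positivity)
  have hmono := Real.Gamma_strictMonoOn_Ici.monotoneOn
  have q1 : Real.Gamma (n + 2 + 2 * α) ≤ (n + 2 + α) * Real.Gamma (n + 2 + α) := by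
    rw [← Real.Gamma_add_one (by positivity)]
    exact hmono (Set.mem_Ici.2 (by linarith)) (Set.mem_Ici.2 (by linarith)) (by linarith)
  have q2 : 1 ≤ (1 + α) * Real.Gamma (1 + α) := by
    rw [← Real.Gamma_add_one (by positivity)]
    refine Real.Gamma_two.symm.trans_le ?_
    exact hmono (Set.mem_Ici.2 (by linarith)) (Set.mem_Ici.2 (by linarith)) (by linarith)
  have q3 : Real.Gamma (n + 2 + 2 * α) / (Real.Gamma (n + 2 + α) * Real.Gamma (1 + α)) ≤
      2 * (n + 3) := by
    rw [div_le_iff₀ (by positivity)]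
    have : (1 : ℝ) ≤ 2 * Real.Gamma (1 + α) := by nlinarith
    calc _ ≤ (n + 2 + α) * Real.Gamma (n + 2 + α) := q1
      _ ≤ (n + 3) * Real.Gamma (n + 2 + α) * 1 := by
        rw [mul_one]; exact mul_le_mul_of_nonneg_right (by linarith) p2.le
      _ ≤ (n + 3) * Real.Gamma (n + 2 + α) * (2 * Real.Gamma (1 + α)) :=
        mul_le_mul_of_nonneg_left this (by positivity)
      _ = _ := by ring
  have q4 : (1 / 2 : ℝ) ^ ((n : ℝ) + 1 + 2 * α) ≤ (1 / 2) ^ n * (1 / 2) := by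
    rw [← pow_succ, ← Real.rpow_natCast]
    refine Real.rpow_le_rpow_of_exponent_ge (by norm_num) (by norm_num) ?_
    push_cast
    linarith
  constructor
  · exact mul_nonneg (by positivity) (sub_nonneg.2 h.2)
  · calc _ ≤ 2 * ((n : ℝ) + 3) * ((1 / 2) ^ n * (1 / 2)) :=
        mul_le_mul q3 (by linarith [h.1]) (sub_nonneg.2 h.2) (by positivity)
      _ = _ := by ring

end SecondFactor

/-! ### Truncation error of the series -/

section Tail

variable {V : Type*} {G : SimpleGraph V} [G.LocallyFinite] {δ : ℕ}

/-- This is the probability that the infected node number `n + 2` has distance `l + 1` from the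
source: the share of the boundary that lies on that level, averaged. -/
lemma level_mul_p₁_mem_Icc (hG : G.IsTree) (hδ : 3 ≤ δ) (hreg : G.IsRegularOfDegree δ) (s : V)
    (l n : ℕ) : δ * ((δ : ℝ) - 1) ^ l * p₁ δ (l + 1) (n + 2) ∈ Set.Icc (0 : ℝ) 1 := by
  have h1 : δ * ((δ : ℝ) - 1) ^ l * p₁ δ (l + 1) (n + 2) =
      ∑ v ∈ level G s (l + 1), arrival G δ s v (n + 1) := by
    rw [Finset.sum_congr rfl fun v hv => arrival_eq hG hδ hreg ((mem_level hG).1 hv) n,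
      Finset.sum_const, card_level hG hreg, nsmul_eq_mul]
    push_cast [Nat.cast_sub (by omega : 1 ≤ δ)]
    rfl
  rw [h1]
  refine ⟨Finset.sum_nonneg fun v _ => arrival_nonneg v _, ?_⟩
  simp only [arrival]
  rw [← Finset.sum_div, ← mean_sum, div_le_one (bdrySize_pos δ n)]
  refine (mean_mono hG fun S h2 h3 => ?_).trans_eq (mean_const hG hδ hreg (s := s) n _)
  rw [← cast_card_bdry hG hδ hreg h2 h3, Finset.sum_boole]
  exact_mod_cast Finset.card_le_card fun v hv => (Finset.mem_filter.1 hv).2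

/-- There are too few indices for the sum `ζ`; a node cannot be infected before all nodes on the way
to it. This is why the sum in `g` may start at `d + 1`. -/
lemma p₁_eq_zero {l n : ℕ} (h : n < l) : p₁ δ (l + 1) (n + 2) = 0 := by
  rw [p₁, Nat.add_sub_cancel, Nat.add_sub_cancel, zetaSum, Finset.powersetCard_eq_empty.2,
    Finset.sum_empty, mul_zero]
  simpa using h

lemma hasSum_tail (m : ℕ) :
    HasSum (fun n : ℕ => ((n + m : ℕ) + 3 : ℝ) * (1 / 2) ^ (n + m)) ((2 * m + 8) * (1 / 2) ^ m) := by
  have h1 := hasSum_coe_mul_geometric_of_norm_lt_one (𝕜 := ℝ) (r := 1 / 2) (by norm_num)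
  have h2 := (hasSum_geometric_of_lt_one (r := (1 / 2 : ℝ)) (by norm_num) (by norm_num)).mul_left
    ((m : ℝ) + 3)
  have h3 := (h1.add h2).mul_left ((1 / 2 : ℝ) ^ m)
  have e : (1 / 2 : ℝ) ^ m * (1 / 2 / (1 - 1 / 2) ^ 2 + (m + 3) * (1 - 1 / 2)⁻¹) =
      (2 * m + 8) * (1 / 2) ^ m := by norm_num; ring
  rw [e] at h3
  have e' : (fun n : ℕ => ((n + m : ℕ) + 3 : ℝ) * (1 / 2) ^ (n + m)) =
      fun n : ℕ => (1 / 2 : ℝ) ^ m * (n * (1 / 2) ^ n + (m + 3) * (1 / 2) ^ n) := by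
    ext n
    push_cast
    rw [pow_add]
    ring
  rw [e']
  exact h3

/-- The remainder of the series for the probability of distance `l + 1`. -/
lemma remainder_mem_Icc (hG : G.IsTree) (hδ : 3 ≤ δ) (hreg : G.IsRegularOfDegree δ) (s : V)
    {l m : ℕ} (hm : l + 2 ≤ m) :
    δ * ((δ : ℝ) - 1) ^ l * (∑' n : ℕ, p₁ δ (l + 1) (n + 2) * p₂ δ (n + 2)) - g δ (l + 1) m ∈
      Set.Icc (0 : ℝ) (ε m) := by
  -- With `k = n + 2`, truncation at `k ≤ m + 1` means `n < m`.
  obtain ⟨m, rfl⟩ := Nat.exists_eq_add_of_le' (by omega : 1 ≤ m)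
  set c : ℕ → ℝ := fun n => δ * ((δ : ℝ) - 1) ^ l * p₁ δ (l + 1) (n + 2) * p₂ δ (n + 2) with hc
  have h1 : ∀ n, 0 ≤ c n := fun n =>
    mul_nonneg (level_mul_p₁_mem_Icc hG hδ hreg s l n).1 (p₂_mem_Icc hδ n).1
  have h2 : ∀ n, c n ≤ (n + 3) * (1 / 2) ^ n := fun n =>
    (mul_le_of_le_one_left (p₂_mem_Icc hδ n).1 (level_mul_p₁_mem_Icc hG hδ hreg s l n).2).trans
      (p₂_mem_Icc hδ n).2
  have hs : Summable c := Summable.of_nonneg_of_le h1 h2 (by simpa using (hasSum_tail 0).summable)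
  have h3 : g δ (l + 1) (m + 1) = ∑ n ∈ Finset.range m, c n := by
    rw [g, if_neg (Nat.succ_ne_zero l), Nat.add_sub_cancel, Finset.mul_sum,
      Finset.range_eq_Ico, ← Finset.sum_Ico_consecutive _ (Nat.zero_le l) (by omega : l ≤ m)]
    rw [Finset.sum_eq_zero (s := Finset.Ico 0 l), zero_add]
    · rw [← Finset.Ico_add_one_right_eq_Icc, (by omega : m + 1 + 1 = m + 2),
        (by omega : l + 1 + 1 = l + 2), ← Finset.sum_Ico_add' _ l m 2]
      exact Finset.sum_congr rfl fun n _ => by rw [hc]; ring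
    · intro n hn
      simp only [hc]
      rw [p₁_eq_zero (Finset.mem_Ico.1 hn).2]
      ring
  have h4 : δ * ((δ : ℝ) - 1) ^ l * (∑' n : ℕ, p₁ δ (l + 1) (n + 2) * p₂ δ (n + 2)) -
      g δ (l + 1) (m + 1) = ∑' n, c (n + m) := by
    rw [h3, ← tsum_mul_left, sub_eq_iff_eq_add, add_comm (tsum _), hs.sum_add_tsum_nat_add]
    exact tsum_congr fun n => by rw [hc]; ring
  rw [h4]
  refine ⟨tsum_nonneg fun n => h1 _, ?_⟩
  refine (Summable.tsum_le_tsum (fun n => h2 (n + m)) ((summable_nat_add_iff m).2 hs)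
    (hasSum_tail m).summable).trans ?_
  rw [(hasSum_tail m).tsum_eq, ε]
  have e1 : (2 : ℝ) ^ (-((m + 1 : ℕ) : ℤ) + 3) = (1 / 2) ^ m * 4 := by
    rw [zpow_add₀ (by norm_num), zpow_neg, zpow_natCast, one_div, inv_pow, pow_succ]
    field_simp
    norm_num
  -- The bound `ε` is generous: the factor `e ^ 2` is used only through being at least one.
  have e2 : (1 : ℝ) ≤ Real.exp 1 ^ 2 := one_le_pow₀ (Real.one_le_exp zero_le_one)
  have hm0 : (0 : ℝ) ≤ m := Nat.cast_nonneg m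
  rw [e1]
  push_cast
  calc (2 * (m : ℝ) + 8) * (1 / 2) ^ m
      ≤ 1 * (8 + 5 * ((m : ℝ) + 1) + (m + 1) ^ 2) * ((1 / 2) ^ m * 4) := by
        have : (0 : ℝ) < (1 / 2) ^ m := by positivity
        nlinarith [mul_nonneg hm0 this.le, mul_nonneg (mul_nonneg hm0 hm0) this.le]
    _ ≤ _ := by gcongr

end Tail

/-! ### The series for degree three -/

/-- Termwise integration: the coefficients are nonnegative, so the terms are dominated by their
values at the right end point, which are summable. -/
lemma hasSum_integral_pow {a : ℕ → ℝ} (ha : ∀ n, 0 ≤ a n) (c : ℕ) {F : ℝ → ℝ} {x : ℝ}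
    (hx : 0 ≤ x) (h : ∀ t ∈ Set.Icc 0 x, HasSum (fun n => a n * t ^ (n + c)) (F t)) :
    HasSum (fun n => a n * x ^ (n + (c + 1)) / ((n + c : ℕ) + 1)) (∫ t in (0 : ℝ)..x, F t) := by
  have h1 := intervalIntegral.hasSum_integral_of_dominated_convergence
    (F := fun n t => a n * t ^ (n + c)) (f := F) (μ := volume) (a := 0) (b := x)
    (fun n _ => a n * x ^ (n + c))
    (fun n => (by fun_prop : Continuous fun t : ℝ => a n * t ^ (n + c)).aestronglyMeasurable)
    (fun n => ae_of_all _ fun t ht => by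
      rw [Set.uIoc_of_le hx] at ht
      rw [Real.norm_of_nonneg (mul_nonneg (ha n) (pow_nonneg ht.1.le _))]
      exact mul_le_mul_of_nonneg_left (pow_le_pow_left₀ ht.1.le ht.2 _) (ha n))
    (ae_of_all _ fun t _ => (h x ⟨hx, le_rfl⟩).summable)
    intervalIntegrable_const
    (ae_of_all _ fun t ht => by
      rw [Set.uIoc_of_le hx] at ht
      exact h t ⟨ht.1.le, ht.2⟩)
  have h2 : ∀ n, ∫ t in (0 : ℝ)..x, a n * t ^ (n + c) =
      a n * x ^ (n + (c + 1)) / ((n + c : ℕ) + 1) := by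
    intro n
    rw [intervalIntegral.integral_const_mul, integral_pow, zero_pow (by omega), sub_zero,
      mul_div_assoc, add_assoc]
  simpa only [h2] using h1

/-- Summation by parts. Monotonicity makes the partial sums bounded, so the series converges, and
then the boundary term tends to zero. -/
lemma hasSum_of_hasSum_differences {s : ℕ → ℝ} (h0 : s 0 = 0) (hs : ∀ n, 0 ≤ s n)
    (hmono : Monotone s) {x F : ℝ} (hx : 0 ≤ x) (hx1 : x < 1)
    (h : HasSum (fun n => (s (n + 1) - s n) * x ^ (n + 2)) F) :
    HasSum (fun n => s n * x ^ (n + 1)) (F / (1 - x)) := by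
  have hpos : 0 < 1 - x := sub_pos.2 hx1
  have key : ∀ N, (1 - x) * ∑ n ∈ Finset.range N, s n * x ^ (n + 1) =
      ∑ n ∈ Finset.range N, (s (n + 1) - s n) * x ^ (n + 2) - s N * x ^ (N + 1) := by
    intro N
    induction N with
    | zero => simp [h0]
    | succ N ih =>
      rw [Finset.sum_range_succ, mul_add, ih, Finset.sum_range_succ]
      ring
  have hsum : Summable fun n => s n * x ^ (n + 1) := by
    refine summable_of_sum_range_le (c := F / (1 - x))
      (fun n => mul_nonneg (hs n) (pow_nonneg hx _)) fun N => ?_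
    rw [le_div_iff₀ hpos, mul_comm, key]
    have h1 := sum_le_hasSum (Finset.range N) (fun n _ => mul_nonneg
      (sub_nonneg.2 (hmono (Nat.le_succ n))) (pow_nonneg hx _)) h
    have h2 := mul_nonneg (hs N) (pow_nonneg hx (N + 1))
    linarith
  have h3 := (hsum.hasSum.mul_left (1 - x)).tendsto_sum_nat
  have h4 := h.tendsto_sum_nat.sub hsum.tendsto_atTop_zero
  simp only [← key, Finset.mul_sum, sub_zero] at h4
  rw [← eq_div_of_mul_eq hpos.ne' ((mul_comm _ _).trans (tendsto_nhds_unique h3 h4))]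
  exact hsum.hasSum

/-- `(-log (1 - x)) ^ l / l!`. -/
def logPow (l : ℕ) (x : ℝ) : ℝ := (-Real.log (1 - x)) ^ l / (l.factorial : ℝ)

lemma logPow_zero_right (l : ℕ) : logPow (l + 1) 0 = 0 := by simp [logPow]

lemma hasDerivAt_logPow (l : ℕ) {x : ℝ} (hx : x < 1) :
    HasDerivAt (logPow (l + 1)) (logPow l x / (1 - x)) x := by
  have hpos : 1 - x ≠ 0 := (sub_pos.2 hx).ne'
  have h := (((((hasDerivAt_id x).const_sub 1).log hpos).neg).pow (l + 1)).div_const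
    ((l + 1).factorial : ℝ)
  refine h.congr_deriv ?_
  have h1 : (l.factorial : ℝ) ≠ 0 := by exact_mod_cast l.factorial_ne_zero
  simp only [logPow, Nat.factorial_succ, Nat.add_sub_cancel, id, Pi.neg_apply]
  push_cast
  field_simp

/-- The derivative telescopes: differentiating `logPow m` gives `logPow (m - 1) / (1 - x)`, and the
factor `1 - y` cancels the denominator. -/
lemma hasDerivAt_sum_logPow (l : ℕ) {x : ℝ} (hx : x < 1) :
    HasDerivAt (fun y => (1 - y) * ∑ m ∈ Finset.range (l + 1), logPow m y) (-logPow l x) x := by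
  have hpos : 1 - x ≠ 0 := (sub_pos.2 hx).ne'
  induction l with
  | zero =>
    simpa [logPow] using (hasDerivAt_id x).const_sub 1
  | succ l ih =>
    simp only [Finset.sum_range_succ _ (l + 1), mul_add]
    refine (ih.add (((hasDerivAt_id x).const_sub 1).mul (hasDerivAt_logPow l hx))).congr_deriv ?_
    simp only [id]
    field_simp
    ring

/-- The function `(1 - x) ∑ n, ζ_n^l(1) x ^ (n + 1)`. -/
def zetaGen : ℕ → ℝ → ℝ
  | 0, x => x
  | l + 1, x => logPow (l + 1) x - zetaGen l x

lemma zetaGen_zero_right (l : ℕ) : zetaGen l 0 = 0 := by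
  induction l with
  | zero => rfl
  | succ l ih => rw [zetaGen, ih, logPow_zero_right, sub_zero]

/-- This differential equation is the counterpart of the recursion `zetaSum_succ` and identifies the
closed form `zetaGen` as the generating function. -/
lemma hasDerivAt_zetaGen (l : ℕ) {x : ℝ} (hx : x < 1) :
    HasDerivAt (zetaGen (l + 1)) (zetaGen l x / (1 - x)) x := by
  have hpos : 1 - x ≠ 0 := (sub_pos.2 hx).ne'
  induction l with
  | zero =>
    refine ((hasDerivAt_logPow 0 hx).sub (hasDerivAt_id x)).congr_deriv ?_
    simp only [logPow, zetaGen, pow_zero, Nat.factorial_zero, Nat.cast_one]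
    field_simp
    ring
  | succ l ih =>
    refine ((hasDerivAt_logPow (l + 1) hx).sub ih).congr_deriv ?_
    rw [zetaGen, sub_div]

lemma continuousAt_zetaGen (l : ℕ) {x : ℝ} (hx : x < 1) : ContinuousAt (zetaGen l) x := by
  cases l with
  | zero => exact continuousAt_id
  | succ l => exact (hasDerivAt_zetaGen l hx).continuousAt

lemma continuousOn_zetaGen_div (l : ℕ) {x : ℝ} (hx : 0 ≤ x) (hx1 : x < 1) :
    ContinuousOn (fun t => zetaGen l t / (1 - t)) (Set.uIcc 0 x) := by
  intro t ht
  rw [Set.uIcc_of_le hx] at ht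
  have ht1 : t < 1 := ht.2.trans_lt hx1
  exact ((continuousAt_zetaGen l ht1).div (by fun_prop) (sub_pos.2 ht1).ne').continuousWithinAt

lemma zetaSum_nonneg (k d : ℕ) {x : ℝ} (hx : 0 ≤ x) : 0 ≤ zetaSum k d x :=
  Finset.sum_nonneg fun J _ => Finset.prod_nonneg fun j _ => by positivity

/-- The differences of `ζ_n^(l+1)(1)` in `n` are `ζ_n^l(1) / (n + 2)`, so their generating series is
the integral of that of `ζ_n^l(1)`, which `hasDerivAt_zetaGen` evaluates. Summation by parts returns
from the differences to the sums. -/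
lemma hasSum_zetaSum (l : ℕ) {x : ℝ} (hx : 0 ≤ x) (hx1 : x < 1) :
    HasSum (fun n => zetaSum n l 1 * x ^ (n + 1)) (zetaGen l x / (1 - x)) := by
  induction l generalizing x with
  | zero =>
    simp only [zetaSum_zero_right, one_mul, zetaGen, pow_succ']
    exact (hasSum_geometric_of_lt_one hx hx1).mul_left x
  | succ l ih =>
    have hrec : ∀ n, zetaSum (n + 1) (l + 1) 1 - zetaSum n (l + 1) 1 =
        zetaSum n l 1 / ((n + 1 : ℕ) + 1) := fun n => by rw [zetaSum_succ]; ring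
    refine hasSum_of_hasSum_differences (zetaSum_zero_left _ _)
      (fun n => zetaSum_nonneg _ _ zero_le_one) (monotone_nat_of_le_succ fun n => ?_) hx hx1 ?_
    · rw [← sub_nonneg, hrec]
      exact div_nonneg (zetaSum_nonneg _ _ zero_le_one) (by positivity)
    · have h1 := hasSum_integral_pow (fun n => zetaSum_nonneg n l zero_le_one) 1 hx
        fun t ht => ih ht.1 (ht.2.trans_lt hx1)
      rw [intervalIntegral.integral_eq_sub_of_hasDerivAt
        (fun t ht => hasDerivAt_zetaGen l (by
          rw [Set.uIcc_of_le hx] at ht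
          exact ht.2.trans_lt hx1))
        (continuousOn_zetaGen_div l hx hx1).intervalIntegrable, zetaGen_zero_right, sub_zero] at h1
      refine h1.congr_fun fun n => ?_
      rw [hrec]
      ring

/-- The integral that gives the probability of distance `l + 1` in degree three. -/
def zetaIntegral (l : ℕ) : ℝ := ∫ t in (0 : ℝ)..1 / 2, zetaGen l t / (1 - t) * t

lemma hasSum_zetaIntegral (l : ℕ) :
    HasSum (fun n : ℕ => zetaSum n l 1 * (1 / 2) ^ (n + 3) / ((n : ℝ) + 3)) (zetaIntegral l) := by
  have h1 := hasSum_integral_pow (fun n => zetaSum_nonneg n l zero_le_one) 2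
    (F := fun t => zetaGen l t / (1 - t) * t) (x := 1 / 2) (by norm_num) fun t ht => by
      have := (hasSum_zetaSum l ht.1 (ht.2.trans_lt (by norm_num))).mul_right t
      refine this.congr_fun fun n => ?_
      ring
  refine h1.congr_fun fun n => ?_
  push_cast
  ring

lemma intervalIntegrable_zetaGen (l : ℕ) :
    IntervalIntegrable (fun t => zetaGen l t / (1 - t) * t) volume 0 (1 / 2) :=
  ((continuousOn_zetaGen_div l (by norm_num) (by norm_num)).mul
    continuousOn_id).intervalIntegrable

lemma logPow_half (l : ℕ) : logPow l (1 / 2) = Real.log 2 ^ l / (l.factorial : ℝ) := by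
  rw [logPow, (by norm_num : (1 : ℝ) - 1 / 2 = 2⁻¹), Real.log_inv, neg_neg]

lemma zetaIntegral_zero : zetaIntegral 0 = Real.log 2 - 5 / 8 := by
  have h := intervalIntegral.integral_eq_sub_of_hasDerivAt (a := 0) (b := 1 / 2)
    (f := fun t : ℝ => logPow 1 t - t - t ^ 2 / 2)
    (f' := fun t => zetaGen 0 t / (1 - t) * t) (fun t ht => by
      rw [Set.uIcc_of_le (by norm_num)] at ht
      have ht1 : t < 1 := ht.2.trans_lt (by norm_num)
      have hpos : 1 - t ≠ 0 := (sub_pos.2 ht1).ne'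
      refine (((hasDerivAt_logPow 0 ht1).sub (hasDerivAt_id t)).sub
        ((hasDerivAt_pow 2 t).div_const 2)).congr_deriv ?_
      simp only [logPow, zetaGen, pow_zero, Nat.factorial_zero, Nat.cast_one]
      field_simp
      push_cast
      ring) (intervalIntegrable_zetaGen 0)
  rw [zetaIntegral, h, logPow_half, logPow_zero_right]
  norm_num
  ring

/-- Two consecutive functions `zetaGen` add up to `logPow (l + 1)`, so the integrand is `logPow (l +
1) t * t / (1 - t)`, that is `logPow (l + 1) t / (1 - t) - logPow (l + 1) t`, and both parts have
explicit antiderivatives. The `-1` is the value of the antiderivative at zero. -/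
lemma zetaIntegral_succ (l : ℕ) : zetaIntegral (l + 1) + zetaIntegral l =
    Real.log 2 ^ (l + 2) / ((l + 2).factorial : ℝ) - 1 +
      (∑ m ∈ Finset.range (l + 2), Real.log 2 ^ m / (m.factorial : ℝ)) / 2 := by
  rw [zetaIntegral, zetaIntegral, ← intervalIntegral.integral_add (intervalIntegrable_zetaGen _)
    (intervalIntegrable_zetaGen _)]
  rw [intervalIntegral.integral_eq_sub_of_hasDerivAt
    (f := fun t : ℝ => logPow (l + 2) t + (1 - t) * ∑ m ∈ Finset.range (l + 2), logPow m t)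
    (fun t ht => by
      rw [Set.uIcc_of_le (by norm_num)] at ht
      have ht1 : t < 1 := ht.2.trans_lt (by norm_num)
      have hpos : 1 - t ≠ 0 := (sub_pos.2 ht1).ne'
      refine ((hasDerivAt_logPow (l + 1) ht1).add (hasDerivAt_sum_logPow (l + 1) ht1)).congr_deriv ?_
      rw [zetaGen]
      field_simp
      ring) ((intervalIntegrable_zetaGen _).add (intervalIntegrable_zetaGen _))]
  simp only [logPow_half, Finset.sum_range_succ' _ (l + 1), logPow_zero_right]
  simp [logPow]
  ring

/-- The alternating solution of the recursion `zetaIntegral_succ`; the `1 / 4` is fixed by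
`zetaIntegral_zero`. -/
lemma zetaIntegral_eq (l : ℕ) : 2 * zetaIntegral l = (-1) ^ (l + 1) *
    (1 / 4 + ∑ j ∈ Finset.Icc 1 (l + 1), (-1) ^ j *
        (Real.log 2 ^ j / (j.factorial : ℝ) - 2 +
          ∑ m ∈ Finset.range (j + 1), Real.log 2 ^ m / (m.factorial : ℝ))) := by
  induction l with
  | zero =>
    rw [zetaIntegral_zero]
    simp [Finset.sum_range_succ]
    ring
  | succ l ih =>
    rw [eq_sub_of_add_eq (zetaIntegral_succ l), mul_sub, ih,
      Finset.sum_Icc_succ_top (by omega : 1 ≤ l + 1 + 1), Finset.sum_range_succ _ (l + 2)]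
    have : ((-1 : ℝ) ^ (l + 1 + 1)) * (-1) ^ (l + 1 + 1) = 1 := by
      rw [← mul_pow]; norm_num
    have e : ((-1 : ℝ) ^ (l + 1)) = - (-1) ^ (l + 1 + 1) := by ring
    rw [e]
    set A := ∑ j ∈ Finset.Icc 1 (l + 1), (-1 : ℝ) ^ j *
        (Real.log 2 ^ j / (j.factorial : ℝ) - 2 +
          ∑ m ∈ Finset.range (j + 1), Real.log 2 ^ m / (m.factorial : ℝ))
    linear_combination (-(Real.log 2 ^ (l + 2) / ((l + 2).factorial : ℝ) - 2 +
      (∑ m ∈ Finset.range (l + 2), Real.log 2 ^ m / (m.factorial : ℝ) +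
        Real.log 2 ^ (l + 2) / ((l + 2).factorial : ℝ)))) * this

/-! ### The factors of the series in degree three -/

lemma edgeWeight_three : edgeWeight 3 = 1 := by rw [edgeWeight]; norm_num

lemma risingFactorial_one (n : ℕ) : risingFactorial 1 n = (n.factorial : ℝ) := by
  rw [risingFactorial, ← Finset.prod_range_add_one_eq_factorial]
  push_cast
  exact Finset.prod_congr rfl fun i _ => add_comm _ _

lemma risingFactorial_two (n : ℕ) : risingFactorial 2 n = ((n + 1).factorial : ℝ) := by
  rw [risingFactorial, ← Finset.prod_range_add_one_eq_factorial, Finset.prod_range_succ']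
  push_cast
  rw [mul_one]
  exact Finset.prod_congr rfl fun i _ => by ring

lemma p₁_three (l n : ℕ) :
    p₁ 3 (l + 1) (n + 2) = 2 / (((n : ℝ) + 2) * (n + 3)) * zetaSum n l 1 := by
  have h : ((n + 1).factorial : ℝ) ≠ 0 := by exact_mod_cast (n + 1).factorial_ne_zero
  rw [p₁, Nat.add_sub_cancel, Nat.add_sub_cancel, (by omega : n + 2 - 1 = n + 1)]
  norm_num
  rw [risingFactorial_one, risingFactorial_two, Nat.factorial_succ (n + 2),
    Nat.factorial_succ (n + 1)]
  push_cast
  left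
  field_simp
  ring

lemma p₂_three (n : ℕ) : p₂ 3 (n + 2) = (n + 2) * (1 / 2) ^ (n + 3) := by
  have hn : (n : ℝ) + 3 ≠ 0 := by positivity
  rw [p₂_eq_integral le_rfl, edgeWeight_three]
  have e1 : (n : ℝ) + 2 + 2 * 1 = (n + 3) + 1 := by ring
  have e2 : (n : ℝ) + 1 + 1 = ((n + 2 : ℕ) : ℝ) := by push_cast; ring
  have e3 : (n : ℝ) + 1 + 2 * 1 = ((n + 3 : ℕ) : ℝ) := by push_cast; ring
  have e4 : (n : ℝ) + 2 + 1 = n + 3 := by ring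
  have hg : Real.Gamma ((n : ℝ) + 3) ≠ 0 := (Real.Gamma_pos_of_pos (by positivity)).ne'
  have hi : ∫ t in (0 : ℝ)..1 / 2, t ^ ((n + 2 : ℕ) : ℝ) * (1 - t) ^ ((1 : ℝ) - 1) =
      (1 / 2) ^ (n + 3) / (n + 3) := by
    simp only [sub_self, Real.rpow_zero, mul_one, Real.rpow_natCast]
    rw [integral_pow, zero_pow (by omega), sub_zero]
    push_cast
    ring
  rw [e1, Real.Gamma_add_one hn, e2, e3, hi, e4, one_add_one_eq_two, Real.Gamma_two,
    Real.rpow_natCast]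
  field_simp
  ring

/-- In the product of `p₁_three` and `p₂_three` the factor `n + 2` cancels, which leaves twice the
terms of `hasSum_zetaIntegral`. -/
lemma f_succ (l : ℕ) : f (l + 1) =
    (3 : ℕ) * (((3 : ℕ) : ℝ) - 1) ^ l * ∑' n : ℕ, p₁ 3 (l + 1) (n + 2) * p₂ 3 (n + 2) := by
  have h1 : ∑' n : ℕ, p₁ 3 (l + 1) (n + 2) * p₂ 3 (n + 2) = 2 * zetaIntegral l := by
    rw [← ((hasSum_zetaIntegral l).mul_left 2).tsum_eq]
    refine tsum_congr fun n => ?_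
    have h2 : (n : ℝ) + 2 ≠ 0 := by positivity
    rw [p₁_three, p₂_three]
    field_simp
  rw [h1, zetaIntegral_eq, f, if_neg (Nat.succ_ne_zero l), Nat.add_sub_cancel]
  norm_num
  ring

end RumorSource

end

theorem corollary1 {V Ω : Type*} [Countable V] [Infinite V] [MeasurableSpace Ω]
    (G : SimpleGraph V) [G.LocallyFinite] (δ : ℕ) (hδ : 3 ≤ δ)
    (hG : G.IsTree) (hreg : G.IsRegularOfDegree δ) (v₁ : V)
    (P : Measure Ω) [IsProbabilityMeasure P]
    (τ : G.Dart → Ω → ℝ) (hmeas : ∀ e, Measurable (τ e))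
    (hindep : iIndepFun τ P) (hlaw : ∀ e, HasLaw (τ e) (expMeasure 1) P)
    (Vhat : ℕ → Ω → V) (hVhat : ∀ n, 1 ≤ n → RumorSource.IsMLEstimate P τ v₁ n (Vhat n)) :
    (δ = 3 → ∀ d : ℕ,
      Tendsto (fun n => P.real {ω | G.dist (Vhat n ω) v₁ ≤ d}) atTop
        (𝓝 (∑ l ∈ Finset.range (d + 1), RumorSource.f l))) ∧
    (∀ d : ℕ, ∃ L : ℝ,
      Tendsto (fun n => P.real {ω | G.dist (Vhat n ω) v₁ ≤ d}) atTop (𝓝 L) ∧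
      ∀ m : ℕ, d + 1 ≤ m →
        0 ≤ L - ∑ l ∈ Finset.range (d + 1), RumorSource.g δ l m ∧
        L - ∑ l ∈ Finset.range (d + 1), RumorSource.g δ l m ≤ d * RumorSource.ε m) := by
  have M : RumorSource.ExpSpread G δ P τ := ⟨hG, hδ, hreg, hmeas, hindep, hlaw⟩
  have hlim := M.tendsto_dist_le hVhat
  refine ⟨?_, fun d => ⟨_, hlim d, fun m hm => ?_⟩⟩
  · rintro rfl d
    convert hlim d using 2
    rw [Finset.sum_range_succ', add_comm]
    congr 1
    exact Finset.sum_congr rfl fun l _ => RumorSource.f_succ l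
  · have hg : RumorSource.g δ 0 m = RumorSource.correctLimit δ := by rw [RumorSource.g, if_pos rfl]
    -- The terms of distance zero agree exactly, so only the `d` remainders of the series are left,
    -- each at most `ε m`.
    rw [Finset.sum_range_succ', hg, add_comm (RumorSource.correctLimit δ),
      add_sub_add_right_eq_sub, ← Finset.sum_sub_distrib]
    have h : ∀ l ∈ Finset.range d, _ := fun l hl => RumorSource.remainder_mem_Icc hG hδ hreg v₁
      (by have := Finset.mem_range.1 hl; omega : l + 2 ≤ m)
    refine ⟨Finset.sum_nonneg fun l hl => (h l hl).1, ?_⟩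
    refine (Finset.sum_le_sum fun l hl => (h l hl).2).trans_eq ?_
    rw [Finset.sum_const, Finset.card_range, nsmul_eq_mul]
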